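/- Let $S$ be a complex analytic surface with a holomorphic symplectic form $\omega$ and a holomorphic one-dimensional foliation $\mathcal F$. Let $\mathrm{Discs}$ be the space of embedded formal discs in $S$ with first-order tangency to $\mathcal F$: a point $t$ is a point $s\in S$ together with a homomorphism $\psi:\mathcal O_{S,s}\to{\bf C}[[z]]$ that is onto every truncation ${\bf C}[[z]]/(z^{n+1})$ and sends a local coordinate $x$ on the space of leaves, with $x(s)=0$, to a series of order exactly $2$; two such $\psi$ are identified if they differ by an automorphism of ${\bf C}[[z]]$. Write $\widehat{\mathbb D}_t$ for the disc, $\widehat{\mathbb D}_t^*$ for the disc punctured at its tangency point, and $T_t\mathrm{Discs}=\Gamma(\widehat{\mathbb D}_t,T_S|_{\widehat{\mathbb D}_t}/T_{\widehat{\mathbb D}_t})$, which is identified with $\Omega^1(\widehat{\mathbb D}_t)$ by contraction with $\omega$. As a functor, $\mathrm{Discs}$ is tested on finite-dimensional parameter spaces: an analytic map $U\to\mathrm{Discs}$, $U\subset{\bf C}^n$ open, is a family of discs that locally on $U$ is given by homomorphisms $\psi_\lambda$ as above whose base point depends continuously on $\lambda$ and such that for every analytic function $f$ on $S$ the coefficients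 of $\psi_\lambda(f)$ are analytic in $\lambda$; analytic sections and differential forms on $\mathrm{Discs}$ are understood through their pull-backs to such $U$. Let $\mathcal H$ be the bundle on $\mathrm{Discs}$ with fibre $$\mathcal H_t=\mathrm{Ker}\big(\mathrm{Res}:\Omega^1(\widehat{\mathbb D}_t^*)\to{\bf C}\big),\qquad \langle df_1,df_2\rangle=\mathrm{Res}(f_1\,df_2).$$ The canonical non-linear connection $\nabla_{univ}$ on the family of punctured discs lifts a tangent vector $v$ to the unique representative of $v$ in $\Gamma(\widehat{\mathbb D}_t^*,T_S)$ that is a section of $T_{\mathcal F}$; in a coordinate $z$ on an analytic family of discs it is $\partial_v+u_v\partial_z$, where $u_v\in{\bf C}((z))$ is determined by $\partial_v\psi(x)+u_v\,\partial_z\psi(x)=0$ for leaf coordinates $x$. The Lie derivative of relative $1$-forms, $\nabla_v(g\,dz)=\big(\partial_v g+\partial_z(u_v g)\big)dz$, is then a well-defined (independent of the coordinate) flat linear connection $\nabla$ on $\mathcal H$ that preserves the symplectic pairing. Let $\phi$ be the $\mathcal H$-valued $1$-form on $\mathrm{Discs}$ given by $$T_t\mathrm{Discs}\simeq\Omega^1(\widehat{\mathbb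 D}_t)\hookrightarrow \mathcal H_t.$$ Then $\phi$ is covariantly closed, that is, over every analytic family $U\to\mathrm{Discs}$ and for all constant vector fields $v,w$ on $U$ one has $\nabla_v(\phi(w))=\nabla_w(\phi(v))$; and $\phi$ is a Lagrangian embedding of the tangent bundle of $\mathrm{Discs}$ into the symplectic bundle $\mathcal H$: each $\phi_t$ is injective and its image equals its own orthogonal complement in $\mathcal H_t$. -/

import Mathlib

open scoped Manifold ContDiff PowerSeries LaurentSeries Topology

noncomputable section

namespace FormalDiscs

/-! ### Formal series: differentials, residues, changes of coordinate -/

/-- A derivation of `ℂ⟦X⟧` is determined by its value on `X`. -/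
theorem derivation_eq (E : Derivation ℂ ℂ⟦X⟧ ℂ⟦X⟧) (f : ℂ⟦X⟧) :
    E f = E PowerSeries.X * PowerSeries.derivative ℂ f := by
  set D : Derivation ℂ ℂ⟦X⟧ ℂ⟦X⟧ := E - E PowerSeries.X • PowerSeries.derivative ℂ with hD
  have hX : D PowerSeries.X = 0 := by simp [hD]
  have hpoly : ∀ q : Polynomial ℂ, D (q : ℂ⟦X⟧) = 0 := by
    intro q
    induction q using Polynomial.induction_on' with
    | add a b ha hb => simp [ha, hb]
    | monomial n a =>
      have : ((Polynomial.monomial n a : Polynomial ℂ) : ℂ⟦X⟧)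
          = a • (PowerSeries.X : ℂ⟦X⟧) ^ n := by
        rw [← Polynomial.C_mul_X_pow_eq_monomial, Polynomial.coe_mul, Polynomial.coe_pow,
          Polynomial.coe_C, Polynomial.coe_X, PowerSeries.smul_eq_C_mul]
      rw [this, Derivation.map_smul, Derivation.leibniz_pow, hX]
      simp
  have hzero : D f = 0 := by
    ext n
    have hdvd : (PowerSeries.X : ℂ⟦X⟧) ^ (n + 2) ∣ f - (f.trunc (n + 2) : ℂ⟦X⟧) := by
      rw [PowerSeries.X_pow_dvd_iff]
      intro m hm
      simp [PowerSeries.coeff_trunc, hm]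
    obtain ⟨g, hg⟩ := hdvd
    have hf : f = (f.trunc (n + 2) : ℂ⟦X⟧) + PowerSeries.X ^ (n + 2) * g := by
      rw [← hg]; ring
    rw [hf, map_add, hpoly, Derivation.leibniz, Derivation.leibniz_pow, hX]
    simp [PowerSeries.coeff_X_pow_mul']
  have := hzero
  simp only [hD, Derivation.sub_apply, Derivation.smul_apply, smul_eq_mul] at this
  exact sub_eq_zero.mp this

/-- Chain rule for an automorphism of `ℂ⟦X⟧`. -/
theorem derivative_algEquiv (σ : ℂ⟦X⟧ ≃ₐ[ℂ] ℂ⟦X⟧) (f : ℂ⟦X⟧) :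
    PowerSeries.derivative ℂ (σ f)
      = σ (PowerSeries.derivative ℂ f) * PowerSeries.derivative ℂ (σ PowerSeries.X) := by
  let E : Derivation ℂ ℂ⟦X⟧ ℂ⟦X⟧ := Derivation.mk'
    (σ.symm.toLinearMap ∘ₗ (PowerSeries.derivative ℂ : ℂ⟦X⟧ →ₗ[ℂ] ℂ⟦X⟧) ∘ₗ σ.toLinearMap)
    (by intro a b; simp)
  have h := derivation_eq E f
  have h2 := congrArg σ h
  have e1 : ∀ g, E g = σ.symm (PowerSeries.derivative ℂ (σ g)) := fun _ => rfl
  rw [map_mul, e1, e1, AlgEquiv.apply_symm_apply, AlgEquiv.apply_symm_apply] at h2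
  rw [h2, mul_comm]

/-- The extension to `ℂ⸨X⸩ = Frac ℂ⟦X⟧` of an automorphism of `ℂ⟦X⟧`, i.e. of a change of the
coordinate on the formal disc. -/
def laurentEquiv (σ : ℂ⟦X⟧ ≃ₐ[ℂ] ℂ⟦X⟧) : ℂ⸨X⸩ ≃+* ℂ⸨X⸩ :=
  IsFractionRing.ringEquivOfRingEquiv σ.toRingEquiv

theorem laurentEquiv_algebraMap (σ : ℂ⟦X⟧ ≃ₐ[ℂ] ℂ⟦X⟧) (f : ℂ⟦X⟧) :
    laurentEquiv σ (algebraMap ℂ⟦X⟧ ℂ⸨X⸩ f) = algebraMap ℂ⟦X⟧ ℂ⸨X⸩ (σ f) :=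
  IsFractionRing.ringEquivOfRingEquiv_algebraMap _ _

theorem smul_eq_algebraMap_C (c : ℂ) (g : ℂ⸨X⸩) :
    c • g = algebraMap ℂ⟦X⟧ ℂ⸨X⸩ (PowerSeries.C c) * g := by
  rw [LaurentSeries.coe_algebraMap, HahnSeries.ofPowerSeries_C, HahnSeries.C_mul_eq_smul]

theorem laurent_smul_mul (c : ℂ) (f g : ℂ⸨X⸩) : (c • f) * g = c • (f * g) := by
  rw [smul_eq_algebraMap_C, smul_eq_algebraMap_C, mul_assoc]

theorem laurent_mul_smul (c : ℂ) (f g : ℂ⸨X⸩) : f * (c • g) = c • (f * g) := by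
  rw [smul_eq_algebraMap_C, smul_eq_algebraMap_C, mul_left_comm]

theorem laurentEquiv_smul (σ : ℂ⟦X⟧ ≃ₐ[ℂ] ℂ⟦X⟧) (c : ℂ) (g : ℂ⸨X⸩) :
    laurentEquiv σ (c • g) = c • laurentEquiv σ g := by
  rw [smul_eq_algebraMap_C, map_mul, laurentEquiv_algebraMap, smul_eq_algebraMap_C]
  congr 2
  exact σ.commutes c

/-- Change of coordinate for the `1`-form `g(z) dz` on the punctured disc:
it becomes `σ(g) dσ(z)`. -/
def formChange (σ : ℂ⟦X⟧ ≃ₐ[ℂ] ℂ⟦X⟧) : ℂ⸨X⸩ →ₗ[ℂ] ℂ⸨X⸩ where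
  toFun g := laurentEquiv σ g *
    algebraMap ℂ⟦X⟧ ℂ⸨X⸩ (PowerSeries.derivative ℂ (σ PowerSeries.X))
  map_add' f g := by rw [map_add, add_mul]
  map_smul' c g := by
    rw [laurentEquiv_smul, laurent_smul_mul, RingHom.id_apply]

/-- The residue of `g(z) dz`. -/
def residue (g : ℂ⸨X⸩) : ℂ := g.coeff (-1)

/-- The primitive without constant term of `g(z) dz`; it is a primitive when the residue
vanishes. -/
def primitive : ℂ⸨X⸩ →ₗ[ℂ] ℂ⸨X⸩ where
  toFun g := HahnSeries.ofSuppBddBelow (fun n : ℤ => g.coeff (n - 1) / (n : ℂ)) <| by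
    refine ⟨g.order, fun n h => ?_⟩
    contrapose! h
    have : g.coeff (n - 1) = 0 := HahnSeries.coeff_eq_zero_of_lt_order (by omega)
    simp [this]
  map_add' f g := by
    ext n
    change (f + g).coeff (n - 1) / (n : ℂ) = f.coeff (n - 1) / (n : ℂ) + g.coeff (n - 1) / (n : ℂ)
    simp [add_div]
  map_smul' c g := by
    ext n
    change (c • g).coeff (n - 1) / (n : ℂ) = c * (g.coeff (n - 1) / (n : ℂ))
    simp [mul_div_assoc]

/-! ### Surfaces: local rings, symplectic forms, foliations -/

section Surface

variable {S : Type*} [TopologicalSpace S] [ChartedSpace (ℂ × ℂ) S]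

/-- `f : S → ℂ` is analytic at (that is, near) the point `s`. -/
def IsAnalyticAt (f : S → ℂ) (s : S) : Prop := ContMDiffAt 𝓘(ℂ, ℂ × ℂ) 𝓘(ℂ, ℂ) ω f s

/-- The differential at `m` of a function on the surface. -/
def diff (f : S → ℂ) (m : S) : TangentSpace 𝓘(ℂ, ℂ × ℂ) m →ₗ[ℂ] ℂ :=
  (mfderiv 𝓘(ℂ, ℂ × ℂ) 𝓘(ℂ, ℂ) f m : (ℂ × ℂ) →L[ℂ] ℂ).toLinearMap

/-- The algebra of functions that are analytic at `s`. -/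
def analyticFunctions (s : S) : Subalgebra ℂ (S → ℂ) where
  carrier := {f | IsAnalyticAt f s}
  mul_mem' hf hg := ContMDiffAt.mul hf hg
  add_mem' hf hg := ContMDiffAt.add hf hg
  algebraMap_mem' _ := contMDiffAt_const

/-- The ideal of functions that vanish near `s`. -/
def vanishingIdeal (s : S) : Ideal (analyticFunctions s) where
  carrier := {f | ∀ᶠ m in 𝓝 s, (f : S → ℂ) m = 0}
  add_mem' hf hg := by
    filter_upwards [hf, hg] with m h1 h2
    simp [h1, h2]
  zero_mem' := by simp
  smul_mem' c f hf := by
    filter_upwards [hf] with m h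
    simp [h]

/-- The local ring of the surface at `s`: germs at `s` of analytic functions. -/
def Stalk (s : S) : Type _ := analyticFunctions s ⧸ vanishingIdeal s

instance (s : S) : CommRing (Stalk s) :=
  inferInstanceAs (CommRing (analyticFunctions s ⧸ vanishingIdeal s))

instance (s : S) : Algebra ℂ (Stalk s) :=
  inferInstanceAs (Algebra ℂ (analyticFunctions s ⧸ vanishingIdeal s))

open Classical in
/-- The germ at `s` of a function that is analytic at `s` (and `0` for other functions). -/
def germ (s : S) (f : S → ℂ) : Stalk s :=
  if h : IsAnalyticAt f s then
    (Ideal.Quotient.mk (vanishingIdeal s) ⟨f, h⟩ : analyticFunctions s ⧸ vanishingIdeal s)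
  else 0

/-- The first coordinate function of the preferred chart at `s`. -/
def coord₁ (s : S) : S → ℂ := fun m => (extChartAt 𝓘(ℂ, ℂ × ℂ) s m).1

/-- The second coordinate function of the preferred chart at `s`. -/
def coord₂ (s : S) : S → ℂ := fun m => (extChartAt 𝓘(ℂ, ℂ × ℂ) s m).2

variable (S) in
/-- A holomorphic symplectic form on a complex surface: a nondegenerate holomorphic `2`-form,
`ω = h da ∧ db` with `h` holomorphic in the local coordinates `(a, b)`. (A holomorphic `2`-form on
a surface is automatically closed.) -/
structure SymplecticForm where
  form : ∀ s : S, TangentSpace 𝓘(ℂ, ℂ × ℂ) s →ₗ[ℂ] TangentSpace 𝓘(ℂ, ℂ × ℂ) s →ₗ[ℂ] ℂ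
  alternating : ∀ s v, form s v v = 0
  nondegenerate : ∀ s v, (∀ w, form s v w = 0) → v = 0
  analytic : ∀ s : S, ∃ h : S → ℂ, IsAnalyticAt h s ∧ ∀ᶠ m in 𝓝 s, ∀ v w, form m v w =
    h m * (diff (coord₁ s) m v * diff (coord₂ s) m w - diff (coord₁ s) m w * diff (coord₂ s) m v)

/-- The coefficient `h` of `ω = h da ∧ db` in the preferred chart at `s`; its germ at `s` is
uniquely determined. -/
def SymplecticForm.density (Ω : SymplecticForm S) (s : S) : S → ℂ := (Ω.analytic s).choose

variable (S) in
/-- A holomorphic one-dimensional foliation of a complex surface: a field of lines that near every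
point is the field of kernels of the differential of a holomorphic function, so that the leaves are
locally the level curves of this function. -/
structure Foliation where
  line : ∀ s : S, Submodule ℂ (TangentSpace 𝓘(ℂ, ℂ × ℂ) s)
  finrank_line : ∀ s, Module.finrank ℂ (line s) = 1
  exists_leafCoord : ∀ s : S, ∃ x : S → ℂ, IsAnalyticAt x s ∧
    ∀ᶠ m in 𝓝 s, LinearMap.ker (diff x m) = line m

/-- `x` is (near `s`) a local coordinate on the space of leaves. -/
def Foliation.IsLeafCoord (F : Foliation S) (s : S) (x : S → ℂ) : Prop :=
  IsAnalyticAt x s ∧ ∀ᶠ m in 𝓝 s, LinearMap.ker (diff x m) = F.line m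

/-! ### Formal discs -/

/-- A formal disc through `s` with first-order tangency to the foliation at `s`, together with a
coordinate on it: a homomorphism from the local ring at `s` to `ℂ⟦X⟧` which is onto every
truncation `ℂ⟦X⟧/(X^(n+1))` and maps a leaf coordinate, normalised to vanish at `s`, to
`𝔪² ∖ 𝔪³`. -/
structure DiscParam (F : Foliation S) (s : S) where
  hom : Stalk s →ₐ[ℂ] ℂ⟦X⟧
  surjective : ∀ n : ℕ, Function.Surjective fun g : Stalk s =>
    Ideal.Quotient.mk (Ideal.span {(PowerSeries.X : ℂ⟦X⟧) ^ (n + 1)}) (hom g)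
  tangency : ∀ x : S → ℂ, F.IsLeafCoord s x →
    (hom (germ s x) - PowerSeries.C (x s)).order = 2

variable {F : Foliation S}

/-- The pull-back to the disc of a function that is analytic at the centre. -/
def DiscParam.pull {s : S} (p : DiscParam F s) (f : S → ℂ) : ℂ⟦X⟧ := p.hom (germ s f)

/-- `p'` is obtained from `p` by the change of coordinate `σ` on the disc. -/
def Reparam {s : S} (σ : ℂ⟦X⟧ ≃ₐ[ℂ] ℂ⟦X⟧) (p p' : DiscParam F s) : Prop :=
  ∀ g, p'.hom g = σ (p.hom g)

/-- Coordinatised discs that differ by a change of coordinate only are the same disc. -/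
instance discSetoid (F : Foliation S) (s : S) : Setoid (DiscParam F s) where
  r p p' := ∃ σ, Reparam σ p p'
  iseqv :=
    { refl := fun p => ⟨AlgEquiv.refl, fun _ => rfl⟩
      symm := by
        rintro p p' ⟨σ, h⟩
        exact ⟨σ.symm, fun g => by rw [h g, AlgEquiv.symm_apply_apply]⟩
      trans := by
        rintro p p' p'' ⟨σ, h⟩ ⟨τ, h'⟩
        exact ⟨σ.trans τ, fun g => by rw [h' g, h g, AlgEquiv.trans_apply]⟩ }

/-- The set of formal discs with first-order tangency to the foliation: the centre (tangency
point) and a disc through it, up to changes of coordinate. -/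
structure Discs (F : Foliation S) where
  center : S
  disc : Quotient (discSetoid F center)

/-- The coordinatisations of a disc. Objects on the disc are described below as families indexed
by all of them which are compatible with the changes of coordinate. -/
def Discs.Param (t : Discs F) : Type _ :=
  {p : DiscParam F t.center // Quotient.mk (discSetoid F t.center) p = t.disc}

theorem Discs.exists_param (t : Discs F) : Nonempty t.Param :=
  let ⟨p, hp⟩ := Quotient.exists_rep t.disc
  ⟨⟨p, hp⟩⟩

/-- Pull-back of functions in a coordinatisation of the disc. -/
def Discs.Param.pull {t : Discs F} (p : t.Param) (f : S → ℂ) : ℂ⟦X⟧ := p.1.pull f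

/-- The `1`-forms with zero residue on the punctured disc. -/
def residueFreeForms (t : Discs F) : Submodule ℂ (t.Param → ℂ⸨X⸩) where
  carrier := {γ | (∀ p p' : t.Param, ∀ σ, Reparam σ p.1 p'.1 → γ p' = formChange σ (γ p)) ∧
    ∀ p, residue (γ p) = 0}
  add_mem' := by
    rintro γ η ⟨h1, h2⟩ ⟨h3, h4⟩
    refine ⟨fun p p' σ h => ?_, fun p => ?_⟩
    · rw [Pi.add_apply, Pi.add_apply, map_add, h1 p p' σ h, h3 p p' σ h]
    · have e2 := h2 p
      have e4 := h4 p
      simp only [residue] at e2 e4 ⊢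
      simp [e2, e4]
  zero_mem' := ⟨fun p p' σ _ => by simp, fun p => by simp [residue]⟩
  smul_mem' := by
    rintro c γ ⟨h1, h2⟩
    refine ⟨fun p p' σ h => ?_, fun p => ?_⟩
    · rw [Pi.smul_apply, Pi.smul_apply, map_smul, h1 p p' σ h]
    · have e2 := h2 p
      simp only [residue] at e2 ⊢
      simp [e2]

/-- The `1`-forms on the (unpunctured) disc, as a subspace of those on the punctured disc. -/
def regularForms (t : Discs F) : Submodule ℂ (t.Param → ℂ⸨X⸩) where
  carrier := {γ | (∀ p p' : t.Param, ∀ σ, Reparam σ p.1 p'.1 → γ p' = formChange σ (γ p)) ∧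
    ∀ p, ∃ g : ℂ⟦X⟧, γ p = algebraMap ℂ⟦X⟧ ℂ⸨X⸩ g}
  add_mem' := by
    rintro γ η ⟨h1, h2⟩ ⟨h3, h4⟩
    refine ⟨fun p p' σ h => ?_, fun p => ?_⟩
    · rw [Pi.add_apply, Pi.add_apply, map_add, h1 p p' σ h, h3 p p' σ h]
    · obtain ⟨f, hf⟩ := h2 p
      obtain ⟨g, hg⟩ := h4 p
      exact ⟨f + g, by rw [Pi.add_apply, hf, hg, map_add]⟩
  zero_mem' := ⟨fun p p' σ _ => by simp, fun p => ⟨0, by simp⟩⟩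
  smul_mem' := by
    rintro c γ ⟨h1, h2⟩
    refine ⟨fun p p' σ h => ?_, fun p => ?_⟩
    · rw [Pi.smul_apply, Pi.smul_apply, map_smul, h1 p p' σ h]
    · obtain ⟨f, hf⟩ := h2 p
      exact ⟨PowerSeries.C c * f, by rw [Pi.smul_apply, hf, smul_eq_algebraMap_C, map_mul]⟩

theorem regularForms_le (t : Discs F) : regularForms t ≤ residueFreeForms t := by
  rintro γ ⟨h1, h2⟩
  refine ⟨h1, fun p => ?_⟩
  obtain ⟨g, hg⟩ := h2 p
  rw [residue, hg, LaurentSeries.coe_algebraMap, HahnSeries.ofPowerSeries_apply]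
  apply HahnSeries.embDomain_of_notMem_range
  rintro ⟨n, hn⟩
  simp at hn

/-- The fibre at `t` of the bundle `H`: the kernel of the residue on `Ω¹(D_t^*)`. -/
def HFiber (t : Discs F) : Type _ := residueFreeForms t

instance (t : Discs F) : AddCommGroup (HFiber t) :=
  inferInstanceAs (AddCommGroup (residueFreeForms t))

instance (t : Discs F) : Module ℂ (HFiber t) :=
  inferInstanceAs (Module ℂ (residueFreeForms t))

/-- The space `Ω¹(D_t)` of `1`-forms on the disc. -/
def RegularForms (t : Discs F) : Type _ := regularForms t

instance (t : Discs F) : AddCommGroup (RegularForms t) :=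
  inferInstanceAs (AddCommGroup (regularForms t))

instance (t : Discs F) : Module ℂ (RegularForms t) :=
  inferInstanceAs (Module ℂ (regularForms t))

/-- The inclusion `Ω¹(D_t) ↪ H_t`. -/
def RegularForms.incl (t : Discs F) : RegularForms t →ₗ[ℂ] HFiber t :=
  Submodule.inclusion (regularForms_le t)

/-- The expression of an element of `H_t` in a coordinate: `γ = (γ.coord p)(z) dz`. -/
def HFiber.coord {t : Discs F} (γ : HFiber t) (p : t.Param) : ℂ⸨X⸩ := γ.1 p

theorem HFiber.coord_add {t : Discs F} (γ η : HFiber t) (p : t.Param) :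
    (γ + η).coord p = γ.coord p + η.coord p := rfl

theorem HFiber.coord_smul {t : Discs F} (c : ℂ) (γ : HFiber t) (p : t.Param) :
    (c • γ).coord p = c • γ.coord p := rfl

/-- The symplectic pairing `⟨df, η⟩ = Res (f η)` on the fibre of `H`, computed in a coordinate. -/
def pairing (t : Discs F) : LinearMap.BilinForm ℂ (HFiber t) :=
  LinearMap.mk₂ ℂ
    (fun γ η => residue
      (primitive (γ.coord t.exists_param.some) * η.coord t.exists_param.some))
    (by intro a b c; simp [residue, HFiber.coord_add, add_mul])
    (by intro c a b; simp [residue, HFiber.coord_smul, laurent_smul_mul])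
    (by intro a b c; simp [residue, HFiber.coord_add, mul_add])
    (by intro c a b; simp [residue, HFiber.coord_smul, laurent_mul_smul])

/-- The sections over the disc of the tangent bundle of the surface: derivations of the local ring
along the pull-back homomorphism. -/
def fieldsAlong (t : Discs F) : Submodule ℂ (t.Param → Stalk t.center →ₗ[ℂ] ℂ⟦X⟧) where
  carrier := {δ |
    (∀ p p' : t.Param, ∀ σ, Reparam σ p.1 p'.1 → ∀ g, δ p' g = σ (δ p g)) ∧
    ∀ p f g, δ p (f * g) = p.1.hom f * δ p g + p.1.hom g * δ p f}
  add_mem' := by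
    rintro γ η ⟨h1, h2⟩ ⟨h3, h4⟩
    refine ⟨fun p p' σ h g => ?_, fun p f g => ?_⟩
    · simp [h1 p p' σ h, h3 p p' σ h]
    · simp only [Pi.add_apply, LinearMap.add_apply, h2, h4]
      ring
  zero_mem' := ⟨fun p p' σ _ g => by simp, fun p f g => by simp⟩
  smul_mem' := by
    rintro c γ ⟨h1, h2⟩
    refine ⟨fun p p' σ h g => ?_, fun p f g => ?_⟩
    · simp [h1 p p' σ h]
    · simp only [Pi.smul_apply, LinearMap.smul_apply, h2, smul_add, mul_smul_comm]

/-- The space `Γ(D_t, T_S|_{D_t})`. -/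
def FieldsAlong (t : Discs F) : Type _ := fieldsAlong t

instance (t : Discs F) : AddCommGroup (FieldsAlong t) :=
  inferInstanceAs (AddCommGroup (fieldsAlong t))

instance (t : Discs F) : Module ℂ (FieldsAlong t) :=
  inferInstanceAs (Module ℂ (fieldsAlong t))

/-- Those sections that are tangent to the disc, of the form `h(z) ∂/∂z`. -/
def tangentFields (t : Discs F) : Submodule ℂ (FieldsAlong t) where
  carrier := {δ | ∀ p, ∃ h : ℂ⟦X⟧, ∀ g, δ.1 p g = h * PowerSeries.derivative ℂ (p.1.hom g)}
  add_mem' := by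
    intro γ η h1 h2 p
    obtain ⟨a, ha⟩ := h1 p
    obtain ⟨b, hb⟩ := h2 p
    refine ⟨a + b, fun g => ?_⟩
    change γ.1 p g + η.1 p g = _
    rw [ha, hb, add_mul]
  zero_mem' := fun p => ⟨0, fun g => by rw [zero_mul]; rfl⟩
  smul_mem' := by
    intro c γ h1 p
    obtain ⟨a, ha⟩ := h1 p
    refine ⟨c • a, fun g => ?_⟩
    change c • γ.1 p g = _
    rw [ha, smul_mul_assoc]

/-- The tangent space of the space of discs at `t`: the sections over the disc of the normal
bundle `T_S|_D / T_D`. -/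
abbrev TangentDiscs (t : Discs F) : Type _ := FieldsAlong t ⧸ tangentFields t

/-- The coefficient `ω(δ, ∂/∂z)` of the contraction of `ω = h da ∧ db` with a section `δ` of the
tangent bundle of the surface over the disc. -/
def contractCoeff (Ω : SymplecticForm S) {s : S} (p : DiscParam F s)
    (δ : Stalk s →ₗ[ℂ] ℂ⟦X⟧) : ℂ⟦X⟧ :=
  p.pull (Ω.density s) *
    (δ (germ s (coord₁ s)) * PowerSeries.derivative ℂ (p.pull (coord₂ s)) -
      PowerSeries.derivative ℂ (p.pull (coord₁ s)) * δ (germ s (coord₂ s)))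

theorem contractCoeff_reparam (Ω : SymplecticForm S) {s : S} {σ : ℂ⟦X⟧ ≃ₐ[ℂ] ℂ⟦X⟧}
    {p p' : DiscParam F s} (h : Reparam σ p p') {δ δ' : Stalk s →ₗ[ℂ] ℂ⟦X⟧}
    (hδ : ∀ g, δ' g = σ (δ g)) :
    contractCoeff Ω p' δ' = σ (contractCoeff Ω p δ) *
      PowerSeries.derivative ℂ (σ PowerSeries.X) := by
  have e : ∀ f, p'.pull f = σ (p.pull f) := fun f => h _
  rw [contractCoeff, contractCoeff, e, e, e, hδ, hδ, derivative_algEquiv σ (p.pull _),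
    derivative_algEquiv σ (p.pull _), map_mul, map_sub, map_mul, map_mul]
  ring

/-- Contraction with `ω` maps sections of `T_S|_D` to `1`-forms on the disc. -/
def contractFields (Ω : SymplecticForm S) (t : Discs F) : FieldsAlong t →ₗ[ℂ] RegularForms t where
  toFun δ := ⟨fun p => algebraMap ℂ⟦X⟧ ℂ⸨X⸩ (contractCoeff Ω p.1 (δ.1 p)),
    fun p p' σ h => by
      change algebraMap ℂ⟦X⟧ ℂ⸨X⸩ (contractCoeff Ω p'.1 (δ.1 p')) =
        laurentEquiv σ (algebraMap ℂ⟦X⟧ ℂ⸨X⸩ (contractCoeff Ω p.1 (δ.1 p))) *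
          algebraMap ℂ⟦X⟧ ℂ⸨X⸩ (PowerSeries.derivative ℂ (σ PowerSeries.X))
      rw [laurentEquiv_algebraMap, ← map_mul, contractCoeff_reparam Ω h (δ.2.1 p p' σ h)],
    fun p => ⟨_, rfl⟩⟩
  map_add' δ δ' := by
    apply Subtype.ext
    funext p
    change algebraMap ℂ⟦X⟧ ℂ⸨X⸩ (contractCoeff Ω p.1 (δ.1 p + δ'.1 p)) =
      algebraMap ℂ⟦X⟧ ℂ⸨X⸩ (contractCoeff Ω p.1 (δ.1 p)) +
        algebraMap ℂ⟦X⟧ ℂ⸨X⸩ (contractCoeff Ω p.1 (δ'.1 p))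
    rw [← map_add]
    congr 1
    simp only [contractCoeff, LinearMap.add_apply]
    ring
  map_smul' c δ := by
    apply Subtype.ext
    funext p
    change algebraMap ℂ⟦X⟧ ℂ⸨X⸩ (contractCoeff Ω p.1 (c • δ.1 p)) =
      c • algebraMap ℂ⟦X⟧ ℂ⸨X⸩ (contractCoeff Ω p.1 (δ.1 p))
    rw [smul_eq_algebraMap_C, ← map_mul]
    congr 1
    simp only [contractCoeff, LinearMap.smul_apply, PowerSeries.smul_eq_C_mul]
    ring

/-- The identification `T_t Discs ≃ Ω¹(D_t)` given by the symplectic form. -/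
def contract (Ω : SymplecticForm S) (t : Discs F) : TangentDiscs t →ₗ[ℂ] RegularForms t :=
  (tangentFields t).liftQ (contractFields Ω t) <| by
    intro δ hδ
    change contractFields Ω t δ = 0
    apply Subtype.ext
    funext p
    obtain ⟨h, hh⟩ := hδ p
    change algebraMap ℂ⟦X⟧ ℂ⸨X⸩ (contractCoeff Ω p.1 (δ.1 p)) = 0
    have : contractCoeff Ω p.1 (δ.1 p) = 0 := by
      rw [contractCoeff, hh, hh]
      simp only [DiscParam.pull]
      ring
    rw [this, map_zero]

/-- The `H`-valued `1`-form `φ` on the space of discs: `T_t Discs ≃ Ω¹(D_t) ↪ H_t`. -/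
def phi (Ω : SymplecticForm S) (t : Discs F) : TangentDiscs t →ₗ[ℂ] HFiber t :=
  RegularForms.incl t ∘ₗ contract Ω t

/-! ### Analytic families of discs, the canonical connection -/

section Families

variable {E : Type*} [NormedAddCommGroup E] [NormedSpace ℂ E]

/-- A choice `q` of coordinates on the discs of the family `t` is analytic at `l`: the coefficients
of the pull-backs of analytic functions on the surface depend analytically on the parameter. -/
def AnalyticParamAt (t : E → Discs F) (q : ∀ l, (t l).Param) (l : E) : Prop :=
  ContinuousAt (fun m => (t m).center) l ∧
  ∀ f : S → ℂ, IsAnalyticAt f (t l).center → ∀ k : ℕ,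
    AnalyticAt ℂ (fun m => PowerSeries.coeff k ((q m).pull f)) l

/-- `q` is an analytic choice of coordinates on the discs of the family `t` near `l`. -/
def LocalParam (t : E → Discs F) (q : ∀ l, (t l).Param) (l : E) : Prop :=
  ∀ᶠ m in 𝓝 l, AnalyticParamAt t q m

/-- `t` is an analytic map from `U` to the space of discs, i.e. an analytic family of discs with
parameter in `U`: locally on `U` it has analytic coordinates. -/
def IsAnalyticFamily (U : Set E) (t : E → Discs F) : Prop :=
  ∀ l ∈ U, ∃ q, LocalParam t q l

/-- The derivative at the parameter `l`, in the direction `v`, of the pull-back of `f`. -/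
def pullDeriv (t : E → Discs F) (q : ∀ l, (t l).Param) (l v : E) (f : S → ℂ) : ℂ⟦X⟧ :=
  PowerSeries.mk fun k => fderiv ℂ (fun m => PowerSeries.coeff k ((q m).pull f)) l v

/-- `ξ` is the velocity of the family `t` at `l` in the direction `v` (the image of `v` under the
differential of `t`): it is represented in every analytic coordinate by the derivative of the
pull-back homomorphism. -/
def IsVelocity (t : E → Discs F) (l v : E) (ξ : TangentDiscs (t l)) : Prop :=
  ∀ q, LocalParam t q l → ∃ δ : FieldsAlong (t l), Submodule.Quotient.mk δ = ξ ∧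
    ∀ f, IsAnalyticAt f (t l).center →
      δ.1 (q l) (germ (t l).center f) = pullDeriv t q l v f

/-- The velocity of the family `t` at `l` in the direction `v`. -/
def velocity (t : E → Discs F) (l v : E) : TangentDiscs (t l) :=
  Classical.epsilon (IsVelocity t l v)

/-- The canonical lift of the direction `v` to the family of punctured discs is
`∂_v + u ∂/∂z` in the coordinate `q`: the corresponding section over the punctured disc of the
tangent bundle of the surface is a section of the tangent bundle of the foliation, i.e. kills
the leaf coordinates. -/
def IsCanonicalLift (t : E → Discs F) (q : ∀ l, (t l).Param) (l v : E) (u : ℂ⸨X⸩) : Prop :=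
  ∀ x, F.IsLeafCoord (t l).center x →
    algebraMap ℂ⟦X⟧ ℂ⸨X⸩ (pullDeriv t q l v x) +
      u * algebraMap ℂ⟦X⟧ ℂ⸨X⸩ (PowerSeries.derivative ℂ ((q l).pull x)) = 0

/-- `γ` is an analytic section over `U` of the pull-back of the bundle `H` by the family `t`: in
analytic coordinates the poles are locally uniformly bounded and the coefficients are analytic. -/
def IsAnalyticSection (U : Set E) (t : E → Discs F) (γ : ∀ l, HFiber (t l)) : Prop :=
  ∀ l ∈ U, ∀ q, LocalParam t q l →
    (∃ N : ℤ, ∀ᶠ m in 𝓝 l, ∀ n < N, ((γ m).coord (q m)).coeff n = 0) ∧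
    ∀ n : ℤ, AnalyticAt ℂ (fun m => ((γ m).coord (q m)).coeff n) l

/-- `η` is the covariant derivative at `l` in the direction `v` of the section `γ` of `H`: the
Lie derivative of the relative `1`-form `γ = g dz` along the canonical lift `∂_v + u ∂/∂z`, which is
`(∂_v g + ∂(u g)/∂z) dz`, in every analytic coordinate. -/
def IsCovDeriv (t : E → Discs F) (γ : ∀ l, HFiber (t l)) (l v : E) (η : HFiber (t l)) : Prop :=
  ∀ q, LocalParam t q l → ∀ u, IsCanonicalLift t q l v u → ∀ n : ℤ,
    (η.coord (q l)).coeff n = fderiv ℂ (fun m => ((γ m).coord (q m)).coeff n) l v +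
      (LaurentSeries.derivative ℂ (u * (γ l).coord (q l))).coeff n

/-- The covariant derivative `∇_v γ` for the linear connection on `H` induced by the canonical
non-linear connection. -/
def nabla (t : E → Discs F) (v : E) (γ : ∀ l, HFiber (t l)) (l : E) : HFiber (t l) :=
  Classical.epsilon (IsCovDeriv t γ l v)

/-- The value at the constant vector field `v` of the pull-back of `φ` by the family `t`. -/
def phiPull (Ω : SymplecticForm S) (t : E → Discs F) (v : E) (l : E) : HFiber (t l) :=
  phi Ω (t l) (velocity t l v)

/-- Over the family `t`, the canonical non-linear connection exists and induces a well-defined,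
linear, flat connection on `H` that preserves the symplectic pairing. -/
structure InducesFlatSymplecticConnection (U : Set E) (t : E → Discs F) : Prop where
  existsUnique_lift : ∀ l ∈ U, ∀ q, LocalParam t q l → ∀ v, ∃! u, IsCanonicalLift t q l v u
  existsUnique : ∀ γ, IsAnalyticSection U t γ → ∀ l ∈ U, ∀ v, ∃! η, IsCovDeriv t γ l v η
  analytic : ∀ γ, IsAnalyticSection U t γ → ∀ v, IsAnalyticSection U t (nabla t v γ)
  linear_direction : ∀ γ, IsAnalyticSection U t γ → ∀ l ∈ U, ∀ (a : ℂ) (v w : E),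
    nabla t (a • v + w) γ l = a • nabla t v γ l + nabla t w γ l
  additive : ∀ γ γ', IsAnalyticSection U t γ → IsAnalyticSection U t γ' → ∀ l ∈ U, ∀ v,
    nabla t v (fun m => γ m + γ' m) l = nabla t v γ l + nabla t v γ' l
  leibniz : ∀ f : E → ℂ, (∀ l ∈ U, AnalyticAt ℂ f l) → ∀ γ, IsAnalyticSection U t γ →
    ∀ l ∈ U, ∀ v,
      nabla t v (fun m => f m • γ m) l = fderiv ℂ f l v • γ l + f l • nabla t v γ l
  flat : ∀ γ, IsAnalyticSection U t γ → ∀ l ∈ U, ∀ v w,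
    nabla t v (nabla t w γ) l = nabla t w (nabla t v γ) l
  symplectic : ∀ γ γ', IsAnalyticSection U t γ → IsAnalyticSection U t γ' → ∀ l ∈ U, ∀ v,
    AnalyticAt ℂ (fun m => pairing (t m) (γ m) (γ' m)) l ∧
    fderiv ℂ (fun m => pairing (t m) (γ m) (γ' m)) l v =
      pairing (t l) (nabla t v γ l) (γ' l) + pairing (t l) (γ l) (nabla t v γ' l)

/-- Over the family `t`, the pull-back of `φ` is a well-defined analytic `H`-valued `1`-form whose
exterior covariant derivative vanishes: `∇_v (φ(w)) = ∇_w (φ(v))` for constant (hence commuting)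
vector fields `v`, `w`. -/
structure PhiCovariantlyClosed (Ω : SymplecticForm S) (U : Set E) (t : E → Discs F) : Prop where
  existsUnique_velocity : ∀ l ∈ U, ∀ v, ∃! ξ, IsVelocity t l v ξ
  linear : ∀ l ∈ U, ∀ (a : ℂ) (v w : E),
    phiPull Ω t (a • v + w) l = a • phiPull Ω t v l + phiPull Ω t w l
  analytic : ∀ v, IsAnalyticSection U t (phiPull Ω t v)
  closed : ∀ l ∈ U, ∀ v w, nabla t v (phiPull Ω t w) l = nabla t w (phiPull Ω t v) l

end Families

/-- The pairing on the fibre `H_t` is a symplectic form given by `Res (f η)` in every coordinate,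
and `φ_t` is a Lagrangian embedding, with image the space of regular `1`-forms. -/
structure PhiLagrangianEmbedding (Ω : SymplecticForm S) (t : Discs F) : Prop where
  pairing_eq : ∀ (γ η : HFiber t) (p : t.Param),
    pairing t γ η = residue (primitive (γ.coord p) * η.coord p)
  isAlt : (pairing t).IsAlt
  nondegenerate : (pairing t).Nondegenerate
  bijective_contract : Function.Bijective (contract Ω t)
  injective : Function.Injective (phi Ω t)
  lagrangian : ∀ η : HFiber t, η ∈ LinearMap.range (phi Ω t) ↔
    ∀ ξ ∈ LinearMap.range (phi Ω t), pairing t ξ η = 0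

end Surface

end FormalDiscs

namespace FormalDiscs

/-! ### Hadamard's lemma for analytic maps -/

/-! In a coordinate z on an analytic family of discs everything becomes a computation with Laurent
series whose coefficients depend analytically on the parameter. Write the symplectic form as h da ∧
db and let indices denote derivatives of the pulled back functions; then φ(v) = h (a_v b_z − a_z
b_v) dz.

Lagrangian property: h is a unit, and since the disc is immersed so is a_z or b_z; hence contraction
identifies normal fields with all regular forms. For n ≠ −1 the pairing with d(z^(−1−n)) reads off
the n-th coefficient (`exists_pairing_eq_coeff`). This gives nondegeneracy, and the cases n ≤ −2,
where that form is regular, show that a form orthogonal to the regular ones is regular.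

Connection: a leaf coordinate x has x_z = z · unit by tangency, so u_v = −x_v / x_z is an analytic
family with at most simple poles. A moving change of coordinate shifts u_v by exactly the term that
its own derivative adds to a form (`lieDeriv_change`). The lifts D_v = ∂_v + u_v ∂_z all kill x, and
x_z ≠ 0, so they commute (`canonicalLift_flat`), which is flatness. The pairing is preserved by
integration by parts (`nabla_symplectic`).

Closedness: let W be the pull-back of the symplectic form to the total space of the family of
punctured discs, and g_v = W(∂_v, ∂_z). W is closed, because dh ∧ da ∧ db = 0 on a surface, so ∂_v
g_w − ∂_w g_v = −∂_z W(∂_v, ∂_w). Moreover W(D_v, D_w) = 0, because both lifts map to the line of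
the foliation (`canonicalLift_isotropic`); expanded, u_v g_w − u_w g_v = W(∂_v, ∂_w). The first
identity plus ∂_z of the second is the claim (`nabla_phiPull_comm`).

Neither the homomorphisms to power series nor the automorphisms of the formal disc are assumed local
or continuous. Locality follows because units map to units. Chain rules
(`DiscParam.IsDerivation.eq_partials`, `powerDeriv_algEquiv`) follow by splitting off the constant
term, with Hadamard's lemma on the surface and division by X on the disc, and showing that the
defect is divisible by every power of X. -/

theorem hasSum_shift_apply {E : Type*} [NormedAddCommGroup E] [NormedSpace ℂ E]
    {f : E → ℂ} {p : FormalMultilinearSeries ℂ E ℂ} {c : E} {r : ENNReal}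
    (h : HasFPowerSeriesOnBall f p c r) {y : E} (hy : y ∈ Metric.eball (0 : E) r) :
    f (c + y) = f c + p.shift.sum y y := by
  have h1 := h.hasSum hy
  have hy' : y ∈ Metric.eball (0 : E) p.shift.radius := by
    rw [FormalMultilinearSeries.radius_shift]
    exact Metric.eball_subset_eball h.r_le hy
  have h2 : HasSum (fun n => p.shift n fun _ => y) (p.shift.sum y) := p.shift.hasSum hy'
  have h3 : HasSum (fun n => (p.shift n fun _ => y) y) (p.shift.sum y y) :=
    h2.mapL (ContinuousLinearMap.apply ℂ ℂ y)
  have h4 : HasSum (fun n => p (n + 1) fun _ => y) (f (c + y) - f c) := by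
    rw [← hasSum_nat_add_iff' 1] at h1
    simpa [h.coeff_zero] using h1
  have h5 : (fun n => (p.shift n fun _ => y) y) = fun n => p (n + 1) fun _ => y := by
    funext n
    rw [FormalMultilinearSeries.shift, ContinuousMultilinearMap.curryRight_apply]
    congr 1
    funext i
    refine Fin.lastCases ?_ (fun j => ?_) i <;> simp
  rw [h5] at h3
  rw [h3.unique h4]
  ring

/-- Each term of positive degree in the expansion is linear in its last argument. Pulling that
argument out leaves the shifted series, which has the same radius of convergence, so the cofactor is
analytic. -/
theorem exists_analytic_eq_add_apply_sub {E : Type*} [NormedAddCommGroup E] [NormedSpace ℂ E]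
    {f : E → ℂ} {c : E} (hf : AnalyticAt ℂ f c) :
    ∃ G : E → (E →L[ℂ] ℂ), AnalyticAt ℂ G c ∧ ∀ᶠ y in 𝓝 c, f y = f c + G y (y - c) := by
  obtain ⟨p, r, h⟩ := hf
  have hr : 0 < p.shift.radius := by
    rw [FormalMultilinearSeries.radius_shift]
    exact h.r_pos.trans_le h.r_le
  refine ⟨fun y => p.shift.sum (y - c), ?_, ?_⟩
  · have h0 : AnalyticAt ℂ p.shift.sum (c - c) := by
      rw [sub_self]
      exact (p.shift.hasFPowerSeriesOnBall hr).analyticAt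
    exact h0.comp (f := fun y => y - c) (analyticAt_id.sub analyticAt_const)
  · filter_upwards [Metric.eball_mem_nhds c h.r_pos] with y hy
    have : y - c ∈ Metric.eball (0 : E) r := by
      simpa [edist_eq_enorm_sub] using hy
    simpa using hasSum_shift_apply h this

/-! ### Analytic functions on the surface -/

section Surface

variable {S : Type*} [TopologicalSpace S] [ChartedSpace (ℂ × ℂ) S]

theorem IsAnalyticAt.add {f g : S → ℂ} {s : S} (hf : IsAnalyticAt f s) (hg : IsAnalyticAt g s) :
    IsAnalyticAt (fun m => f m + g m) s := ContMDiffAt.add hf hg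

theorem IsAnalyticAt.mul {f g : S → ℂ} {s : S} (hf : IsAnalyticAt f s) (hg : IsAnalyticAt g s) :
    IsAnalyticAt (fun m => f m * g m) s := ContMDiffAt.mul hf hg

theorem isAnalyticAt_const (c : ℂ) (s : S) : IsAnalyticAt (fun _ => c) s := contMDiffAt_const

theorem IsAnalyticAt.congr {f g : S → ℂ} {s : S} (hf : IsAnalyticAt f s) (h : f =ᶠ[𝓝 s] g) :
    IsAnalyticAt g s := ContMDiffAt.congr_of_eventuallyEq hf h.symm

theorem IsAnalyticAt.continuousAt {f : S → ℂ} {s : S} (hf : IsAnalyticAt f s) :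
    ContinuousAt f s := ContMDiffAt.continuousAt hf

theorem analyticAt_comp_isAnalyticAt {f : S → ℂ} {s : S} {G : ℂ → ℂ} (hf : IsAnalyticAt f s)
    (hG : AnalyticAt ℂ G (f s)) : IsAnalyticAt (fun m => G (f m)) s :=
  ContMDiffAt.comp (I' := 𝓘(ℂ, ℂ)) s (hG.contDiffAt.contMDiffAt) hf

theorem IsAnalyticAt.inv {f : S → ℂ} {s : S} (hf : IsAnalyticAt f s) (h : f s ≠ 0) :
    IsAnalyticAt (fun m => (f m)⁻¹) s :=
  analyticAt_comp_isAnalyticAt hf (analyticAt_inv h)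

/-! ### Germs -/

theorem germ_eq_mk {f : S → ℂ} {s : S} (h : IsAnalyticAt f s) : germ s f =
    (Ideal.Quotient.mk (vanishingIdeal s) ⟨f, h⟩ : analyticFunctions s ⧸ vanishingIdeal s) :=
  dif_pos h

theorem germ_congr {f g : S → ℂ} {s : S} (h : f =ᶠ[𝓝 s] g) : germ s f = germ s g := by
  by_cases hf : IsAnalyticAt f s
  · have hg := hf.congr h
    rw [germ_eq_mk hf, germ_eq_mk hg]
    refine (Ideal.Quotient.eq (I := vanishingIdeal s)).2 ?_
    change ∀ᶠ m in 𝓝 s, _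
    filter_upwards [h] with m hm
    simp [hm]
  -- Analyticity at `s` depends only on the values near `s`, so here both germs take the default
  -- value `0`.
  · have hg : ¬ IsAnalyticAt g s := fun hg => hf (hg.congr h.symm)
    have e : ∀ f : S → ℂ, ¬ IsAnalyticAt f s → germ s f = 0 := fun f hf => dif_neg hf
    rw [e f hf, e g hg]

theorem germ_add {f g : S → ℂ} {s : S} (hf : IsAnalyticAt f s) (hg : IsAnalyticAt g s) :
    germ s (fun m => f m + g m) = germ s f + germ s g := by
  rw [germ_eq_mk hf, germ_eq_mk hg, germ_eq_mk (hf.add hg)]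
  exact map_add (Ideal.Quotient.mk (vanishingIdeal s)) ⟨f, hf⟩ ⟨g, hg⟩

theorem germ_mul {f g : S → ℂ} {s : S} (hf : IsAnalyticAt f s) (hg : IsAnalyticAt g s) :
    germ s (fun m => f m * g m) = germ s f * germ s g := by
  rw [germ_eq_mk hf, germ_eq_mk hg, germ_eq_mk (hf.mul hg)]
  exact map_mul (Ideal.Quotient.mk (vanishingIdeal s)) ⟨f, hf⟩ ⟨g, hg⟩

theorem germ_const (c : ℂ) (s : S) : germ s (fun _ => c) = algebraMap ℂ (Stalk s) c := by
  rw [germ_eq_mk (isAnalyticAt_const c s)]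
  rfl

theorem Stalk.exists_germ {s : S} (g : Stalk s) : ∃ f, IsAnalyticAt f s ∧ germ s f = g := by
  obtain ⟨⟨f, hf⟩, rfl⟩ := Ideal.Quotient.mk_surjective (I := vanishingIdeal s) g
  refine ⟨f, hf, ?_⟩
  exact germ_eq_mk hf

theorem germ_smul {f : S → ℂ} {s : S} (c : ℂ) (hf : IsAnalyticAt f s) :
    germ s (fun m => c * f m) = c • germ s f := by
  rw [germ_mul (isAnalyticAt_const c s) hf, germ_const, Algebra.smul_def]

/-! ### The coordinates of a chart -/

/-- Only the chart at `s` enters, so compatibility of charts plays no role; over ℂ, smoothness of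
class `ω` in the model space is analyticity. -/
theorem isAnalyticAt_iff_chart {f : S → ℂ} {s : S} :
    IsAnalyticAt f s ↔ AnalyticAt ℂ (f ∘ (extChartAt 𝓘(ℂ, ℂ × ℂ) s).symm)
      (extChartAt 𝓘(ℂ, ℂ × ℂ) s s) := by
  rw [IsAnalyticAt, contMDiffAt_iff_source, modelWithCornersSelf_coe, Set.range_id,
    contMDiffWithinAt_univ, contMDiffAt_iff_contDiffAt]
  exact ⟨fun h => h.analyticAt, fun h => h.contDiffAt⟩

theorem IsAnalyticAt.eventually_differentiableAt {f : S → ℂ} {s : S} (hf : IsAnalyticAt f s) :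
    ∀ᶠ m in 𝓝 s, DifferentiableAt ℂ (f ∘ (extChartAt 𝓘(ℂ, ℂ × ℂ) s).symm)
      (extChartAt 𝓘(ℂ, ℂ × ℂ) s m) := by
  have h := (isAnalyticAt_iff_chart.1 hf).eventually_analyticAt
  filter_upwards [(continuousAt_extChartAt (I := 𝓘(ℂ, ℂ × ℂ)) s).eventually h] with m hm
  exact hm.differentiableAt

variable [IsManifold 𝓘(ℂ, ℂ × ℂ) ω S]

theorem IsAnalyticAt.eventually {f : S → ℂ} {s : S} (hf : IsAnalyticAt f s) :
    ∀ᶠ m in 𝓝 s, IsAnalyticAt f m :=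
  (contMDiffAt_iff_contMDiffAt_nhds (by simp)).1 hf

theorem isAnalyticAt_comp_chart {F : ℂ × ℂ → ℂ} {s m : S}
    (hm : m ∈ (extChartAt 𝓘(ℂ, ℂ × ℂ) s).source)
    (hF : AnalyticAt ℂ F (extChartAt 𝓘(ℂ, ℂ × ℂ) s m)) :
    IsAnalyticAt (fun x => F (extChartAt 𝓘(ℂ, ℂ × ℂ) s x)) m :=
  ContMDiffAt.comp (I' := 𝓘(ℂ, ℂ × ℂ)) m (hF.contDiffAt.contMDiffAt)
    (contMDiffAt_extChartAt' (by simpa using hm))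

theorem isAnalyticAt_coord₁ (s : S) : IsAnalyticAt (coord₁ s) s :=
  isAnalyticAt_comp_chart (mem_extChartAt_source s) analyticAt_fst

theorem isAnalyticAt_coord₂ (s : S) : IsAnalyticAt (coord₂ s) s :=
  isAnalyticAt_comp_chart (mem_extChartAt_source s) analyticAt_snd

/-- Hadamard's lemma in the preferred chart. -/
theorem IsAnalyticAt.exists_hadamard {f : S → ℂ} {s : S} (hf : IsAnalyticAt f s) :
    ∃ g₁ g₂ : S → ℂ, IsAnalyticAt g₁ s ∧ IsAnalyticAt g₂ s ∧ ∀ᶠ m in 𝓝 s,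
      f m = f s + ((coord₁ s m - coord₁ s s) * g₁ m + (coord₂ s m - coord₂ s s) * g₂ m) := by
  obtain ⟨G, hG, h⟩ := exists_analytic_eq_add_apply_sub (isAnalyticAt_iff_chart.1 hf)
  have hpart : ∀ e : ℂ × ℂ, AnalyticAt ℂ (fun y => G y e) (extChartAt 𝓘(ℂ, ℂ × ℂ) s s) :=
    fun e => ((ContinuousLinearMap.apply ℂ ℂ e).analyticAt _).comp hG
  refine ⟨_, _, isAnalyticAt_comp_chart (mem_extChartAt_source s) (hpart (1, 0)),
    isAnalyticAt_comp_chart (mem_extChartAt_source s) (hpart (0, 1)), ?_⟩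
  have h' := (continuousAt_extChartAt (I := 𝓘(ℂ, ℂ × ℂ)) s).eventually h
  filter_upwards [h', extChartAt_source_mem_nhds (I := 𝓘(ℂ, ℂ × ℂ)) s] with m hm hs
  simp only [Function.comp_apply, (extChartAt 𝓘(ℂ, ℂ × ℂ) s).left_inv hs,
    (extChartAt 𝓘(ℂ, ℂ × ℂ) s).left_inv (mem_extChartAt_source s)] at hm
  rw [hm]
  congr 1
  set y := extChartAt 𝓘(ℂ, ℂ × ℂ) s m
  have e : y - extChartAt 𝓘(ℂ, ℂ × ℂ) s s = (coord₁ s m - coord₁ s s) • ((1, 0) : ℂ × ℂ) +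
      (coord₂ s m - coord₂ s s) • ((0, 1) : ℂ × ℂ) := by
    ext <;> simp [coord₁, coord₂, y]
  rw [e, map_add, map_smul, map_smul, smul_eq_mul, smul_eq_mul]

/-- The partial derivative in the preferred chart at `s`, in the direction `e`. -/
def chartDeriv (s : S) (e : ℂ × ℂ) (f : S → ℂ) : S → ℂ := fun m =>
  fderiv ℂ (f ∘ (extChartAt 𝓘(ℂ, ℂ × ℂ) s).symm) (extChartAt 𝓘(ℂ, ℂ × ℂ) s m) e

/-- The first partial derivative in the preferred chart at `s`. -/
abbrev partial₁ (s : S) (f : S → ℂ) : S → ℂ := chartDeriv s (1, 0) f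

/-- The second partial derivative in the preferred chart at `s`. -/
abbrev partial₂ (s : S) (f : S → ℂ) : S → ℂ := chartDeriv s (0, 1) f

theorem IsAnalyticAt.chartDeriv {f : S → ℂ} {s : S} (hf : IsAnalyticAt f s) (e : ℂ × ℂ) :
    IsAnalyticAt (chartDeriv s e f) s := by
  have h := (isAnalyticAt_iff_chart.1 hf).fderiv
  exact isAnalyticAt_comp_chart (F := fun y => fderiv ℂ (f ∘ (extChartAt 𝓘(ℂ, ℂ × ℂ) s).symm) y e)
    (mem_extChartAt_source s) (((ContinuousLinearMap.apply ℂ ℂ e).analyticAt _).comp h)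

omit [IsManifold 𝓘(ℂ, ℂ × ℂ) ω S] in
theorem chartDeriv_congr {f g : S → ℂ} {s : S} (e : ℂ × ℂ) (h : f =ᶠ[𝓝 s] g) :
    chartDeriv s e f =ᶠ[𝓝 s] chartDeriv s e g := by
  have h1 : f ∘ (extChartAt 𝓘(ℂ, ℂ × ℂ) s).symm =ᶠ[𝓝 (extChartAt 𝓘(ℂ, ℂ × ℂ) s s)]
      g ∘ (extChartAt 𝓘(ℂ, ℂ × ℂ) s).symm := by
    have hc := continuousAt_extChartAt_symm (I := 𝓘(ℂ, ℂ × ℂ)) s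
    have h' : ∀ᶠ m in 𝓝 ((extChartAt 𝓘(ℂ, ℂ × ℂ) s).symm (extChartAt 𝓘(ℂ, ℂ × ℂ) s s)),
        f m = g m := by
      rw [(extChartAt 𝓘(ℂ, ℂ × ℂ) s).left_inv (mem_extChartAt_source s)]
      exact h
    exact hc.eventually h'
  filter_upwards [(continuousAt_extChartAt (I := 𝓘(ℂ, ℂ × ℂ)) s).eventually
    h1.eventuallyEq_nhds] with m hm
  simp only [chartDeriv]
  rw [hm.fderiv_eq]

omit [IsManifold 𝓘(ℂ, ℂ × ℂ) ω S] in
theorem chartDeriv_add {f g : S → ℂ} {s : S} (e : ℂ × ℂ) (hf : IsAnalyticAt f s)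
    (hg : IsAnalyticAt g s) : chartDeriv s e (fun m => f m + g m) =ᶠ[𝓝 s]
      fun m => chartDeriv s e f m + chartDeriv s e g m := by
  filter_upwards [hf.eventually_differentiableAt, hg.eventually_differentiableAt] with m h1 h2
  have := fderiv_add h1 h2
  simp only [chartDeriv]
  rw [← add_apply, ← this]
  rfl

omit [IsManifold 𝓘(ℂ, ℂ × ℂ) ω S] in
theorem chartDeriv_mul {f g : S → ℂ} {s : S} (e : ℂ × ℂ) (hf : IsAnalyticAt f s)
    (hg : IsAnalyticAt g s) : chartDeriv s e (fun m => f m * g m) =ᶠ[𝓝 s]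
      fun m => f m * chartDeriv s e g m + g m * chartDeriv s e f m := by
  filter_upwards [hf.eventually_differentiableAt, hg.eventually_differentiableAt,
    extChartAt_source_mem_nhds (I := 𝓘(ℂ, ℂ × ℂ)) s] with m h1 h2 hs
  have := congrArg (fun L => L e) (fderiv_mul h1 h2)
  simp only [Function.comp_apply, (extChartAt 𝓘(ℂ, ℂ × ℂ) s).left_inv hs,
    add_apply, smul_apply, smul_eq_mul] at this
  simp only [chartDeriv]
  rw [← this]
  rfl

omit [IsManifold 𝓘(ℂ, ℂ × ℂ) ω S] in
theorem chartDeriv_const (s : S) (e : ℂ × ℂ) (c : ℂ) :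
    chartDeriv s e (fun _ => c) = fun _ => 0 := by
  funext m
  have : (fun _ => c : S → ℂ) ∘ (extChartAt 𝓘(ℂ, ℂ × ℂ) s).symm = fun _ => c := rfl
  rw [chartDeriv, this]
  simp

omit [IsManifold 𝓘(ℂ, ℂ × ℂ) ω S] in
theorem chartDeriv_comp_chart {s : S} (e : ℂ × ℂ) (L : ℂ × ℂ →L[ℂ] ℂ) :
    chartDeriv s e (fun m => L (extChartAt 𝓘(ℂ, ℂ × ℂ) s m)) =ᶠ[𝓝 s] fun _ => L e := by
  filter_upwards [extChartAt_source_mem_nhds (I := 𝓘(ℂ, ℂ × ℂ)) s] with m hs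
  have h : (fun m => L (extChartAt 𝓘(ℂ, ℂ × ℂ) s m)) ∘ (extChartAt 𝓘(ℂ, ℂ × ℂ) s).symm
      =ᶠ[𝓝 (extChartAt 𝓘(ℂ, ℂ × ℂ) s m)] L := by
    filter_upwards [extChartAt_target_mem_nhds' (I := 𝓘(ℂ, ℂ × ℂ))
      ((extChartAt 𝓘(ℂ, ℂ × ℂ) s).map_source hs)] with y hy
    rw [Function.comp_apply, (extChartAt 𝓘(ℂ, ℂ × ℂ) s).right_inv hy]
  simp only [chartDeriv]
  rw [h.fderiv_eq, L.fderiv]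

omit [IsManifold 𝓘(ℂ, ℂ × ℂ) ω S] in
theorem chartDeriv_coord₁ (s : S) (e : ℂ × ℂ) :
    chartDeriv s e (coord₁ s) =ᶠ[𝓝 s] fun _ => e.1 :=
  chartDeriv_comp_chart e (ContinuousLinearMap.fst ℂ ℂ ℂ)

omit [IsManifold 𝓘(ℂ, ℂ × ℂ) ω S] in
theorem chartDeriv_coord₂ (s : S) (e : ℂ × ℂ) :
    chartDeriv s e (coord₂ s) =ᶠ[𝓝 s] fun _ => e.2 :=
  chartDeriv_comp_chart e (ContinuousLinearMap.snd ℂ ℂ ℂ)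

/-- Composing the chart with the two projections gives the components. This links the intrinsic
`diff` at a nearby point `m` to the fixed chart at `s`. -/
theorem diff_coord {s m : S} (hs : m ∈ (extChartAt 𝓘(ℂ, ℂ × ℂ) s).source)
    (v : TangentSpace 𝓘(ℂ, ℂ × ℂ) m) :
    (mfderiv 𝓘(ℂ, ℂ × ℂ) 𝓘(ℂ, ℂ × ℂ) (extChartAt 𝓘(ℂ, ℂ × ℂ) s) m v : ℂ × ℂ) =
      (diff (coord₁ s) m v, diff (coord₂ s) m v) := by
  have hd : MDifferentiableAt 𝓘(ℂ, ℂ × ℂ) 𝓘(ℂ, ℂ × ℂ) (extChartAt 𝓘(ℂ, ℂ × ℂ) s) m :=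
    (contMDiffAt_extChartAt' (n := ω) (by simpa using hs)).mdifferentiableAt (by simp)
  have h : ∀ L : ℂ × ℂ →L[ℂ] ℂ, mfderiv 𝓘(ℂ, ℂ × ℂ) 𝓘(ℂ, ℂ)
      (L ∘ extChartAt 𝓘(ℂ, ℂ × ℂ) s) m v =
      L (mfderiv 𝓘(ℂ, ℂ × ℂ) 𝓘(ℂ, ℂ × ℂ) (extChartAt 𝓘(ℂ, ℂ × ℂ) s) m v) := by
    intro L
    rw [mfderiv_comp (I' := 𝓘(ℂ, ℂ × ℂ)) m L.differentiableAt.mdifferentiableAt hd,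
      mfderiv_eq_fderiv, L.fderiv]
    rfl
  refine Prod.ext ?_ ?_
  · exact (h (ContinuousLinearMap.fst ℂ ℂ ℂ)).symm
  · exact (h (ContinuousLinearMap.snd ℂ ℂ ℂ)).symm

/-- Near `m` the function factors through the fixed chart at `s`, and the chain rule applies. It
turns conditions on tangent vectors, in the foliation and in the symplectic form, into identities
between analytic functions that can be pulled back to discs. -/
theorem eventually_diff_eq {f : S → ℂ} {s : S} (hf : IsAnalyticAt f s) :
    ∀ᶠ m in 𝓝 s, ∀ v, diff f m v =
      partial₁ s f m * diff (coord₁ s) m v + partial₂ s f m * diff (coord₂ s) m v := by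
  filter_upwards [hf.eventually_differentiableAt,
    eventually_eventually_nhds.2 (extChartAt_source_mem_nhds (I := 𝓘(ℂ, ℂ × ℂ)) s)] with m h hs v
  have hs' : m ∈ (extChartAt 𝓘(ℂ, ℂ × ℂ) s).source := mem_of_mem_nhds hs
  have hd : MDifferentiableAt 𝓘(ℂ, ℂ × ℂ) 𝓘(ℂ, ℂ × ℂ) (extChartAt 𝓘(ℂ, ℂ × ℂ) s) m :=
    (contMDiffAt_extChartAt' (n := ω) (by simpa using hs')).mdifferentiableAt (by simp)
  have hfe : f =ᶠ[𝓝 m] (f ∘ (extChartAt 𝓘(ℂ, ℂ × ℂ) s).symm) ∘ extChartAt 𝓘(ℂ, ℂ × ℂ) s := by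
    filter_upwards [hs] with x hx
    rw [Function.comp_apply, Function.comp_apply, (extChartAt 𝓘(ℂ, ℂ × ℂ) s).left_inv hx]
  have h1 : diff f m v = fderiv ℂ (f ∘ (extChartAt 𝓘(ℂ, ℂ × ℂ) s).symm)
      (extChartAt 𝓘(ℂ, ℂ × ℂ) s m)
      (mfderiv 𝓘(ℂ, ℂ × ℂ) 𝓘(ℂ, ℂ × ℂ) (extChartAt 𝓘(ℂ, ℂ × ℂ) s) m v) := by
    change mfderiv 𝓘(ℂ, ℂ × ℂ) 𝓘(ℂ, ℂ) f m v = _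
    rw [hfe.mfderiv_eq, mfderiv_comp (I' := 𝓘(ℂ, ℂ × ℂ)) m h.mdifferentiableAt hd,
      mfderiv_eq_fderiv]
    rfl
  rw [h1, diff_coord hs']
  have e : ((diff (coord₁ s) m v, diff (coord₂ s) m v) : ℂ × ℂ) =
      diff (coord₁ s) m v • ((1, 0) : ℂ × ℂ) + diff (coord₂ s) m v • ((0, 1) : ℂ × ℂ) := by
    ext <;> simp
  rw [e, map_add, map_smul, map_smul, smul_eq_mul, smul_eq_mul, mul_comm,
    mul_comm (diff (coord₂ s) m v)]
  rfl

/-- The differential of a chart is invertible. The resulting test vectors extract the coefficients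
of a form near `s`. -/
theorem eventually_exists_diff_coord (s : S) :
    ∀ᶠ m in 𝓝 s, ∀ α β : ℂ, ∃ v, diff (coord₁ s) m v = α ∧ diff (coord₂ s) m v = β := by
  filter_upwards [extChartAt_source_mem_nhds (I := 𝓘(ℂ, ℂ × ℂ)) s] with m hs α β
  have : IsManifold 𝓘(ℂ, ℂ × ℂ) 1 S := .of_le (n := ω) le_top
  obtain ⟨e, he⟩ := isInvertible_mfderiv_extChartAt (I := 𝓘(ℂ, ℂ × ℂ)) hs
  have h2 := diff_coord hs (e.symm (α, β))
  rw [← he] at h2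
  have h3 : ((α, β) : ℂ × ℂ) = _ := (e.apply_symm_apply (α, β)).symm.trans h2
  exact ⟨e.symm (α, β), (congrArg Prod.fst h3).symm, (congrArg Prod.snd h3).symm⟩

end Surface

section Surface

variable {S : Type*} [TopologicalSpace S] [ChartedSpace (ℂ × ℂ) S] {F : Foliation S}

/-! ### Pull-back of functions to a coordinatised disc -/

theorem DiscParam.pull_congr {s : S} (p : DiscParam F s) {f g : S → ℂ} (h : f =ᶠ[𝓝 s] g) :
    p.pull f = p.pull g := by rw [DiscParam.pull, germ_congr h, DiscParam.pull]

theorem DiscParam.pull_add {s : S} (p : DiscParam F s) {f g : S → ℂ} (hf : IsAnalyticAt f s)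
    (hg : IsAnalyticAt g s) : p.pull (fun m => f m + g m) = p.pull f + p.pull g := by
  simp only [DiscParam.pull, germ_add hf hg, map_add]

theorem DiscParam.pull_mul {s : S} (p : DiscParam F s) {f g : S → ℂ} (hf : IsAnalyticAt f s)
    (hg : IsAnalyticAt g s) : p.pull (fun m => f m * g m) = p.pull f * p.pull g := by
  simp only [DiscParam.pull, germ_mul hf hg, map_mul]

theorem DiscParam.pull_const {s : S} (p : DiscParam F s) (c : ℂ) :
    p.pull (fun _ => c) = PowerSeries.C c := by
  rw [DiscParam.pull, germ_const, AlgHom.commutes]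
  rfl

/-- The constant coefficient of a pull-back is the value at the centre. -/
theorem DiscParam.constantCoeff_pull {s : S} (p : DiscParam F s) {f : S → ℂ}
    (hf : IsAnalyticAt f s) : PowerSeries.constantCoeff (p.pull f) = f s := by
  set c := PowerSeries.constantCoeff (p.pull f) with hc
  by_contra hne
  have hg : IsAnalyticAt (fun m => f m + -c) s := hf.add (isAnalyticAt_const _ s)
  have h0 : (fun m => f m + -c) s ≠ 0 := by
    intro h
    exact hne (by linear_combination -h)
  -- The homomorphism is not assumed local. As `f - c` does not vanish at `s`, it is a unit of the
  -- local ring, whereas its image has constant coefficient `0`.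
  have h1 : p.pull (fun m => (f m + -c) * (f m + -c)⁻¹) = 1 := by
    rw [p.pull_congr (g := fun _ => 1), p.pull_const, map_one]
    filter_upwards [hg.continuousAt.eventually_ne h0] with m hm
    exact mul_inv_cancel₀ hm
  rw [p.pull_mul hg (hg.inv h0), p.pull_add hf (isAnalyticAt_const _ s), p.pull_const] at h1
  have h2 := congrArg PowerSeries.constantCoeff h1
  rw [map_mul, map_add, ← hc, PowerSeries.constantCoeff_C, map_one, add_neg_cancel,
    zero_mul] at h2
  exact zero_ne_one h2

variable [IsManifold 𝓘(ℂ, ℂ × ℂ) ω S]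

/-- The pull-back of a function to a disc in terms of Hadamard's lemma. -/
theorem DiscParam.pull_hadamard {s : S} (p : DiscParam F s) {f : S → ℂ} (hf : IsAnalyticAt f s) :
    ∃ g₁ g₂ : S → ℂ, IsAnalyticAt g₁ s ∧ IsAnalyticAt g₂ s ∧
      f =ᶠ[𝓝 s] (fun m => f s + ((coord₁ s m + -coord₁ s s) * g₁ m +
        (coord₂ s m + -coord₂ s s) * g₂ m)) ∧
      p.pull f = PowerSeries.C (f s) + ((p.pull (coord₁ s) - PowerSeries.C (coord₁ s s)) * p.pull g₁
        + (p.pull (coord₂ s) - PowerSeries.C (coord₂ s s)) * p.pull g₂) := by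
  obtain ⟨g₁, g₂, h₁, h₂, h⟩ := hf.exists_hadamard
  have e : f =ᶠ[𝓝 s] (fun m => f s + ((coord₁ s m + -coord₁ s s) * g₁ m +
        (coord₂ s m + -coord₂ s s) * g₂ m)) := by
    filter_upwards [h] with m hm
    rw [hm]
    ring
  refine ⟨g₁, g₂, h₁, h₂, e, ?_⟩
  have a₁ := (isAnalyticAt_coord₁ s).add (isAnalyticAt_const (-coord₁ s s) s)
  have a₂ := (isAnalyticAt_coord₂ s).add (isAnalyticAt_const (-coord₂ s s) s)
  rw [p.pull_congr e, p.pull_add (isAnalyticAt_const _ s) ((a₁.mul h₁).add (a₂.mul h₂)),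
    p.pull_add (a₁.mul h₁) (a₂.mul h₂), p.pull_mul a₁ h₁, p.pull_mul a₂ h₂,
    p.pull_add (isAnalyticAt_coord₁ s) (isAnalyticAt_const _ s),
    p.pull_add (isAnalyticAt_coord₂ s) (isAnalyticAt_const _ s), p.pull_const, p.pull_const,
    p.pull_const, map_neg, map_neg]
  ring

omit [IsManifold 𝓘(ℂ, ℂ × ℂ) ω S] in
theorem DiscParam.X_dvd_pull_sub {s : S} (p : DiscParam F s) {f : S → ℂ}
    (hf : IsAnalyticAt f s) : (PowerSeries.X : ℂ⟦X⟧) ∣ p.pull f - PowerSeries.C (f s) := by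
  rw [PowerSeries.X_dvd_iff, map_sub, p.constantCoeff_pull hf, PowerSeries.constantCoeff_C,
    sub_self]

/-- A formal disc is immersed: one of the coordinates of the chart has nonzero derivative. -/
theorem DiscParam.immersion {s : S} (p : DiscParam F s) :
    PowerSeries.coeff 1 (p.pull (coord₁ s)) ≠ 0 ∨ PowerSeries.coeff 1 (p.pull (coord₂ s)) ≠ 0 := by
  by_contra! hne
  -- Index 1 means modulo X². Some germ pulls back to X modulo X²; by Hadamard's lemma this is
  -- impossible if both coordinates lack a linear term.
  obtain ⟨g, hg⟩ := p.surjective 1 (Ideal.Quotient.mk _ PowerSeries.X)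
  obtain ⟨f, hf, rfl⟩ := g.exists_germ
  have hd := Ideal.mem_span_singleton.1 (Ideal.Quotient.eq.1 hg)
  rw [PowerSeries.X_pow_dvd_iff] at hd
  have h1 := hd 1 (by norm_num)
  rw [map_sub, PowerSeries.coeff_one_X] at h1
  obtain ⟨g₁, g₂, h₁, h₂, -, e⟩ := p.pull_hadamard hf
  have hz : PowerSeries.coeff 1 (p.pull f) = 0 := by
    have key : ∀ q r : ℂ⟦X⟧, PowerSeries.constantCoeff q = 0 → PowerSeries.coeff 1 q = 0 →
        PowerSeries.coeff 1 (q * r) = 0 := by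
      intro q r hq0 hq1
      rw [PowerSeries.coeff_mul, Finset.Nat.antidiagonal_succ]
      simp [hq0, hq1]
    rw [e, map_add, map_add, key, key, PowerSeries.coeff_C]
    · simp
    · simp [p.constantCoeff_pull (isAnalyticAt_coord₂ s)]
    · simp [hne.2]
    · simp [p.constantCoeff_pull (isAnalyticAt_coord₁ s)]
    · simp [hne.1]
  change PowerSeries.coeff 1 (p.pull f) - 1 = 0 at h1
  rw [hz] at h1
  norm_num at h1

/-! ### Derivations of the local ring along a disc -/

/-- `δ` is a derivation along the homomorphism `p`. -/
def DiscParam.IsDerivation {s : S} (p : DiscParam F s) (δ : Stalk s →ₗ[ℂ] ℂ⟦X⟧) : Prop :=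
  ∀ f g, δ (f * g) = p.hom f * δ g + p.hom g * δ f

omit [IsManifold 𝓘(ℂ, ℂ × ℂ) ω S] in
theorem DiscParam.IsDerivation.const {s : S} {p : DiscParam F s} {δ : Stalk s →ₗ[ℂ] ℂ⟦X⟧}
    (hδ : p.IsDerivation δ) (c : ℂ) : δ (germ s fun _ => c) = 0 := by
  have h1 : δ 1 = 0 := by
    have := hδ 1 1
    rw [mul_one, map_one p.hom, one_mul] at this
    simpa using this
  rw [germ_const, Algebra.algebraMap_eq_smul_one, map_smul, h1, smul_zero]

/-- A derivation along a disc which kills the coordinates is zero. -/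
theorem DiscParam.IsDerivation.eq_zero {s : S} {p : DiscParam F s} {δ : Stalk s →ₗ[ℂ] ℂ⟦X⟧}
    (hδ : p.IsDerivation δ) (h₁ : δ (germ s (coord₁ s)) = 0) (h₂ : δ (germ s (coord₂ s)) = 0) :
    δ = 0 := by
  -- By Hadamard's lemma `f - f(s)` is a combination of coordinate increments, which δ kills and
  -- whose pull-backs are divisible by X. So one more factor X is gained for all `f` at once, and no
  -- continuity of δ is needed.
  have key : ∀ n : ℕ, ∀ f, IsAnalyticAt f s → (PowerSeries.X : ℂ⟦X⟧) ^ n ∣ δ (germ s f) := by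
    intro n
    induction n with
    | zero => simp
    | succ n ih =>
      intro f hf
      obtain ⟨g₁, g₂, hg₁, hg₂, e, -⟩ := p.pull_hadamard hf
      have a₁ := (isAnalyticAt_coord₁ s).add (isAnalyticAt_const (-coord₁ s s) s)
      have a₂ := (isAnalyticAt_coord₂ s).add (isAnalyticAt_const (-coord₂ s s) s)
      have d₁ := p.X_dvd_pull_sub (isAnalyticAt_coord₁ s)
      have d₂ := p.X_dvd_pull_sub (isAnalyticAt_coord₂ s)
      rw [germ_congr e, germ_add (isAnalyticAt_const _ s) ((a₁.mul hg₁).add (a₂.mul hg₂)),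
        germ_add (a₁.mul hg₁) (a₂.mul hg₂), germ_mul a₁ hg₁, germ_mul a₂ hg₂,
        germ_add (isAnalyticAt_coord₁ s) (isAnalyticAt_const _ s),
        germ_add (isAnalyticAt_coord₂ s) (isAnalyticAt_const _ s), map_add, map_add, hδ, hδ,
        map_add, map_add, map_add, map_add, hδ.const, hδ.const, hδ.const, h₁, h₂, zero_add,
        add_zero, mul_zero, mul_zero, add_zero, add_zero]
      have c₁ : p.hom (germ s (coord₁ s)) + p.hom (germ s fun _ => -coord₁ s s) =
          p.pull (coord₁ s) - PowerSeries.C (coord₁ s s) := by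
        have := p.pull_const (-coord₁ s s)
        rw [DiscParam.pull] at this
        rw [this, map_neg, DiscParam.pull, sub_eq_add_neg]
      have c₂ : p.hom (germ s (coord₂ s)) + p.hom (germ s fun _ => -coord₂ s s) =
          p.pull (coord₂ s) - PowerSeries.C (coord₂ s s) := by
        have := p.pull_const (-coord₂ s s)
        rw [DiscParam.pull] at this
        rw [this, map_neg, DiscParam.pull, sub_eq_add_neg]
      rw [c₁, c₂, pow_succ']
      exact dvd_add (mul_dvd_mul d₁ (ih _ hg₁)) (mul_dvd_mul d₂ (ih _ hg₂))
  ext1 g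
  obtain ⟨f, hf, rfl⟩ := g.exists_germ
  ext n
  have := key (n + 1) f hf
  rw [PowerSeries.X_pow_dvd_iff] at this
  simpa using this n (by omega)

omit [IsManifold 𝓘(ℂ, ℂ × ℂ) ω S] in
/-- A rule on functions that satisfies the axioms of a derivation along a disc descends to the local
ring. -/
theorem DiscParam.exists_derivation_of_fun {s : S} (p : DiscParam F s) (d : (S → ℂ) → ℂ⟦X⟧)
    (hcongr : ∀ f g, IsAnalyticAt f s → f =ᶠ[𝓝 s] g → d f = d g)
    (hadd : ∀ f g, IsAnalyticAt f s → IsAnalyticAt g s → d (fun m => f m + g m) = d f + d g)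
    (hmul : ∀ f g, IsAnalyticAt f s → IsAnalyticAt g s →
      d (fun m => f m * g m) = p.pull f * d g + p.pull g * d f)
    (hconst : ∀ c : ℂ, d (fun _ => c) = 0) :
    ∃ δ : Stalk s →ₗ[ℂ] ℂ⟦X⟧, p.IsDerivation δ ∧ ∀ f, IsAnalyticAt f s → δ (germ s f) = d f := by
  choose rep hrep hgerm using fun g : Stalk s => g.exists_germ
  have hcongr' : ∀ f g, IsAnalyticAt f s → IsAnalyticAt g s → germ s f = germ s g →
      d f = d g := by
    intro f g hf hg h
    refine hcongr f g hf ?_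
    rw [germ_eq_mk hf, germ_eq_mk hg] at h
    have h' : ∀ᶠ m in 𝓝 s, f m - g m = 0 := (Ideal.Quotient.eq (I := vanishingIdeal s)).1 h
    filter_upwards [h'] with m hm using sub_eq_zero.1 hm
  refine ⟨{ toFun := fun g => d (rep g), map_add' := fun f g => ?_, map_smul' := fun c f => ?_ },
    fun f g => ?_, fun f hf => ?_⟩
  · rw [← hadd _ _ (hrep f) (hrep g)]
    refine hcongr' _ _ (hrep _) ((hrep f).add (hrep g)) ?_
    rw [hgerm, germ_add (hrep f) (hrep g), hgerm, hgerm]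
  · rw [hcongr' (rep (c • f)) (fun m => c * rep f m) (hrep _)
      ((isAnalyticAt_const c s).mul (hrep f)) (by rw [hgerm, germ_smul c (hrep f), hgerm]),
      hmul _ _ (isAnalyticAt_const c s) (hrep f), hconst, p.pull_const, mul_zero, add_zero,
      PowerSeries.smul_eq_C_mul, RingHom.id_apply]
  · change d (rep (f * g)) = p.hom f * d (rep g) + p.hom g * d (rep f)
    rw [hcongr' (rep (f * g)) (fun m => rep f m * rep g m) (hrep _) ((hrep f).mul (hrep g))
      (by rw [hgerm, germ_mul (hrep f) (hrep g), hgerm, hgerm]), hmul _ _ (hrep f) (hrep g),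
      DiscParam.pull, DiscParam.pull, hgerm, hgerm]
  · exact hcongr' _ _ (hrep _) hf (hgerm _)

/-- This is the vector field u ∂/∂a + w ∂/∂b along the disc: the Leibniz rules for partial
derivatives, pulled back, are the derivation axioms. Hence the values on the two coordinates can be
prescribed freely. -/
theorem DiscParam.exists_derivation {s : S} (p : DiscParam F s) (u w : ℂ⟦X⟧) :
    ∃ δ : Stalk s →ₗ[ℂ] ℂ⟦X⟧, p.IsDerivation δ ∧ ∀ f, IsAnalyticAt f s →
      δ (germ s f) = p.pull (partial₁ s f) * u + p.pull (partial₂ s f) * w := by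
  refine p.exists_derivation_of_fun _ (fun f g hf e => ?_) (fun f g hf hg => ?_)
    (fun f g hf hg => ?_) fun c => ?_
  · rw [p.pull_congr (chartDeriv_congr _ e), p.pull_congr (chartDeriv_congr _ e)]
  · rw [p.pull_congr (chartDeriv_add _ hf hg), p.pull_congr (chartDeriv_add _ hf hg),
      p.pull_add (hf.chartDeriv _) (hg.chartDeriv _), p.pull_add (hf.chartDeriv _) (hg.chartDeriv _)]
    ring
  · rw [p.pull_congr (chartDeriv_mul _ hf hg), p.pull_congr (chartDeriv_mul _ hf hg),
      p.pull_add (hf.mul (hg.chartDeriv _)) (hg.mul (hf.chartDeriv _)),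
      p.pull_add (hf.mul (hg.chartDeriv _)) (hg.mul (hf.chartDeriv _)),
      p.pull_mul hf (hg.chartDeriv _), p.pull_mul hg (hf.chartDeriv _),
      p.pull_mul hf (hg.chartDeriv _), p.pull_mul hg (hf.chartDeriv _)]
    ring
  · simp only [partial₁, partial₂, chartDeriv_const, p.pull_const, map_zero, zero_mul, add_zero]

omit [IsManifold 𝓘(ℂ, ℂ × ℂ) ω S] in
theorem DiscParam.pull_partials_coord {s : S} (p : DiscParam F s) (u w : ℂ⟦X⟧) :
    p.pull (partial₁ s (coord₁ s)) * u + p.pull (partial₂ s (coord₁ s)) * w = u ∧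
    p.pull (partial₁ s (coord₂ s)) * u + p.pull (partial₂ s (coord₂ s)) * w = w := by
  rw [p.pull_congr (chartDeriv_coord₁ s _), p.pull_congr (chartDeriv_coord₁ s _),
    p.pull_congr (chartDeriv_coord₂ s _), p.pull_congr (chartDeriv_coord₂ s _)]
  simp [p.pull_const]

/-- Chain rule: a derivation along a disc is determined by its values on the coordinates. -/
theorem DiscParam.IsDerivation.eq_partials {s : S} {p : DiscParam F s} {δ : Stalk s →ₗ[ℂ] ℂ⟦X⟧}
    (hδ : p.IsDerivation δ) {f : S → ℂ} (hf : IsAnalyticAt f s) :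
    δ (germ s f) = p.pull (partial₁ s f) * δ (germ s (coord₁ s)) +
      p.pull (partial₂ s f) * δ (germ s (coord₂ s)) := by
  obtain ⟨ε, hε, e⟩ := p.exists_derivation (δ (germ s (coord₁ s))) (δ (germ s (coord₂ s)))
  have h : p.IsDerivation (δ - ε) := by
    intro f g
    simp only [LinearMap.sub_apply, hδ f g, hε f g]
    ring
  have h0 := h.eq_zero
    (by rw [LinearMap.sub_apply, e _ (isAnalyticAt_coord₁ s), (p.pull_partials_coord _ _).1,
      sub_self])
    (by rw [LinearMap.sub_apply, e _ (isAnalyticAt_coord₂ s), (p.pull_partials_coord _ _).2,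
      sub_self])
  rw [← e f hf, sub_eq_zero.1 h0]

/-- The derivation of the local ring given by differentiation along the disc. -/
def DiscParam.deriv {s : S} (p : DiscParam F s) : Stalk s →ₗ[ℂ] ℂ⟦X⟧ :=
  (PowerSeries.derivative ℂ : ℂ⟦X⟧ →ₗ[ℂ] ℂ⟦X⟧) ∘ₗ p.hom.toLinearMap

omit [IsManifold 𝓘(ℂ, ℂ × ℂ) ω S] in
theorem DiscParam.isDerivation_deriv {s : S} (p : DiscParam F s) : p.IsDerivation p.deriv := by
  intro f g
  simp [DiscParam.deriv]

theorem DiscParam.derivative_pull {s : S} (p : DiscParam F s) {f : S → ℂ}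
    (hf : IsAnalyticAt f s) : PowerSeries.derivative ℂ (p.pull f) =
      p.pull (partial₁ s f) * PowerSeries.derivative ℂ (p.pull (coord₁ s)) +
      p.pull (partial₂ s f) * PowerSeries.derivative ℂ (p.pull (coord₂ s)) :=
  p.isDerivation_deriv.eq_partials hf

/-- Contraction of the wedge of two differentials with two derivations along a disc. -/
theorem DiscParam.IsDerivation.wedge {s : S} {p : DiscParam F s} {δ ε : Stalk s →ₗ[ℂ] ℂ⟦X⟧}
    (hδ : p.IsDerivation δ) (hε : p.IsDerivation ε) {f g : S → ℂ} (hf : IsAnalyticAt f s)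
    (hg : IsAnalyticAt g s) :
    δ (germ s f) * ε (germ s g) - ε (germ s f) * δ (germ s g) =
      p.pull (fun m => partial₁ s f m * partial₂ s g m + -1 * (partial₂ s f m * partial₁ s g m)) *
        (δ (germ s (coord₁ s)) * ε (germ s (coord₂ s)) -
          ε (germ s (coord₁ s)) * δ (germ s (coord₂ s))) := by
  have f₁ := hf.chartDeriv (1, 0)
  have f₂ := hf.chartDeriv (0, 1)
  have g₁ := hg.chartDeriv (1, 0)
  have g₂ := hg.chartDeriv (0, 1)
  rw [hδ.eq_partials hf, hδ.eq_partials hg, hε.eq_partials hf, hε.eq_partials hg,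
    p.pull_add (f₁.mul g₂) ((isAnalyticAt_const _ s).mul (f₂.mul g₁)), p.pull_mul f₁ g₂,
    p.pull_mul (isAnalyticAt_const _ s) (f₂.mul g₁), p.pull_mul f₂ g₁, p.pull_const, map_neg,
    map_one]
  ring

/-! ### The symplectic density -/

omit [IsManifold 𝓘(ℂ, ℂ × ℂ) ω S] in
theorem SymplecticForm.isAnalyticAt_density (Ω : SymplecticForm S) (s : S) :
    IsAnalyticAt (Ω.density s) s := (Ω.analytic s).choose_spec.1

omit [IsManifold 𝓘(ℂ, ℂ × ℂ) ω S] in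
theorem SymplecticForm.form_eq (Ω : SymplecticForm S) (s : S) :
    ∀ᶠ m in 𝓝 s, ∀ v w, Ω.form m v w = Ω.density s m *
      (diff (coord₁ s) m v * diff (coord₂ s) m w - diff (coord₁ s) m w * diff (coord₂ s) m v) :=
  (Ω.analytic s).choose_spec.2

/-- If the density vanished at `s`, every vector would lie in the kernel of the form, including one
with da = 1. -/
theorem SymplecticForm.density_ne_zero (Ω : SymplecticForm S) (s : S) : Ω.density s s ≠ 0 := by
  intro h0
  obtain ⟨v, hv, -⟩ := (eventually_exists_diff_coord s).self_of_nhds 1 0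
  have hz : v = 0 := Ω.nondegenerate s v fun w => by
    rw [(Ω.form_eq s).self_of_nhds, h0, zero_mul]
  rw [hz, map_zero] at hv
  exact zero_ne_one hv

/-- Change of chart for the density of a symplectic form. -/
theorem SymplecticForm.density_eq (Ω : SymplecticForm S) {s s' : S}
    (h : ∀ᶠ m in 𝓝 s', ∀ v w, Ω.form m v w = Ω.density s m *
      (diff (coord₁ s) m v * diff (coord₂ s) m w - diff (coord₁ s) m w * diff (coord₂ s) m v))
    (h₁ : IsAnalyticAt (coord₁ s) s') (h₂ : IsAnalyticAt (coord₂ s) s') :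
    Ω.density s' =ᶠ[𝓝 s'] fun m => Ω.density s m *
      (partial₁ s' (coord₁ s) m * partial₂ s' (coord₂ s) m +
        -1 * (partial₂ s' (coord₁ s) m * partial₁ s' (coord₂ s) m)) := by
  filter_upwards [h, Ω.form_eq s', eventually_diff_eq h₁, eventually_diff_eq h₂,
    eventually_exists_diff_coord s'] with m e e' d₁ d₂ hex
  -- Both expressions of the form are evaluated on the basis dual to the coordinate differentials of
  -- the chart at `s'`.
  obtain ⟨v, hv₁, hv₂⟩ := hex 1 0
  obtain ⟨w, hw₁, hw₂⟩ := hex 0 1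
  have := (e v w).symm.trans (e' v w)
  rw [d₁, d₂, d₁, d₂, hv₁, hv₂, hw₁, hw₂] at this
  linear_combination -this

end Surface

/-! ### Automorphisms of the formal disc -/

/-- The constant term of `f` is the only `c` for which `f - c` is not a unit, and an automorphism
preserves units. Thus automorphisms are automatically local. -/
theorem constantCoeff_algEquiv (σ : ℂ⟦X⟧ ≃ₐ[ℂ] ℂ⟦X⟧) (f : ℂ⟦X⟧) :
    PowerSeries.constantCoeff (σ f) = PowerSeries.constantCoeff f := by
  have hC : ∀ c : ℂ, σ (PowerSeries.C c) = PowerSeries.C c := fun c => σ.commutes c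
  by_contra hne
  set c := PowerSeries.constantCoeff f with hc
  have hu : IsUnit (σ f - PowerSeries.C c) := by
    rw [PowerSeries.isUnit_iff_constantCoeff, map_sub, PowerSeries.constantCoeff_C,
      isUnit_iff_ne_zero]
    exact sub_ne_zero.2 hne
  have hu' : IsUnit (f - PowerSeries.C c) := by
    have := hu.map σ.symm
    rwa [← hC c, ← map_sub, AlgEquiv.symm_apply_apply] at this
  rw [PowerSeries.isUnit_iff_constantCoeff, map_sub, PowerSeries.constantCoeff_C, ← hc,
    sub_self, isUnit_iff_ne_zero] at hu'
  exact hu' rfl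

theorem algEquiv_C (σ : ℂ⟦X⟧ ≃ₐ[ℂ] ℂ⟦X⟧) (c : ℂ) : σ (PowerSeries.C c) = PowerSeries.C c :=
  σ.commutes c

theorem constantCoeff_algEquiv_X (σ : ℂ⟦X⟧ ≃ₐ[ℂ] ℂ⟦X⟧) :
    PowerSeries.constantCoeff (σ PowerSeries.X) = 0 := by
  rw [constantCoeff_algEquiv, PowerSeries.constantCoeff_X]

theorem X_dvd_algEquiv_X (σ : ℂ⟦X⟧ ≃ₐ[ℂ] ℂ⟦X⟧) : (PowerSeries.X : ℂ⟦X⟧) ∣ σ PowerSeries.X :=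
  PowerSeries.X_dvd_iff.2 (constantCoeff_algEquiv_X σ)

/-- The chain rule applied to the preimage of X exhibits the derivative of σ(X) as a factor of 1. -/
theorem constantCoeff_derivative_algEquiv_X (σ : ℂ⟦X⟧ ≃ₐ[ℂ] ℂ⟦X⟧) :
    PowerSeries.constantCoeff (PowerSeries.derivative ℂ (σ PowerSeries.X)) ≠ 0 := by
  intro h
  have := derivative_algEquiv σ (σ.symm PowerSeries.X)
  rw [AlgEquiv.apply_symm_apply, PowerSeries.derivative_X] at this
  have h2 := congrArg PowerSeries.constantCoeff this
  rw [map_mul, h, mul_zero, map_one] at h2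
  exact one_ne_zero h2

theorem algEquiv_X_ne_zero (σ : ℂ⟦X⟧ ≃ₐ[ℂ] ℂ⟦X⟧) : σ PowerSeries.X ≠ 0 := by
  rw [Ne, map_eq_zero_iff σ σ.injective]
  exact PowerSeries.X_ne_zero

/-- Automorphisms are X-adically continuous because σ(X) is divisible by X; this allows comparisons
through truncations. -/
theorem X_pow_dvd_algEquiv (σ : ℂ⟦X⟧ ≃ₐ[ℂ] ℂ⟦X⟧) {n : ℕ} {f : ℂ⟦X⟧}
    (h : (PowerSeries.X : ℂ⟦X⟧) ^ n ∣ f) : (PowerSeries.X : ℂ⟦X⟧) ^ n ∣ σ f := by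
  have := map_dvd σ h
  rw [map_pow] at this
  exact (pow_dvd_pow_of_dvd (X_dvd_algEquiv_X σ) n).trans this

/-! ### Laurent series -/

/-- Power series as Laurent series. -/
abbrev toLaurent : ℂ⟦X⟧ →+* ℂ⸨X⸩ := algebraMap ℂ⟦X⟧ ℂ⸨X⸩

theorem toLaurent_injective : Function.Injective toLaurent :=
  IsFractionRing.injective ℂ⟦X⟧ ℂ⸨X⸩

theorem coeff_toLaurent_nat (f : ℂ⟦X⟧) (n : ℕ) :
    (toLaurent f).coeff n = PowerSeries.coeff n f := by
  rw [toLaurent, LaurentSeries.coe_algebraMap, LaurentSeries.coeff_coe_powerSeries]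

theorem coeff_toLaurent_of_neg (f : ℂ⟦X⟧) {n : ℤ} (hn : n < 0) : (toLaurent f).coeff n = 0 := by
  rw [toLaurent, LaurentSeries.coe_algebraMap, HahnSeries.ofPowerSeries_apply]
  apply HahnSeries.embDomain_of_notMem_range
  rintro ⟨k, hk⟩
  change (k : ℤ) = n at hk
  omega

theorem toLaurent_X_pow (n : ℕ) : toLaurent (PowerSeries.X ^ n) = HahnSeries.single (n : ℤ) 1 := by
  rw [toLaurent, LaurentSeries.coe_algebraMap, HahnSeries.ofPowerSeries_X_pow]

theorem toLaurent_X : toLaurent PowerSeries.X = HahnSeries.single (1 : ℤ) 1 := by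
  simp

theorem toLaurent_C (c : ℂ) : toLaurent (PowerSeries.C c) = HahnSeries.C c := by
  rw [toLaurent, LaurentSeries.coe_algebraMap, HahnSeries.ofPowerSeries_C]

theorem toLaurent_X_ne_zero : toLaurent PowerSeries.X ≠ 0 := by
  rw [Ne, map_eq_zero_iff _ toLaurent_injective]
  exact PowerSeries.X_ne_zero

/-- A Laurent series without pole is a power series. -/
theorem exists_toLaurent_eq {g : ℂ⸨X⸩} (h : ∀ n < 0, g.coeff n = 0) : ∃ f, g = toLaurent f := by
  refine ⟨PowerSeries.mk fun k => g.coeff k, ?_⟩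
  ext n
  rcases lt_or_ge n 0 with hn | hn
  · rw [h n hn, coeff_toLaurent_of_neg _ hn]
  · lift n to ℕ using hn
    rw [coeff_toLaurent_nat, PowerSeries.coeff_mk]

theorem coeff_X_pow_mul (N : ℕ) (g : ℂ⸨X⸩) (n : ℤ) :
    (toLaurent (PowerSeries.X ^ N) * g).coeff n = g.coeff (n - N) := by
  rw [toLaurent_X_pow]
  have := HahnSeries.coeff_single_mul_add (r := (1 : ℂ)) (x := g) (a := n - N) (b := (N : ℤ))
  rwa [sub_add_cancel, one_mul] at this

/-- Clearing poles in this way reduces the rules for Laurent series below to those for power series.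
-/
theorem exists_X_pow_mul_eq (g : ℂ⸨X⸩) :
    ∃ (N : ℕ) (f : ℂ⟦X⟧), toLaurent PowerSeries.X ^ N * g = toLaurent f := by
  refine ⟨(-g.order).toNat, ?_⟩
  rw [← map_pow]
  refine exists_toLaurent_eq fun n hn => ?_
  rw [coeff_X_pow_mul]
  exact HahnSeries.coeff_eq_zero_of_lt_order (by omega)

/-- Differentiation of Laurent series. -/
abbrev lderiv : ℂ⸨X⸩ →ₗ[ℂ] ℂ⸨X⸩ := LaurentSeries.derivative ℂ

theorem coeff_lderiv (g : ℂ⸨X⸩) (n : ℤ) : (lderiv g).coeff n = (n + 1) * g.coeff (n + 1) := by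
  rw [lderiv, LaurentSeries.derivative_apply, LaurentSeries.hasseDeriv_coeff]
  simp

theorem lderiv_toLaurent (f : ℂ⟦X⟧) :
    lderiv (toLaurent f) = toLaurent (PowerSeries.derivative ℂ f) := by
  ext n
  rw [coeff_lderiv]
  rcases lt_trichotomy n (-1) with hn | rfl | hn
  · rw [coeff_toLaurent_of_neg _ (by omega), coeff_toLaurent_of_neg _ (by omega), mul_zero]
  · rw [coeff_toLaurent_of_neg (n := -1) _ (by omega)]
    simp
  · obtain ⟨k, rfl⟩ := Int.eq_ofNat_of_zero_le (show 0 ≤ n by omega)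
    have e : (k : ℤ) + 1 = ((k + 1 : ℕ) : ℤ) := by push_cast; rfl
    rw [coeff_toLaurent_nat, PowerSeries.coeff_derivative, e, coeff_toLaurent_nat]
    push_cast
    ring

theorem lderiv_single (n : ℤ) (c : ℂ) :
    lderiv (HahnSeries.single n c) = HahnSeries.single (n - 1) (n * c) := by
  ext k
  rw [coeff_lderiv]
  by_cases h : k = n - 1
  · subst h
    simp
  · rw [HahnSeries.coeff_single_of_ne h, HahnSeries.coeff_single_of_ne (by omega), mul_zero]

theorem lderiv_X_mul (g : ℂ⸨X⸩) :
    lderiv (toLaurent PowerSeries.X * g) = g + toLaurent PowerSeries.X * lderiv g := by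
  have h : ∀ (g : ℂ⸨X⸩) n, (toLaurent PowerSeries.X * g).coeff n = g.coeff (n - 1) := by
    intro g n
    simpa using coeff_X_pow_mul 1 g n
  ext n
  rw [coeff_lderiv, h, HahnSeries.coeff_add, h, coeff_lderiv]
  simp only [add_sub_cancel_right, sub_add_cancel]
  push_cast
  ring

/-- The extra factor X avoids the exponent N − 1, which would need a separate case for N = 0. -/
theorem lderiv_X_pow_mul (N : ℕ) (g : ℂ⸨X⸩) :
    toLaurent PowerSeries.X * lderiv (toLaurent PowerSeries.X ^ N * g) =
      N * (toLaurent PowerSeries.X ^ N * g) +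
        toLaurent PowerSeries.X ^ (N + 1) * lderiv g := by
  induction N with
  | zero => simp
  | succ N ih =>
    rw [pow_succ', mul_assoc, lderiv_X_mul]
    push_cast
    linear_combination toLaurent PowerSeries.X * ih

/-- After multiplication by powers of X both factors are power series, where the Leibniz rule is
known; `lderiv_X_pow_mul` removes the powers again. -/
theorem lderiv_mul (f g : ℂ⸨X⸩) : lderiv (f * g) = f * lderiv g + g * lderiv f := by
  obtain ⟨N, a, ha⟩ := exists_X_pow_mul_eq f
  obtain ⟨M, b, hb⟩ := exists_X_pow_mul_eq g
  have h1 := lderiv_X_pow_mul N f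
  have h2 := lderiv_X_pow_mul M g
  have h3 := lderiv_X_pow_mul (N + M) (f * g)
  have e : toLaurent PowerSeries.X ^ (N + M) * (f * g) = toLaurent (a * b) := by
    rw [map_mul, ← ha, ← hb]
    ring
  rw [e, lderiv_toLaurent, Derivation.leibniz, smul_eq_mul, smul_eq_mul, map_add, map_mul, map_mul,
    ← lderiv_toLaurent, ← lderiv_toLaurent, map_mul, ← ha, ← hb] at h3
  push_cast at h3
  have h4 : toLaurent PowerSeries.X ^ (N + M + 1) * lderiv (f * g) =
      toLaurent PowerSeries.X ^ (N + M + 1) * (f * lderiv g + g * lderiv f) := by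
    linear_combination -h3 + toLaurent PowerSeries.X ^ N * f * h2 +
      toLaurent PowerSeries.X ^ M * g * h1
  exact mul_left_cancel₀ (pow_ne_zero _ toLaurent_X_ne_zero) h4

theorem laurentEquiv_toLaurent (σ : ℂ⟦X⟧ ≃ₐ[ℂ] ℂ⟦X⟧) (f : ℂ⟦X⟧) :
    laurentEquiv σ (toLaurent f) = toLaurent (σ f) := laurentEquiv_algebraMap σ f

/-- Chain rule for Laurent series. -/
theorem lderiv_laurentEquiv (σ : ℂ⟦X⟧ ≃ₐ[ℂ] ℂ⟦X⟧) (g : ℂ⸨X⸩) :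
    lderiv (laurentEquiv σ g) = formChange σ (lderiv g) := by
  change _ = laurentEquiv σ (lderiv g) * toLaurent _
  obtain ⟨N, f, hf⟩ := exists_X_pow_mul_eq g
  rw [← map_pow] at hf
  -- The identity X^N g = f is differentiated once after σ and once before it; comparing the two
  -- results isolates the chain rule for `g`.
  have h1 := congrArg lderiv (congrArg (laurentEquiv σ) hf)
  have h2 := congrArg (laurentEquiv σ) (congrArg lderiv hf)
  rw [laurentEquiv_toLaurent, map_mul, laurentEquiv_toLaurent, lderiv_mul, lderiv_toLaurent,
    lderiv_toLaurent, derivative_algEquiv σ f, derivative_algEquiv σ (PowerSeries.X ^ N), map_mul,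
    map_mul] at h1
  rw [lderiv_mul, lderiv_toLaurent, lderiv_toLaurent, map_add, map_mul, map_mul,
    laurentEquiv_toLaurent, laurentEquiv_toLaurent, laurentEquiv_toLaurent] at h2
  have h0 : toLaurent (σ (PowerSeries.X ^ N)) ≠ 0 := by
    rw [Ne, map_eq_zero_iff _ toLaurent_injective, map_pow]
    exact pow_ne_zero _ (algEquiv_X_ne_zero σ)
  refine mul_left_cancel₀ h0 ?_
  linear_combination h1 - toLaurent (PowerSeries.derivative ℂ (σ PowerSeries.X)) * h2

/-! ### Residues and primitives -/

theorem residue_add (f g : ℂ⸨X⸩) : residue (f + g) = residue f + residue g := by simp [residue]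

theorem residue_smul (c : ℂ) (g : ℂ⸨X⸩) : residue (c • g) = c * residue g := by simp [residue]

theorem residue_lderiv (g : ℂ⸨X⸩) : residue (lderiv g) = 0 := by
  rw [residue, coeff_lderiv]
  simp

theorem coeff_primitive (g : ℂ⸨X⸩) (n : ℤ) : (primitive g).coeff n = g.coeff (n - 1) / n := rfl

/-- Up to a residue, a form is the differential of its primitive. -/
theorem lderiv_primitive_add (g : ℂ⸨X⸩) :
    lderiv (primitive g) + HahnSeries.single (-1) (residue g) = g := by
  ext n
  rw [HahnSeries.coeff_add, coeff_lderiv, coeff_primitive, add_sub_cancel_right]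
  by_cases h : n = -1
  · subst h
    simp [residue]
  · have : (n : ℂ) + 1 ≠ 0 := by
      have : ((n + 1 : ℤ) : ℂ) ≠ 0 := Int.cast_ne_zero.2 (by omega)
      simpa using this
    rw [HahnSeries.coeff_single_of_ne h]
    push_cast
    field_simp
    ring

theorem lderiv_primitive {g : ℂ⸨X⸩} (h : residue g = 0) : lderiv (primitive g) = g := by
  have := lderiv_primitive_add g
  rwa [h, map_zero, add_zero] at this

theorem primitive_lderiv (g : ℂ⸨X⸩) : primitive (lderiv g) = g - HahnSeries.C (g.coeff 0) := by
  ext n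
  rw [coeff_primitive, coeff_lderiv, HahnSeries.coeff_sub]
  by_cases h : n = 0
  · subst h
    simp [HahnSeries.C_apply]
  · rw [HahnSeries.C_apply, HahnSeries.coeff_single_of_ne h]
    have : (n : ℂ) ≠ 0 := Int.cast_ne_zero.2 h
    push_cast
    rw [sub_add_cancel, sub_add_cancel]
    field_simp
    ring

theorem residue_C_mul (c : ℂ) (g : ℂ⸨X⸩) : residue (HahnSeries.C c * g) = c * residue g := by
  rw [HahnSeries.C_mul_eq_smul, residue_smul]

theorem residue_toLaurent (f : ℂ⟦X⟧) : residue (toLaurent f) = 0 :=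
  coeff_toLaurent_of_neg f (by norm_num)

/-- Integration by parts. -/
theorem residue_mul_lderiv (f g : ℂ⸨X⸩) : residue (f * lderiv g) = -residue (g * lderiv f) := by
  have := residue_lderiv (f * g)
  rw [lderiv_mul, residue_add] at this
  linear_combination this

theorem formChange_apply (σ : ℂ⟦X⟧ ≃ₐ[ℂ] ℂ⟦X⟧) (g : ℂ⸨X⸩) : formChange σ g =
    laurentEquiv σ g * toLaurent (PowerSeries.derivative ℂ (σ PowerSeries.X)) := rfl

theorem single_neg_one : (HahnSeries.single (-1 : ℤ) (1 : ℂ) : ℂ⸨X⸩) =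
    (toLaurent PowerSeries.X)⁻¹ := by
  rw [eq_comm, inv_eq_iff_eq_inv, eq_comm]
  refine inv_eq_of_mul_eq_one_left ?_
  rw [toLaurent_X, HahnSeries.single_mul_single]
  simp

/-- The residue of a form does not depend on the coordinate. -/
theorem residue_formChange (σ : ℂ⟦X⟧ ≃ₐ[ℂ] ℂ⟦X⟧) (g : ℂ⸨X⸩) :
    residue (formChange σ g) = residue g := by
  -- A residue-free form is exact and stays so in every coordinate, so only dz/z matters. If z
  -- becomes zυ, then dz/z becomes dz/z + dυ/υ, and the last term is regular as υ has nonzero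
  -- constant term.
  have key : residue (formChange σ (HahnSeries.single (-1 : ℤ) (1 : ℂ))) = 1 := by
    obtain ⟨υ, hυ⟩ := X_dvd_algEquiv_X σ
    have h0 : PowerSeries.constantCoeff υ ≠ 0 := by
      have := constantCoeff_derivative_algEquiv_X σ
      rw [hυ, Derivation.leibniz, PowerSeries.derivative_X] at this
      simpa using this
    have hinv : υ * υ⁻¹ = 1 := PowerSeries.mul_inv_cancel υ h0
    have e : formChange σ (HahnSeries.single (-1 : ℤ) (1 : ℂ)) =
        HahnSeries.single (-1 : ℤ) (1 : ℂ) + toLaurent (υ⁻¹ * PowerSeries.derivative ℂ υ) := by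
      rw [formChange_apply, single_neg_one, map_inv₀, laurentEquiv_toLaurent, hυ,
        Derivation.leibniz, PowerSeries.derivative_X]
      simp only [smul_eq_mul, map_mul, map_add, mul_one]
      have hX := toLaurent_X_ne_zero
      have hL := congrArg toLaurent hinv
      rw [map_mul, map_one] at hL
      have hυ0 : toLaurent υ ≠ 0 := left_ne_zero_of_mul_eq_one hL
      have e2 : toLaurent υ⁻¹ = (toLaurent υ)⁻¹ := (eq_inv_of_mul_eq_one_right hL)
      rw [e2]
      field_simp
      ring
    rw [e, residue_add, residue_toLaurent]
    simp [residue]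
  conv_lhs => rw [← lderiv_primitive_add g]
  rw [map_add, ← lderiv_laurentEquiv, residue_add, residue_lderiv, zero_add]
  have : HahnSeries.single (-1 : ℤ) (residue g) =
      residue g • HahnSeries.single (-1 : ℤ) (1 : ℂ) := by
    rw [← HahnSeries.C_mul_eq_smul, HahnSeries.C_apply, HahnSeries.single_mul_single, zero_add,
      mul_one]
  rw [this, map_smul, residue_smul, key, mul_one]

/-- The pairing of two residue-free forms does not depend on the coordinate. -/
theorem residue_primitive_formChange (σ : ℂ⟦X⟧ ≃ₐ[ℂ] ℂ⟦X⟧) {f g : ℂ⸨X⸩} (hf : residue f = 0)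
    (hg : residue g = 0) : residue (primitive (formChange σ f) * formChange σ g) =
      residue (primitive f * g) := by
  have h1 : formChange σ f = lderiv (laurentEquiv σ (primitive f)) := by
    rw [lderiv_laurentEquiv, lderiv_primitive hf]
  -- The transported primitive and the normalised one differ by a constant, which contributes
  -- nothing because `g` has no residue.
  rw [h1, primitive_lderiv, sub_mul]
  have h2 : laurentEquiv σ (primitive f) * formChange σ g = formChange σ (primitive f * g) := by
    rw [formChange_apply, formChange_apply, map_mul, mul_assoc]
  have h3 : ∀ a b : ℂ⸨X⸩, residue (a - b) = residue a - residue b := by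
    intro a b
    simp [residue]
  rw [h2, h3, residue_formChange, residue_C_mul, residue_formChange, hg, mul_zero, sub_zero]

/-- Integration by parts shows that Res(f df) equals its own negative. -/
theorem residue_primitive_mul_self {g : ℂ⸨X⸩} (h : residue g = 0) :
    residue (primitive g * g) = 0 := by
  have := residue_mul_lderiv (primitive g) (primitive g)
  rw [lderiv_primitive h] at this
  linear_combination (1 / 2 : ℂ) * this

theorem residue_single_mul (n : ℤ) (c : ℂ) (g : ℂ⸨X⸩) :
    residue (HahnSeries.single n c * g) = c * g.coeff (-1 - n) := by
  have := HahnSeries.coeff_single_mul_add (r := c) (x := g) (a := -1 - n) (b := n)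
  rw [sub_add_cancel] at this
  exact this

/-- A ring map on Laurent series is determined on power series, by clearing poles. -/
theorem laurentEquiv_trans (σ τ : ℂ⟦X⟧ ≃ₐ[ℂ] ℂ⟦X⟧) (g : ℂ⸨X⸩) :
    laurentEquiv (σ.trans τ) g = laurentEquiv τ (laurentEquiv σ g) := by
  obtain ⟨N, f, hf⟩ := exists_X_pow_mul_eq g
  rw [← map_pow] at hf
  have h1 := congrArg (laurentEquiv (σ.trans τ)) hf
  have h2 := congrArg (laurentEquiv τ) (congrArg (laurentEquiv σ) hf)
  rw [map_mul, laurentEquiv_toLaurent, laurentEquiv_toLaurent] at h1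
  rw [map_mul, map_mul, laurentEquiv_toLaurent, laurentEquiv_toLaurent, laurentEquiv_toLaurent,
    laurentEquiv_toLaurent, ← AlgEquiv.trans_apply, ← AlgEquiv.trans_apply, ← h1] at h2
  have h0 : toLaurent ((σ.trans τ) (PowerSeries.X ^ N)) ≠ 0 := by
    rw [Ne, map_eq_zero_iff _ toLaurent_injective, map_pow]
    exact pow_ne_zero _ (algEquiv_X_ne_zero _)
  exact (mul_left_cancel₀ h0 h2).symm

theorem formChange_trans (σ τ : ℂ⟦X⟧ ≃ₐ[ℂ] ℂ⟦X⟧) (g : ℂ⸨X⸩) :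
    formChange (σ.trans τ) g = formChange τ (formChange σ g) := by
  rw [formChange_apply, formChange_apply, formChange_apply, map_mul, laurentEquiv_trans,
    laurentEquiv_toLaurent, AlgEquiv.trans_apply, derivative_algEquiv τ, map_mul, mul_assoc]

theorem formChange_refl (g : ℂ⸨X⸩) : formChange AlgEquiv.refl g = g := by
  obtain ⟨N, f, hf⟩ := exists_X_pow_mul_eq g
  rw [← map_pow] at hf
  have h1 := congrArg (laurentEquiv AlgEquiv.refl) hf
  rw [map_mul, laurentEquiv_toLaurent, laurentEquiv_toLaurent, AlgEquiv.coe_refl, id, id,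
    ← hf] at h1
  have h0 : toLaurent (PowerSeries.X ^ N) ≠ 0 := by
    rw [map_pow]
    exact pow_ne_zero _ toLaurent_X_ne_zero
  rw [formChange_apply, mul_left_cancel₀ h0 h1]
  simp

section Surface

variable {S : Type*} [TopologicalSpace S] [ChartedSpace (ℂ × ℂ) S] {F : Foliation S}

/-! ### Objects on a disc from their expressions in one coordinate -/

theorem Reparam.trans {s : S} {p p' p'' : DiscParam F s} {σ τ : ℂ⟦X⟧ ≃ₐ[ℂ] ℂ⟦X⟧}
    (h : Reparam σ p p') (h' : Reparam τ p' p'') : Reparam (σ.trans τ) p p'' := fun g => by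
  rw [h' g, h g, AlgEquiv.trans_apply]

theorem Reparam.refl {s : S} (p : DiscParam F s) : Reparam AlgEquiv.refl p p := fun _ => rfl

/-- The change of coordinate between two coordinatisations of a disc is unique. -/
theorem Reparam.unique {s : S} {p p' : DiscParam F s} {σ τ : ℂ⟦X⟧ ≃ₐ[ℂ] ℂ⟦X⟧}
    (h : Reparam σ p p') (h' : Reparam τ p p') : σ = τ := by
  ext1 f
  ext n
  -- Modulo X^(n+1) every series is a pull-back. On pull-backs σ and τ agree, and both preserve
  -- divisibility by X^(n+1), so the n-th coefficients coincide.
  obtain ⟨g, hg⟩ := p.surjective n (Ideal.Quotient.mk _ f)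
  have hd := Ideal.mem_span_singleton.1 (Ideal.Quotient.eq.1 hg)
  have h1 := X_pow_dvd_algEquiv σ hd
  have h2 := X_pow_dvd_algEquiv τ hd
  rw [map_sub, ← h g, PowerSeries.X_pow_dvd_iff] at h1
  rw [map_sub, ← h' g, PowerSeries.X_pow_dvd_iff] at h2
  have e1 := h1 n (by omega)
  have e2 := h2 n (by omega)
  rw [map_sub] at e1 e2
  linear_combination e2 - e1

theorem Discs.Param.exists_reparam {t : Discs F} (p p' : t.Param) : ∃ σ, Reparam σ p.1 p'.1 :=
  Quotient.exact (p.2.trans p'.2.symm)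

/-- The change of coordinate between two coordinatisations of a disc. -/
def Discs.Param.change {t : Discs F} (p p' : t.Param) : ℂ⟦X⟧ ≃ₐ[ℂ] ℂ⟦X⟧ :=
  (p.exists_reparam p').choose

theorem Discs.Param.reparam_change {t : Discs F} (p p' : t.Param) :
    Reparam (p.change p') p.1 p'.1 := (p.exists_reparam p').choose_spec

theorem Discs.Param.change_trans {t : Discs F} (p p' p'' : t.Param) {σ : ℂ⟦X⟧ ≃ₐ[ℂ] ℂ⟦X⟧}
    (h : Reparam σ p'.1 p''.1) : p.change p'' = (p.change p').trans σ :=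
  (p.reparam_change p'').unique ((p.reparam_change p').trans h)

theorem Discs.Param.change_self {t : Discs F} (p : t.Param) : p.change p = AlgEquiv.refl :=
  (p.reparam_change p).unique (Reparam.refl p.1)

theorem Discs.Param.pull_change {t : Discs F} (p p' : t.Param) (f : S → ℂ) :
    p'.pull f = p.change p' (p.pull f) := p.reparam_change p' _

theorem HFiber.residue_coord {t : Discs F} (γ : HFiber t) (p : t.Param) :
    residue (γ.coord p) = 0 := γ.2.2 p

theorem HFiber.coord_reparam {t : Discs F} (γ : HFiber t) {p p' : t.Param}
    {σ : ℂ⟦X⟧ ≃ₐ[ℂ] ℂ⟦X⟧} (h : Reparam σ p.1 p'.1) :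
    γ.coord p' = formChange σ (γ.coord p) := γ.2.1 p p' σ h

theorem HFiber.ext_coord {t : Discs F} {γ η : HFiber t} (p : t.Param)
    (h : γ.coord p = η.coord p) : γ = η := by
  apply Subtype.ext
  funext p'
  have h1 := γ.coord_reparam (p.reparam_change p')
  rw [h, ← η.coord_reparam (p.reparam_change p')] at h1
  exact h1

/-- The expression in one coordinate is transported to all others. The compatibility of the
resulting family is the cocycle rule `Discs.Param.change_trans`, a consequence of the uniqueness of
changes of coordinate. -/
theorem exists_hfiber {t : Discs F} (p : t.Param) {g : ℂ⸨X⸩} (hg : residue g = 0) :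
    ∃ γ : HFiber t, γ.coord p = g := by
  refine ⟨⟨fun p' => formChange (p.change p') g, fun p' p'' σ h => ?_, fun p' => ?_⟩, ?_⟩
  · change formChange (p.change p'') g = formChange σ (formChange (p.change p') g)
    rw [p.change_trans p' p'' h, formChange_trans]
  · change residue (formChange (p.change p') g) = 0
    rw [residue_formChange, hg]
  · change formChange (p.change p) g = g
    rw [p.change_self, formChange_refl]

theorem exists_regularForm {t : Discs F} (p : t.Param) (g : ℂ⟦X⟧) :
    ∃ γ : RegularForms t, γ.1 p = toLaurent g := by
  obtain ⟨γ, hγ⟩ := exists_hfiber p (residue_toLaurent g)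
  refine ⟨⟨γ.1, γ.2.1, fun p' => ?_⟩, hγ⟩
  have := γ.coord_reparam (p.reparam_change p')
  rw [hγ, formChange_apply, laurentEquiv_toLaurent, ← map_mul] at this
  exact ⟨_, this⟩

theorem FieldsAlong.isDerivation {t : Discs F} (δ : FieldsAlong t) (p : t.Param) :
    p.1.IsDerivation (δ.1 p) := δ.2.2 p

theorem FieldsAlong.reparam {t : Discs F} (δ : FieldsAlong t) {p p' : t.Param}
    {σ : ℂ⟦X⟧ ≃ₐ[ℂ] ℂ⟦X⟧} (h : Reparam σ p.1 p'.1) (g : Stalk t.center) :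
    δ.1 p' g = σ (δ.1 p g) := δ.2.1 p p' σ h g

theorem exists_fieldsAlong {t : Discs F} (p : t.Param) {δ : Stalk t.center →ₗ[ℂ] ℂ⟦X⟧}
    (hδ : p.1.IsDerivation δ) : ∃ ε : FieldsAlong t, ε.1 p = δ := by
  refine ⟨⟨fun p' => (p.change p').toLinearMap ∘ₗ δ, fun p' p'' σ h g => ?_, fun p' f g => ?_⟩, ?_⟩
  · change p.change p'' (δ g) = σ (p.change p' (δ g))
    rw [p.change_trans p' p'' h, AlgEquiv.trans_apply]
  · change p.change p' (δ (f * g)) =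
      p'.1.hom f * p.change p' (δ g) + p'.1.hom g * p.change p' (δ f)
    rw [hδ f g, p.reparam_change p' f, p.reparam_change p' g]
    simp
  · change (p.change p).toLinearMap ∘ₗ δ = δ
    rw [p.change_self]
    rfl

/-- A field h ∂/∂z becomes (σ(h)/σ(z)′) ∂/∂z under a change of coordinate, and the denominator is a
unit; so tangency need be checked in one coordinate only. -/
theorem mem_tangentFields {t : Discs F} {δ : FieldsAlong t} (p : t.Param)
    (h : ∃ h : ℂ⟦X⟧, ∀ g, δ.1 p g = h * PowerSeries.derivative ℂ (p.1.hom g)) :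
    δ ∈ tangentFields t := by
  obtain ⟨h, hh⟩ := h
  intro p'
  have hinv := PowerSeries.mul_inv_cancel _
    (constantCoeff_derivative_algEquiv_X (p.change p'))
  refine ⟨p.change p' h *
    (PowerSeries.derivative ℂ (p.change p' PowerSeries.X))⁻¹, fun g => ?_⟩
  rw [δ.reparam (p.reparam_change p'), hh, p.reparam_change p' g,
    derivative_algEquiv (p.change p') (p.1.hom g), map_mul]
  linear_combination (-(p.change p' h *
    p.change p' (PowerSeries.derivative ℂ (p.1.hom g)))) * hinv

/-! ### The pairing and the Lagrangian property -/

theorem pairing_eq {t : Discs F} (γ η : HFiber t) (p : t.Param) :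
    pairing t γ η = residue (primitive (γ.coord p) * η.coord p) := by
  change residue (primitive (γ.coord t.exists_param.some) * η.coord t.exists_param.some) = _
  have h := p.reparam_change t.exists_param.some
  rw [γ.coord_reparam h, η.coord_reparam h,
    residue_primitive_formChange _ (γ.residue_coord p) (η.residue_coord p)]

theorem pairing_isAlt (t : Discs F) : (pairing t).IsAlt := fun γ => by
  rw [pairing_eq γ γ t.exists_param.some]
  exact residue_primitive_mul_self (γ.residue_coord _)

/-- Res(z^(−1−n) η) is the n-th coefficient of η. For n = −1 the test function would be constant and
its differential zero, but there the coefficient is the residue and vanishes anyway. -/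
theorem exists_pairing_eq_coeff {t : Discs F} (p : t.Param) (n : ℤ) (hn : n ≠ -1) :
    ∃ ξ : HFiber t, ξ.coord p = lderiv (HahnSeries.single (-1 - n) 1) ∧
      ∀ η : HFiber t, pairing t ξ η = (η.coord p).coeff n := by
  obtain ⟨ξ, hξ⟩ := exists_hfiber p (residue_lderiv (HahnSeries.single (-1 - n) 1))
  refine ⟨ξ, hξ, fun η => ?_⟩
  rw [pairing_eq ξ η p, hξ, primitive_lderiv, HahnSeries.coeff_single_of_ne (by omega), map_zero,
    sub_zero, residue_single_mul, one_mul]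
  congr 1
  ring

theorem pairing_nondegenerate (t : Discs F) : (pairing t).Nondegenerate := by
  have hr : (pairing t).SeparatingRight := by
    intro η h
    refine HFiber.ext_coord t.exists_param.some ?_
    ext n
    by_cases hn : n = -1
    · subst hn
      exact η.residue_coord _
    · obtain ⟨ξ, -, hξ⟩ := exists_pairing_eq_coeff t.exists_param.some n hn
      rw [← hξ η, h ξ]
      rfl
  refine ⟨fun γ h => hr γ fun ξ => ?_, hr⟩
  rw [← LinearMap.BilinForm.IsAlt.neg_eq (pairing_isAlt t), h ξ, neg_zero]

/-! ### Contraction with the symplectic form is an isomorphism -/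

variable [IsManifold 𝓘(ℂ, ℂ × ℂ) ω S]

theorem DiscParam.density_mul_inv {s : S} (p : DiscParam F s) (Ω : SymplecticForm S) :
    p.pull (Ω.density s) * (p.pull (Ω.density s))⁻¹ = 1 :=
  PowerSeries.mul_inv_cancel _ (by
    rw [p.constantCoeff_pull (Ω.isAnalyticAt_density s)]
    exact Ω.density_ne_zero s)

theorem DiscParam.derivative_unit {s : S} (p : DiscParam F s) :
    (PowerSeries.derivative ℂ (p.pull (coord₁ s)) *
      (PowerSeries.derivative ℂ (p.pull (coord₁ s)))⁻¹ = 1) ∨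
    (PowerSeries.derivative ℂ (p.pull (coord₂ s)) *
      (PowerSeries.derivative ℂ (p.pull (coord₂ s)))⁻¹ = 1) := by
  have key : ∀ f : ℂ⟦X⟧, PowerSeries.coeff 1 f ≠ 0 →
      PowerSeries.derivative ℂ f * (PowerSeries.derivative ℂ f)⁻¹ = 1 := by
    intro f hf
    refine PowerSeries.mul_inv_cancel _ ?_
    rw [← PowerSeries.coeff_zero_eq_constantCoeff_apply, PowerSeries.coeff_derivative]
    simpa using hf
  exact p.immersion.imp (key _) (key _)

/-- The density is a unit, and so is the derivative of one of the coordinates; the equation for the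
two components is solved with the other component equal to zero. -/
theorem exists_contractCoeff_eq (Ω : SymplecticForm S) {s : S} (p : DiscParam F s) (g : ℂ⟦X⟧) :
    ∃ δ, p.IsDerivation δ ∧ contractCoeff Ω p δ = g := by
  have hd := p.density_mul_inv Ω
  have key : ∃ u w : ℂ⟦X⟧, p.pull (Ω.density s) *
      (u * PowerSeries.derivative ℂ (p.pull (coord₂ s)) -
        PowerSeries.derivative ℂ (p.pull (coord₁ s)) * w) = g := by
    rcases p.derivative_unit with h | h
    · refine ⟨0, -((p.pull (Ω.density s))⁻¹ * g *
        (PowerSeries.derivative ℂ (p.pull (coord₁ s)))⁻¹), ?_⟩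
      linear_combination g * hd + p.pull (Ω.density s) * (p.pull (Ω.density s))⁻¹ * g * h
    · refine ⟨(p.pull (Ω.density s))⁻¹ * g *
        (PowerSeries.derivative ℂ (p.pull (coord₂ s)))⁻¹, 0, ?_⟩
      linear_combination g * hd + p.pull (Ω.density s) * (p.pull (Ω.density s))⁻¹ * g * h
  obtain ⟨u, w, h⟩ := key
  obtain ⟨δ, hδ, e⟩ := p.exists_derivation u w
  refine ⟨δ, hδ, ?_⟩
  rw [contractCoeff, e _ (isAnalyticAt_coord₁ s), e _ (isAnalyticAt_coord₂ s),
    (p.pull_partials_coord u w).1, (p.pull_partials_coord u w).2, h]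

/-- Vanishing contraction makes the values of δ on the coordinates proportional to their derivatives
a′, b′. As one of these is a unit, the factor is a power series, and the chain rule extends the
proportionality to all germs. -/
theorem exists_eq_mul_derivative (Ω : SymplecticForm S) {s : S} {p : DiscParam F s}
    {δ : Stalk s →ₗ[ℂ] ℂ⟦X⟧} (hδ : p.IsDerivation δ) (h0 : contractCoeff Ω p δ = 0) :
    ∃ h : ℂ⟦X⟧, ∀ g, δ g = h * PowerSeries.derivative ℂ (p.hom g) := by
  have hd := p.density_mul_inv Ω
  rw [contractCoeff] at h0
  set a' := PowerSeries.derivative ℂ (p.pull (coord₁ s)) with ha'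
  set b' := PowerSeries.derivative ℂ (p.pull (coord₂ s)) with hb'
  set α := δ (germ s (coord₁ s)) with hα
  set β := δ (germ s (coord₂ s)) with hβ
  have hdet : α * b' = a' * β := by
    linear_combination (p.pull (Ω.density s))⁻¹ * h0 - (α * b' - a' * β) * hd
  have key : ∃ h : ℂ⟦X⟧, α = h * a' ∧ β = h * b' := by
    rcases p.derivative_unit with h | h
    · exact ⟨α * a'⁻¹, by linear_combination -α * h, by linear_combination a'⁻¹ * (-hdet) - β * h⟩
    · exact ⟨β * b'⁻¹, by linear_combination b'⁻¹ * hdet - α * h, by linear_combination -β * h⟩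
  obtain ⟨h, h1, h2⟩ := key
  refine ⟨h, fun g => ?_⟩
  obtain ⟨f, hf, rfl⟩ := g.exists_germ
  have := p.derivative_pull hf
  rw [← DiscParam.pull, this, hδ.eq_partials hf, ← hα, ← hβ, h1, h2]
  ring

omit [IsManifold 𝓘(ℂ, ℂ × ℂ) ω S] in
theorem contract_mk (Ω : SymplecticForm S) {t : Discs F} (δ : FieldsAlong t) (p : t.Param) :
    (contract Ω t (Submodule.Quotient.mk δ)).1 p =
      toLaurent (contractCoeff Ω p.1 (δ.1 p)) := rfl

omit [IsManifold 𝓘(ℂ, ℂ × ℂ) ω S] in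
theorem coord_phi_mk (Ω : SymplecticForm S) {t : Discs F} (δ : FieldsAlong t) (p : t.Param) :
    (phi Ω t (Submodule.Quotient.mk δ)).coord p =
      toLaurent (contractCoeff Ω p.1 (δ.1 p)) := rfl

theorem contract_injective (Ω : SymplecticForm S) (t : Discs F) :
    Function.Injective (contract Ω t) := by
  rw [injective_iff_map_eq_zero]
  intro ξ hξ
  obtain ⟨δ, rfl⟩ := Submodule.Quotient.mk_surjective _ ξ
  rw [Submodule.Quotient.mk_eq_zero]
  have p := t.exists_param.some
  refine mem_tangentFields p (exists_eq_mul_derivative Ω (δ.isDerivation p) ?_)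
  apply toLaurent_injective
  rw [← contract_mk, hξ, map_zero]
  rfl

theorem contract_surjective (Ω : SymplecticForm S) (t : Discs F) :
    Function.Surjective (contract Ω t) := by
  intro γ
  have p := t.exists_param.some
  obtain ⟨g, hg⟩ := γ.2.2 p
  obtain ⟨δ, hδ, e⟩ := exists_contractCoeff_eq Ω p.1 g
  obtain ⟨ε, rfl⟩ := exists_fieldsAlong p hδ
  refine ⟨Submodule.Quotient.mk ε, ?_⟩
  have h : RegularForms.incl t (contract Ω t (Submodule.Quotient.mk ε)) =
      RegularForms.incl t γ := by
    refine HFiber.ext_coord p ?_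
    change (contract Ω t (Submodule.Quotient.mk ε)).1 p = γ.1 p
    rw [contract_mk, e]
    exact hg.symm
  exact Submodule.inclusion_injective _ h

theorem mem_range_phi (Ω : SymplecticForm S) {t : Discs F} (η : HFiber t) (p : t.Param) :
    η ∈ LinearMap.range (phi Ω t) ↔ ∃ g : ℂ⟦X⟧, η.coord p = toLaurent g := by
  constructor
  · rintro ⟨ξ, rfl⟩
    exact (contract Ω t ξ).2.2 p
  · rintro ⟨g, hg⟩
    obtain ⟨γ, hγ⟩ := exists_regularForm p g
    obtain ⟨ξ, hξ⟩ := contract_surjective Ω t γ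
    refine ⟨ξ, HFiber.ext_coord p ?_⟩
    rw [hg, ← hγ, ← hξ]
    rfl

theorem phiLagrangianEmbedding (Ω : SymplecticForm S) (t : Discs F) :
    PhiLagrangianEmbedding Ω t where
  pairing_eq := pairing_eq
  isAlt := pairing_isAlt t
  nondegenerate := pairing_nondegenerate t
  bijective_contract := ⟨contract_injective Ω t, contract_surjective Ω t⟩
  injective := (Submodule.inclusion_injective (regularForms_le t)).comp (contract_injective Ω t)
  lagrangian η := by
    have p := t.exists_param.some
    rw [mem_range_phi Ω η p]
    constructor
    -- The primitive of a regular form is regular, so the product has no residue.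
    · rintro ⟨g, hg⟩ ξ hξ
      obtain ⟨f, hf⟩ := (mem_range_phi Ω ξ p).1 hξ
      have hprim : ∃ a : ℂ⟦X⟧, primitive (toLaurent f) = toLaurent a :=
        exists_toLaurent_eq fun n hn => by
          rw [coeff_primitive, coeff_toLaurent_of_neg _ (by omega), zero_div]
      obtain ⟨a, ha⟩ := hprim
      rw [pairing_eq ξ η p, hf, hg, ha, ← map_mul, residue_toLaurent]
    · intro h
      refine exists_toLaurent_eq fun n hn => ?_
      by_cases h1 : n = -1
      · subst h1
        exact η.residue_coord p
      -- Here n ≤ −2, so d(z^(−1−n)) is a multiple of z^(−2−n) dz, a regular form that detects the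
      -- n-th coefficient.
      · obtain ⟨ξ, hξ, e⟩ := exists_pairing_eq_coeff p n h1
        rw [← e η]
        refine h ξ ((mem_range_phi Ω ξ p).2 ?_)
        rw [hξ, lderiv_single]
        refine exists_toLaurent_eq fun k hk => HahnSeries.coeff_single_of_ne ?_
        omega

end Surface

/-! ### Analytic families of Laurent series -/

section Calculus

variable {E : Type*} [NormedAddCommGroup E] [NormedSpace ℂ E]

/-- The family `G` of Laurent series has analytic coefficients at `l`, and poles of bounded order
near `l`. -/
def AnalyticFamilyAt (G : E → ℂ⸨X⸩) (l : E) : Prop :=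
  (∃ N : ℤ, ∀ᶠ m in 𝓝 l, ∀ n < N, (G m).coeff n = 0) ∧
    ∀ n : ℤ, AnalyticAt ℂ (fun m => (G m).coeff n) l

open Classical in
/-- The Laurent series with given coefficients, if they vanish in very negative degrees (and `0`
otherwise). -/
def laurentOfCoeff (φ : ℤ → ℂ) : ℂ⸨X⸩ :=
  if h : BddBelow (Function.support φ) then HahnSeries.ofSuppBddBelow φ h else 0

theorem coeff_laurentOfCoeff {φ : ℤ → ℂ} (h : BddBelow (Function.support φ)) (n : ℤ) :
    (laurentOfCoeff φ).coeff n = φ n := by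
  rw [laurentOfCoeff, dif_pos h]
  rfl

/-- The derivative of a family of Laurent series with respect to the parameter. -/
def paramDeriv (v : E) (G : E → ℂ⸨X⸩) (l : E) : ℂ⸨X⸩ :=
  laurentOfCoeff fun n => fderiv ℂ (fun m => (G m).coeff n) l v

/-- Below the common pole bound all coefficients vanish identically near `l`, hence so do their
derivatives, and `laurentOfCoeff` does not fall into its default case. -/
theorem coeff_paramDeriv_of_bound {G : E → ℂ⸨X⸩} {l : E}
    (h : ∃ N : ℤ, ∀ᶠ m in 𝓝 l, ∀ n < N, (G m).coeff n = 0) (v : E) (n : ℤ) :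
    (paramDeriv v G l).coeff n = fderiv ℂ (fun m => (G m).coeff n) l v := by
  obtain ⟨N, hN⟩ := h
  have hb : BddBelow (Function.support fun n : ℤ => fderiv ℂ (fun m => (G m).coeff n) l v) := by
    refine ⟨N, fun n hn => ?_⟩
    by_contra! hlt
    refine hn ?_
    have e : (fun m => (G m).coeff n) =ᶠ[𝓝 l] fun _ => 0 := by
      filter_upwards [hN] with m hm using hm n hlt
    change fderiv ℂ (fun m => (G m).coeff n) l v = 0
    rw [e.fderiv_eq]
    simp
  exact coeff_laurentOfCoeff hb n

theorem AnalyticFamilyAt.coeff_paramDeriv {G : E → ℂ⸨X⸩} {l : E} (h : AnalyticFamilyAt G l)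
    (v : E) (n : ℤ) :
    (paramDeriv v G l).coeff n = fderiv ℂ (fun m => (G m).coeff n) l v :=
  coeff_paramDeriv_of_bound h.1 v n

theorem paramDeriv_congr {G H : E → ℂ⸨X⸩} {l : E} (h : G =ᶠ[𝓝 l] H) (v : E) :
    paramDeriv v G l = paramDeriv v H l := by
  have : (fun n : ℤ => fderiv ℂ (fun m => (G m).coeff n) l v) =
      fun n : ℤ => fderiv ℂ (fun m => (H m).coeff n) l v := by
    funext n
    have e : (fun m => (G m).coeff n) =ᶠ[𝓝 l] fun m => (H m).coeff n := by
      filter_upwards [h] with m hm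
      rw [hm]
    rw [e.fderiv_eq]
  rw [paramDeriv, this, paramDeriv]

theorem AnalyticFamilyAt.congr {G H : E → ℂ⸨X⸩} {l : E} (hG : AnalyticFamilyAt G l)
    (h : G =ᶠ[𝓝 l] H) : AnalyticFamilyAt H l := by
  obtain ⟨⟨N, hN⟩, ha⟩ := hG
  refine ⟨⟨N, ?_⟩, fun n => (ha n).congr ?_⟩
  · filter_upwards [hN, h] with m h1 h2
    rwa [← h2]
  · filter_upwards [h] with m hm
    rw [hm]

theorem AnalyticFamilyAt.exists_nat_bound {G : E → ℂ⸨X⸩} {l : E} (h : AnalyticFamilyAt G l) :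
    ∃ N : ℕ, ∀ᶠ m in 𝓝 l, ∀ n < -(N : ℤ), (G m).coeff n = 0 := by
  obtain ⟨⟨N, hN⟩, -⟩ := h
  refine ⟨(-N).toNat, ?_⟩
  filter_upwards [hN] with m hm n hn using hm n (by omega)

theorem analyticFamilyAt_const (g : ℂ⸨X⸩) (l : E) : AnalyticFamilyAt (fun _ => g) l :=
  ⟨⟨g.order, Filter.Eventually.of_forall fun _ _ hn =>
    HahnSeries.coeff_eq_zero_of_lt_order hn⟩, fun _ => analyticAt_const⟩

theorem paramDeriv_const (v : E) (g : ℂ⸨X⸩) (l : E) : paramDeriv v (fun _ => g) l = 0 := by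
  ext n
  rw [(analyticFamilyAt_const g l).coeff_paramDeriv]
  simp

theorem AnalyticFamilyAt.add {G H : E → ℂ⸨X⸩} {l : E} (hG : AnalyticFamilyAt G l)
    (hH : AnalyticFamilyAt H l) : AnalyticFamilyAt (fun m => G m + H m) l := by
  obtain ⟨⟨N, hN⟩, ha⟩ := hG
  obtain ⟨⟨M, hM⟩, hb⟩ := hH
  refine ⟨⟨min N M, ?_⟩, fun n => ?_⟩
  · filter_upwards [hN, hM] with m h1 h2 n hn
    rw [HahnSeries.coeff_add, h1 n (by omega), h2 n (by omega), add_zero]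
  · exact (ha n).add (hb n)

theorem paramDeriv_add {G H : E → ℂ⸨X⸩} {l : E} (hG : AnalyticFamilyAt G l)
    (hH : AnalyticFamilyAt H l) (v : E) :
    paramDeriv v (fun m => G m + H m) l = paramDeriv v G l + paramDeriv v H l := by
  ext n
  rw [(hG.add hH).coeff_paramDeriv, HahnSeries.coeff_add, hG.coeff_paramDeriv,
    hH.coeff_paramDeriv, ← add_apply,
    ← fderiv_add (hG.2 n).differentiableAt (hH.2 n).differentiableAt]
  rfl

/-- The range of summation depends on the pole bounds alone, not on the series. Near a point each
coefficient of a product of families is therefore one fixed finite sum, which can be differentiated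
termwise. -/
theorem coeff_mul_of_bound {f g : ℂ⸨X⸩} {N M : ℤ} (hf : ∀ n < N, f.coeff n = 0)
    (hg : ∀ n < M, g.coeff n = 0) (n : ℤ) :
    (f * g).coeff n = ∑ i ∈ Finset.Icc N (n - M), f.coeff i * g.coeff (n - i) := by
  rw [HahnSeries.coeff_mul]
  refine Finset.sum_of_injOn Prod.fst ?_ ?_ ?_ ?_
  · rintro ⟨a, b⟩ h ⟨c, d⟩ h' (rfl : a = c)
    simp only [Finset.mem_coe, Finset.mem_antidiagonal] at h h'
    ext
    · rfl
    · change b = d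
      have h1 := h.2.2
      have h2 := h'.2.2
      omega
  · rintro ⟨a, b⟩ h
    simp only [Finset.mem_coe, Finset.mem_antidiagonal, HahnSeries.mem_support] at h
    simp only [Finset.coe_Icc, Set.mem_Icc]
    obtain ⟨h1, h2, h3⟩ := h
    constructor
    · by_contra! hlt
      exact h1 (hf _ hlt)
    · by_contra! hlt
      exact h2 (hg _ (by omega))
  · intro i _ hi
    by_contra hne
    refine hi ⟨(i, n - i), ?_, rfl⟩
    simp only [Finset.mem_coe, Finset.mem_antidiagonal, HahnSeries.mem_support]
    exact ⟨left_ne_zero_of_mul hne, right_ne_zero_of_mul hne, by ring⟩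
  · rintro ⟨a, b⟩ h
    simp only [Finset.mem_antidiagonal] at h
    have h3 := h.2.2
    simp only
    congr 2
    omega

theorem AnalyticFamilyAt.mul {G H : E → ℂ⸨X⸩} {l : E} (hG : AnalyticFamilyAt G l)
    (hH : AnalyticFamilyAt H l) : AnalyticFamilyAt (fun m => G m * H m) l := by
  obtain ⟨⟨N, hN⟩, ha⟩ := hG
  obtain ⟨⟨M, hM⟩, hb⟩ := hH
  refine ⟨⟨N + M, ?_⟩, fun n => ?_⟩
  · filter_upwards [hN, hM] with m h1 h2 n hn
    rw [coeff_mul_of_bound h1 h2, Finset.Icc_eq_empty (by omega), Finset.sum_empty]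
  · have h : AnalyticAt ℂ (fun m => ∑ i ∈ Finset.Icc N (n - M),
        (G m).coeff i * (H m).coeff (n - i)) l :=
      Finset.analyticAt_fun_sum _ fun i _ => (ha i).mul (hb (n - i))
    refine h.congr ?_
    filter_upwards [hN, hM] with m h1 h2
    rw [coeff_mul_of_bound h1 h2]

theorem paramDeriv_mul {G H : E → ℂ⸨X⸩} {l : E} (hG : AnalyticFamilyAt G l)
    (hH : AnalyticFamilyAt H l) (v : E) :
    paramDeriv v (fun m => G m * H m) l = G l * paramDeriv v H l + H l * paramDeriv v G l := by
  ext n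
  rw [(hG.mul hH).coeff_paramDeriv]
  obtain ⟨N, hN⟩ := hG.1
  obtain ⟨M, hM⟩ := hH.1
  have e : (fun m => (G m * H m).coeff n) =ᶠ[𝓝 l] fun m => ∑ i ∈ Finset.Icc N (n - M),
      (G m).coeff i * (H m).coeff (n - i) := by
    filter_upwards [hN, hM] with m h1 h2
    rw [coeff_mul_of_bound h1 h2]
  -- The derivatives inherit the pole bounds, so the same range of summation serves for all three
  -- products.
  have dN : ∀ n < N, (paramDeriv v G l).coeff n = 0 := by
    intro n hn
    rw [hG.coeff_paramDeriv]
    have e : (fun m => (G m).coeff n) =ᶠ[𝓝 l] fun _ => 0 := by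
      filter_upwards [hN] with m hm using hm n hn
    rw [e.fderiv_eq]
    simp
  have dM : ∀ n < M, (paramDeriv v H l).coeff n = 0 := by
    intro n hn
    rw [hH.coeff_paramDeriv]
    have e : (fun m => (H m).coeff n) =ᶠ[𝓝 l] fun _ => 0 := by
      filter_upwards [hM] with m hm using hm n hn
    rw [e.fderiv_eq]
    simp
  have hd : ∀ i ∈ Finset.Icc N (n - M), DifferentiableAt ℂ
      (fun m => (G m).coeff i * (H m).coeff (n - i)) l := fun i _ =>
    (hG.2 i).differentiableAt.mul (hH.2 (n - i)).differentiableAt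
  rw [e.fderiv_eq, fderiv_fun_sum hd, HahnSeries.coeff_add,
    coeff_mul_of_bound hN.self_of_nhds dM, mul_comm (H l) (paramDeriv v G l),
    coeff_mul_of_bound dN hM.self_of_nhds, sum_apply, ← Finset.sum_add_distrib]
  refine Finset.sum_congr rfl fun i _ => ?_
  rw [fderiv_fun_mul (hG.2 i).differentiableAt (hH.2 (n - i)).differentiableAt,
    hG.coeff_paramDeriv, hH.coeff_paramDeriv]
  simp [mul_comm]

theorem laurent_neg_one_mul (g : ℂ⸨X⸩) : -1 * g = -g := neg_one_mul g

theorem AnalyticFamilyAt.neg {G : E → ℂ⸨X⸩} {l : E} (hG : AnalyticFamilyAt G l) :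
    AnalyticFamilyAt (fun m => -G m) l := by
  simpa only [laurent_neg_one_mul] using (analyticFamilyAt_const (-1 : ℂ⸨X⸩) l).mul hG

theorem paramDeriv_neg {G : E → ℂ⸨X⸩} {l : E} (hG : AnalyticFamilyAt G l) (v : E) :
    paramDeriv v (fun m => -G m) l = -paramDeriv v G l := by
  have := paramDeriv_mul (analyticFamilyAt_const (-1 : ℂ⸨X⸩) l) hG v
  rw [paramDeriv_const, mul_zero, add_zero] at this
  simpa only [laurent_neg_one_mul] using this

theorem AnalyticFamilyAt.sub {G H : E → ℂ⸨X⸩} {l : E} (hG : AnalyticFamilyAt G l)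
    (hH : AnalyticFamilyAt H l) : AnalyticFamilyAt (fun m => G m - H m) l := by
  simpa only [sub_eq_add_neg] using hG.add hH.neg

theorem paramDeriv_sub {G H : E → ℂ⸨X⸩} {l : E} (hG : AnalyticFamilyAt G l)
    (hH : AnalyticFamilyAt H l) (v : E) :
    paramDeriv v (fun m => G m - H m) l = paramDeriv v G l - paramDeriv v H l := by
  simp only [sub_eq_add_neg]
  rw [paramDeriv_add hG hH.neg, paramDeriv_neg hH]

theorem AnalyticFamilyAt.lderiv {G : E → ℂ⸨X⸩} {l : E} (hG : AnalyticFamilyAt G l) :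
    AnalyticFamilyAt (fun m => lderiv (G m)) l := by
  obtain ⟨⟨N, hN⟩, ha⟩ := hG
  refine ⟨⟨N - 1, ?_⟩, fun n => ?_⟩
  · filter_upwards [hN] with m hm n hn
    rw [coeff_lderiv, hm _ (by omega), mul_zero]
  · simp only [coeff_lderiv]
    exact analyticAt_const.mul (ha _)

theorem paramDeriv_lderiv {G : E → ℂ⸨X⸩} {l : E} (hG : AnalyticFamilyAt G l) (v : E) :
    paramDeriv v (fun m => lderiv (G m)) l = lderiv (paramDeriv v G l) := by
  ext n
  rw [hG.lderiv.coeff_paramDeriv, coeff_lderiv, hG.coeff_paramDeriv]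
  simp only [coeff_lderiv]
  rw [fderiv_const_mul (hG.2 _).differentiableAt]
  simp

theorem AnalyticFamilyAt.primitive {G : E → ℂ⸨X⸩} {l : E} (hG : AnalyticFamilyAt G l) :
    AnalyticFamilyAt (fun m => primitive (G m)) l := by
  obtain ⟨⟨N, hN⟩, ha⟩ := hG
  refine ⟨⟨N + 1, ?_⟩, fun n => ?_⟩
  · filter_upwards [hN] with m hm n hn
    rw [coeff_primitive, hm _ (by omega), zero_div]
  · simp only [coeff_primitive]
    exact (ha _).div_const

theorem paramDeriv_primitive {G : E → ℂ⸨X⸩} {l : E} (hG : AnalyticFamilyAt G l) (v : E) :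
    paramDeriv v (fun m => FormalDiscs.primitive (G m)) l =
      FormalDiscs.primitive (paramDeriv v G l) := by
  ext n
  rw [hG.primitive.coeff_paramDeriv, coeff_primitive, hG.coeff_paramDeriv]
  simp only [coeff_primitive, div_eq_inv_mul]
  rw [fderiv_const_mul (hG.2 _).differentiableAt]
  simp

theorem AnalyticFamilyAt.paramDeriv {G : E → ℂ⸨X⸩} {l : E} (hG : AnalyticFamilyAt G l) (v : E) :
    AnalyticFamilyAt (fun m => paramDeriv v G m) l := by
  obtain ⟨⟨N, hN⟩, ha⟩ := hG
  have hcoeff : ∀ᶠ m in 𝓝 l, ∀ n, (FormalDiscs.paramDeriv v G m).coeff n =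
      fderiv ℂ (fun m => (G m).coeff n) m v := by
    filter_upwards [hN.eventually_nhds] with m hm n
    exact coeff_paramDeriv_of_bound ⟨N, hm⟩ v n
  refine ⟨⟨N, ?_⟩, fun n => ?_⟩
  · filter_upwards [hN.eventually_nhds, hcoeff] with m hm h n hn
    have e : (fun m => (G m).coeff n) =ᶠ[𝓝 m] fun _ => 0 := by
      filter_upwards [hm] with m' hm' using hm' n hn
    rw [h, e.fderiv_eq]
    simp
  · have h : AnalyticAt ℂ (fun m => fderiv ℂ (fun m => (G m).coeff n) m v) l :=
      ((ContinuousLinearMap.apply ℂ ℂ v).analyticAt _).comp (ha n).fderiv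
    refine h.congr ?_
    filter_upwards [hcoeff] with m hm
    rw [hm]

/-- Coefficientwise this is the symmetry of the second derivative of an analytic function. -/
theorem paramDeriv_comm {G : E → ℂ⸨X⸩} {l : E} (hG : AnalyticFamilyAt G l) (v w : E) :
    paramDeriv v (fun m => paramDeriv w G m) l = paramDeriv w (fun m => paramDeriv v G m) l := by
  obtain ⟨N, hN⟩ := hG.1
  have hcoeff : ∀ v : E, ∀ᶠ m in 𝓝 l, ∀ n, (FormalDiscs.paramDeriv v G m).coeff n =
      fderiv ℂ (fun m => (G m).coeff n) m v := by
    intro v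
    filter_upwards [hN.eventually_nhds] with m hm n
    exact coeff_paramDeriv_of_bound ⟨N, hm⟩ v n
  have key : ∀ v w : E, ∀ n, (paramDeriv v (fun m => paramDeriv w G m) l).coeff n =
      fderiv ℂ (fderiv ℂ (fun m => (G m).coeff n)) l v w := by
    intro v w n
    rw [(hG.paramDeriv w).coeff_paramDeriv]
    have e : (fun m => (paramDeriv w G m).coeff n) =ᶠ[𝓝 l]
        fun m => fderiv ℂ (fun m => (G m).coeff n) m w := by
      filter_upwards [hcoeff w] with m hm
      rw [hm]
    rw [e.fderiv_eq]
    have hd : DifferentiableAt ℂ (fderiv ℂ (fun m => (G m).coeff n)) l :=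
      (hG.2 n).fderiv.differentiableAt
    have := fderiv_clm_apply hd (differentiableAt_const w)
    rw [this]
    simp
  ext n
  rw [key, key]
  exact (ContDiffAt.isSymmSndFDerivAt_of_omega (hG.2 n).contDiffAt).eq v w

theorem paramDeriv_smul_add {G : E → ℂ⸨X⸩} {l : E} (hG : AnalyticFamilyAt G l) (a : ℂ) (v w : E) :
    paramDeriv (a • v + w) G l = HahnSeries.C a * paramDeriv v G l + paramDeriv w G l := by
  ext n
  rw [HahnSeries.coeff_add, HahnSeries.C_mul_eq_smul, HahnSeries.coeff_smul, hG.coeff_paramDeriv,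
    hG.coeff_paramDeriv, hG.coeff_paramDeriv, map_add, map_smul]

theorem analyticFamilyAt_C {f : E → ℂ} {l : E} (hf : AnalyticAt ℂ f l) :
    AnalyticFamilyAt (fun m => HahnSeries.C (f m)) l := by
  refine ⟨⟨0, Filter.Eventually.of_forall fun m n hn => ?_⟩, fun n => ?_⟩
  · exact HahnSeries.coeff_single_of_ne hn.ne
  · by_cases h : n = 0
    · subst h
      simpa [HahnSeries.C_apply] using hf
    · simp only [HahnSeries.C_apply, HahnSeries.coeff_single_of_ne h]
      exact analyticAt_const

theorem paramDeriv_C {f : E → ℂ} {l : E} (hf : AnalyticAt ℂ f l) (v : E) :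
    paramDeriv v (fun m => HahnSeries.C (f m)) l = HahnSeries.C (fderiv ℂ f l v) := by
  ext n
  rw [(analyticFamilyAt_C hf).coeff_paramDeriv]
  by_cases h : n = 0
  · subst h
    simp [HahnSeries.C_apply]
  · simp [HahnSeries.C_apply, HahnSeries.coeff_single_of_ne h]

theorem AnalyticFamilyAt.pow {G : E → ℂ⸨X⸩} {l : E} (hG : AnalyticFamilyAt G l) (N : ℕ) :
    AnalyticFamilyAt (fun m => G m ^ N) l := by
  induction N with
  | zero => simpa using analyticFamilyAt_const (1 : ℂ⸨X⸩) l
  | succ N ih => simpa only [pow_succ] using ih.mul hG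

/-- The factor `G l` again avoids the exponent N − 1. -/
theorem mul_paramDeriv_pow {G : E → ℂ⸨X⸩} {l : E} (hG : AnalyticFamilyAt G l) (N : ℕ) (v : E) :
    G l * paramDeriv v (fun m => G m ^ N) l = N * G l ^ N * paramDeriv v G l := by
  induction N with
  | zero => simp [paramDeriv_const]
  | succ N ih =>
    simp only [pow_succ]
    rw [paramDeriv_mul (hG.pow N) hG]
    push_cast
    linear_combination G l * ih

theorem AnalyticFamilyAt.residue {G : E → ℂ⸨X⸩} {l : E} (hG : AnalyticFamilyAt G l) :
    AnalyticAt ℂ (fun m => residue (G m)) l := hG.2 (-1)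

theorem fderiv_residue {G : E → ℂ⸨X⸩} {l : E} (hG : AnalyticFamilyAt G l) (v : E) :
    fderiv ℂ (fun m => residue (G m)) l v = residue (paramDeriv v G l) :=
  (hG.coeff_paramDeriv v (-1)).symm

/-! ### Analytic families of power series -/

/-- The coefficients of the family `P` of power series are analytic at `l`. -/
def AnalyticPowerAt (P : E → ℂ⟦X⟧) (l : E) : Prop :=
  ∀ k : ℕ, AnalyticAt ℂ (fun m => PowerSeries.coeff k (P m)) l

omit [NormedSpace ℂ E] in
theorem toLaurent_bound (P : E → ℂ⟦X⟧) (l : E) :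
    ∃ N : ℤ, ∀ᶠ m in 𝓝 l, ∀ n < N, (toLaurent (P m)).coeff n = 0 :=
  ⟨0, Filter.Eventually.of_forall fun _ _ hn => coeff_toLaurent_of_neg _ hn⟩

theorem AnalyticPowerAt.toLaurent {P : E → ℂ⟦X⟧} {l : E} (hP : AnalyticPowerAt P l) :
    AnalyticFamilyAt (fun m => toLaurent (P m)) l := by
  refine ⟨toLaurent_bound P l, fun n => ?_⟩
  rcases lt_or_ge n 0 with hn | hn
  · simp only [coeff_toLaurent_of_neg _ hn]
    exact analyticAt_const
  · lift n to ℕ using hn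
    simp only [coeff_toLaurent_nat]
    exact hP n

theorem analyticPowerAt_of_toLaurent {P : E → ℂ⟦X⟧} {l : E}
    (h : AnalyticFamilyAt (fun m => toLaurent (P m)) l) : AnalyticPowerAt P l := fun k => by
  simpa only [coeff_toLaurent_nat] using h.2 k

theorem paramDeriv_toLaurent (P : E → ℂ⟦X⟧) (l v : E) :
    paramDeriv v (fun m => toLaurent (P m)) l =
      toLaurent (PowerSeries.mk fun k => fderiv ℂ (fun m => PowerSeries.coeff k (P m)) l v) := by
  ext n
  rw [coeff_paramDeriv_of_bound (toLaurent_bound P l)]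
  rcases lt_or_ge n 0 with hn | hn
  · simp only [coeff_toLaurent_of_neg _ hn]
    simp
  · lift n to ℕ using hn
    rw [coeff_toLaurent_nat, PowerSeries.coeff_mk]
    simp only [coeff_toLaurent_nat]

/-- Each coefficient of the inverse is a polynomial in earlier ones, the coefficients of `P`, and
the inverse of the constant term, which is analytic where that term is nonzero. -/
theorem AnalyticPowerAt.inv {P : E → ℂ⟦X⟧} {l : E} (hP : AnalyticPowerAt P l)
    (h0 : PowerSeries.constantCoeff (P l) ≠ 0) : AnalyticPowerAt (fun m => (P m)⁻¹) l := by
  have hc : AnalyticAt ℂ (fun m => (PowerSeries.constantCoeff (P m))⁻¹) l := by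
    have := hP 0
    simp only [PowerSeries.coeff_zero_eq_constantCoeff_apply] at this
    exact this.inv h0
  intro k
  induction k using Nat.strong_induction_on with
  | _ k ih =>
    have e : (fun m => PowerSeries.coeff k (P m)⁻¹) = _ :=
      funext fun m => PowerSeries.coeff_inv k (P m)
    rw [e]
    split_ifs with h
    · exact hc
    · refine hc.neg.mul (Finset.analyticAt_fun_sum _ fun x _ => ?_)
      split_ifs with hx
      · exact (hP _).mul (ih _ hx)
      · exact analyticAt_const

end Calculus

/-! ### Analytic families of changes of coordinate -/

section ChangeOfCoordinate

variable {E : Type*} [NormedAddCommGroup E] [NormedSpace ℂ E]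

/-- The derivative of a family of power series with respect to the parameter. -/
def powerDeriv (v : E) (P : E → ℂ⟦X⟧) (l : E) : ℂ⟦X⟧ :=
  PowerSeries.mk fun k => fderiv ℂ (fun m => PowerSeries.coeff k (P m)) l v

theorem toLaurent_powerDeriv (v : E) (P : E → ℂ⟦X⟧) (l : E) :
    toLaurent (powerDeriv v P l) = paramDeriv v (fun m => toLaurent (P m)) l :=
  (paramDeriv_toLaurent P l v).symm

theorem AnalyticPowerAt.mul {P Q : E → ℂ⟦X⟧} {l : E} (hP : AnalyticPowerAt P l)
    (hQ : AnalyticPowerAt Q l) : AnalyticPowerAt (fun m => P m * Q m) l := by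
  refine analyticPowerAt_of_toLaurent ?_
  simpa only [map_mul] using hP.toLaurent.mul hQ.toLaurent

theorem analyticPowerAt_const (f : ℂ⟦X⟧) (l : E) : AnalyticPowerAt (fun _ => f) l :=
  fun _ => analyticAt_const

theorem analyticPowerAt_C {f : E → ℂ} {l : E} (hf : AnalyticAt ℂ f l) :
    AnalyticPowerAt (fun m => PowerSeries.C (f m)) l := by
  refine analyticPowerAt_of_toLaurent ?_
  simpa only [toLaurent_C] using analyticFamilyAt_C hf

theorem AnalyticPowerAt.derivative {P : E → ℂ⟦X⟧} {l : E} (hP : AnalyticPowerAt P l) :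
    AnalyticPowerAt (fun m => PowerSeries.derivative ℂ (P m)) l := fun k => by
  simp only [PowerSeries.coeff_derivative]
  exact (hP _).mul analyticAt_const

theorem powerDeriv_add {P Q : E → ℂ⟦X⟧} {l : E} (hP : AnalyticPowerAt P l)
    (hQ : AnalyticPowerAt Q l) (v : E) :
    powerDeriv v (fun m => P m + Q m) l = powerDeriv v P l + powerDeriv v Q l := by
  apply toLaurent_injective
  rw [toLaurent_powerDeriv, map_add, toLaurent_powerDeriv, toLaurent_powerDeriv,
    ← paramDeriv_add hP.toLaurent hQ.toLaurent]
  simp only [map_add]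

theorem powerDeriv_mul {P Q : E → ℂ⟦X⟧} {l : E} (hP : AnalyticPowerAt P l)
    (hQ : AnalyticPowerAt Q l) (v : E) :
    powerDeriv v (fun m => P m * Q m) l = P l * powerDeriv v Q l + Q l * powerDeriv v P l := by
  apply toLaurent_injective
  rw [toLaurent_powerDeriv, map_add, map_mul, map_mul, toLaurent_powerDeriv, toLaurent_powerDeriv,
    ← paramDeriv_mul hP.toLaurent hQ.toLaurent]
  simp only [map_mul]

theorem powerDeriv_const (v : E) (f : ℂ⟦X⟧) (l : E) : powerDeriv v (fun _ => f) l = 0 := by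
  ext k
  simp [powerDeriv]

theorem powerDeriv_C {f : E → ℂ} {l : E} (hf : AnalyticAt ℂ f l) (v : E) :
    powerDeriv v (fun m => PowerSeries.C (f m)) l = PowerSeries.C (fderiv ℂ f l v) := by
  apply toLaurent_injective
  rw [toLaurent_powerDeriv, toLaurent_C, ← paramDeriv_C hf]
  simp only [toLaurent_C]

theorem powerDeriv_congr {P Q : E → ℂ⟦X⟧} {l : E} (h : P =ᶠ[𝓝 l] Q) (v : E) :
    powerDeriv v P l = powerDeriv v Q l := by
  apply toLaurent_injective
  rw [toLaurent_powerDeriv, toLaurent_powerDeriv]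
  refine paramDeriv_congr ?_ v
  filter_upwards [h] with m hm
  rw [hm]

/-- Division by `X` of a series without its constant term. -/
def divX (f : ℂ⟦X⟧) : ℂ⟦X⟧ := PowerSeries.mk fun k => PowerSeries.coeff (k + 1) f

theorem eq_X_mul_divX_add (f : ℂ⟦X⟧) :
    f = PowerSeries.X * divX f + PowerSeries.C (PowerSeries.coeff 0 f) := by
  rw [PowerSeries.coeff_zero_eq_constantCoeff_apply]
  exact PowerSeries.eq_X_mul_shift_add_const f

theorem AnalyticPowerAt.divX {P : E → ℂ⟦X⟧} {l : E} (hP : AnalyticPowerAt P l) :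
    AnalyticPowerAt (fun m => divX (P m)) l := fun k => by
  simpa only [FormalDiscs.divX, PowerSeries.coeff_mk] using hP (k + 1)

/-- Since σ(X) has no constant term, the i-th coefficient of σ(f) involves only coefficients of
σ(divX f) in degrees below i. This recursion takes the place of a formula for the coefficients of a
composite series. -/
theorem algEquiv_eq_mul_divX_add (σ : ℂ⟦X⟧ ≃ₐ[ℂ] ℂ⟦X⟧) (f : ℂ⟦X⟧) :
    σ f = σ PowerSeries.X * σ (divX f) + PowerSeries.C (PowerSeries.coeff 0 f) := by
  conv_lhs => rw [eq_X_mul_divX_add f, map_add, map_mul, algEquiv_C]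

theorem coeff_zero_algEquiv_X (σ : ℂ⟦X⟧ ≃ₐ[ℂ] ℂ⟦X⟧) :
    PowerSeries.coeff 0 (σ PowerSeries.X) = 0 := by
  rw [PowerSeries.coeff_zero_eq_constantCoeff_apply, constantCoeff_algEquiv_X]

variable {σ : E → ℂ⟦X⟧ ≃ₐ[ℂ] ℂ⟦X⟧} {l : E}

/-- Induction on the degree through `algEquiv_eq_mul_divX_add`. Only the coefficients of σ(X) up to
degree K are required, so that the statement can be used while their analyticity is still being
proved. -/
theorem analyticAt_coeff_algEquiv {K : ℕ}
    (hτ : ∀ i ≤ K, AnalyticAt ℂ (fun m => PowerSeries.coeff i (σ m PowerSeries.X)) l) (i : ℕ)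
    (hi : i ≤ K) {P : E → ℂ⟦X⟧} (hP : AnalyticPowerAt P l) :
    AnalyticAt ℂ (fun m => PowerSeries.coeff i (σ m (P m))) l := by
  induction i using Nat.strong_induction_on generalizing P with
  | _ i ih =>
    have e : (fun m => PowerSeries.coeff i (σ m (P m))) = fun m =>
        (∑ x ∈ Finset.HasAntidiagonal.antidiagonal i, PowerSeries.coeff x.1 (σ m PowerSeries.X) *
          PowerSeries.coeff x.2 (σ m (divX (P m)))) +
        PowerSeries.coeff i (PowerSeries.C (PowerSeries.coeff 0 (P m))) := by
      funext m
      rw [← PowerSeries.coeff_mul, ← map_add, ← algEquiv_eq_mul_divX_add]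
    rw [e]
    refine AnalyticAt.add (Finset.analyticAt_fun_sum _ fun x hx => ?_) (analyticPowerAt_C (hP 0) i)
    have hx' := Finset.HasAntidiagonal.mem_antidiagonal.1 hx
    by_cases h0 : x.1 = 0
    · simp only [h0, coeff_zero_algEquiv_X, zero_mul]
      exact analyticAt_const
    · exact (hτ _ (by omega)).mul (ih x.2 (by omega) (by omega) hP.divX)

/-- A family of changes of coordinate is analytic if it transforms some immersed analytic family
into an analytic family. -/
theorem analyticPowerAt_algEquiv_X {P : E → ℂ⟦X⟧} (hP : AnalyticPowerAt P l)
    (hQ : AnalyticPowerAt (fun m => σ m (P m)) l) (h1 : PowerSeries.coeff 1 (P l) ≠ 0) :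
    AnalyticPowerAt (fun m => σ m PowerSeries.X) l := by
  intro k
  induction k using Nat.strong_induction_on with
  | _ k ih =>
    rcases k with _ | K
    · simp only [coeff_zero_algEquiv_X]
      exact analyticAt_const
    have hσ := fun i hi => analyticAt_coeff_algEquiv (σ := σ) (K := K)
      (fun i hi => ih i (by omega)) i hi hP.divX
    have hrest : AnalyticAt ℂ (fun m => ∑ x ∈ Finset.HasAntidiagonal.antidiagonal K,
        PowerSeries.coeff x.1 (σ m PowerSeries.X) *
          PowerSeries.coeff (x.2 + 1) (σ m (divX (P m)))) l := by
      refine Finset.analyticAt_fun_sum _ fun x hx => ?_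
      have hx' := Finset.HasAntidiagonal.mem_antidiagonal.1 hx
      by_cases h0 : x.1 = 0
      · simp only [h0, coeff_zero_algEquiv_X, zero_mul]
        exact analyticAt_const
      · exact (ih x.1 (by omega)).mul (hσ _ (by omega))
    -- In degree K + 1, σ(P) is the coefficient of σ(X) sought times the linear coefficient of P,
    -- plus terms with lower coefficients of σ(X); the equation is solved by division.
    refine (((hQ (K + 1)).sub hrest).div (hP 1) h1).congr ?_
    filter_upwards [(hP 1).continuousAt.eventually_ne h1] with m hm
    have e := congrArg (PowerSeries.coeff (K + 1)) (algEquiv_eq_mul_divX_add (σ m) (P m))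
    have e0 : PowerSeries.coeff 0 (σ m (divX (P m))) = PowerSeries.coeff 1 (P m) := by
      rw [PowerSeries.coeff_zero_eq_constantCoeff_apply, constantCoeff_algEquiv, divX,
        ← PowerSeries.coeff_zero_eq_constantCoeff_apply, PowerSeries.coeff_mk]
    rw [map_add, PowerSeries.coeff_mul, Finset.Nat.sum_antidiagonal_succ', PowerSeries.coeff_C,
      if_neg (Nat.succ_ne_zero K), add_zero, e0] at e
    change (PowerSeries.coeff (K + 1) (σ m (P m)) - _) / _ = _
    rw [e, div_eq_iff hm]
    ring

theorem AnalyticPowerAt.algEquiv (hτ : AnalyticPowerAt (fun m => σ m PowerSeries.X) l)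
    {P : E → ℂ⟦X⟧} (hP : AnalyticPowerAt P l) : AnalyticPowerAt (fun m => σ m (P m)) l := fun k =>
  analyticAt_coeff_algEquiv (K := k) (fun i _ => hτ i) k le_rfl hP

/-- Derivative of a family of power series composed with a family of changes of coordinate. -/
theorem powerDeriv_algEquiv (hτ : AnalyticPowerAt (fun m => σ m PowerSeries.X) l)
    {P : E → ℂ⟦X⟧} (hP : AnalyticPowerAt P l) (v : E) :
    powerDeriv v (fun m => σ m (P m)) l = σ l (powerDeriv v P l) +
      σ l (PowerSeries.derivative ℂ (P l)) * powerDeriv v (fun m => σ m PowerSeries.X) l := by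
  -- The defect of the formula for P is σ(X) times the defect for `divX P`, so it is divisible by
  -- every power of X.
  have key : ∀ n : ℕ, ∀ {P : E → ℂ⟦X⟧}, AnalyticPowerAt P l → (PowerSeries.X : ℂ⟦X⟧) ^ n ∣
      powerDeriv v (fun m => σ m (P m)) l - (σ l (powerDeriv v P l) +
      σ l (PowerSeries.derivative ℂ (P l)) * powerDeriv v (fun m => σ m PowerSeries.X) l) := by
    intro n
    induction n with
    | zero => simp
    | succ n ih =>
      intro P hP
      have hR := hP.divX
      have hX : AnalyticPowerAt (fun _ : E => (PowerSeries.X : ℂ⟦X⟧)) l := analyticPowerAt_const _ l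
      have hC := analyticPowerAt_C (hP 0)
      have e1 : powerDeriv v (fun m => σ m (P m)) l =
          σ l PowerSeries.X * powerDeriv v (fun m => σ m (divX (P m))) l +
          σ l (divX (P l)) * powerDeriv v (fun m => σ m PowerSeries.X) l +
          powerDeriv v (fun m => PowerSeries.C (PowerSeries.coeff 0 (P m))) l := by
        rw [← powerDeriv_mul hτ (hτ.algEquiv hR), ← powerDeriv_add (hτ.mul (hτ.algEquiv hR)) hC]
        simp only [← algEquiv_eq_mul_divX_add]
      have e2 : powerDeriv v P l = PowerSeries.X * powerDeriv v (fun m => divX (P m)) l +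
          powerDeriv v (fun m => PowerSeries.C (PowerSeries.coeff 0 (P m))) l := by
        have := powerDeriv_mul hX hR v
        rw [powerDeriv_const, mul_zero, add_zero] at this
        rw [← this, ← powerDeriv_add (hX.mul hR) hC]
        simp only [← eq_X_mul_divX_add]
      have e3 : PowerSeries.derivative ℂ (P l) =
          divX (P l) + PowerSeries.X * PowerSeries.derivative ℂ (divX (P l)) := by
        conv_lhs => rw [eq_X_mul_divX_add (P l), map_add, Derivation.leibniz,
          PowerSeries.derivative_X, PowerSeries.derivative_C]
        simp only [smul_eq_mul]
        ring
      have e4 : σ l (powerDeriv v P l) =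
          σ l PowerSeries.X * σ l (powerDeriv v (fun m => divX (P m)) l) +
          powerDeriv v (fun m => PowerSeries.C (PowerSeries.coeff 0 (P m))) l := by
        rw [e2, powerDeriv_C (hP 0), map_add, map_mul, algEquiv_C]
      have e5 : powerDeriv v (fun m => σ m (P m)) l - (σ l (powerDeriv v P l) +
          σ l (PowerSeries.derivative ℂ (P l)) * powerDeriv v (fun m => σ m PowerSeries.X) l) =
          σ l PowerSeries.X * (powerDeriv v (fun m => σ m (divX (P m))) l -
            (σ l (powerDeriv v (fun m => divX (P m)) l) +
            σ l (PowerSeries.derivative ℂ (divX (P l))) *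
              powerDeriv v (fun m => σ m PowerSeries.X) l)) := by
        rw [e1, e4, e3, map_add, map_mul]
        ring
      rw [e5, pow_succ']
      exact mul_dvd_mul (X_dvd_algEquiv_X (σ l)) (ih hR)
  rw [← sub_eq_zero]
  ext n
  have := key (n + 1) hP
  rw [PowerSeries.X_pow_dvd_iff] at this
  simpa using this n (by omega)

/-- Derivative of a family of `1`-forms in terms of their expression in another coordinate. -/
theorem paramDeriv_formChange (hτ : AnalyticPowerAt (fun m => σ m PowerSeries.X) l)
    {G : E → ℂ⸨X⸩} (hG : AnalyticFamilyAt G l)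
    (hG' : AnalyticFamilyAt (fun m => formChange (σ m) (G m)) l) (v : E) :
    paramDeriv v (fun m => formChange (σ m) (G m)) l =
      formChange (σ l) (paramDeriv v G l) +
      (formChange (σ l) (lderiv (G l)) *
          toLaurent (powerDeriv v (fun m => σ m PowerSeries.X) l) +
        laurentEquiv (σ l) (G l) *
          lderiv (toLaurent (powerDeriv v (fun m => σ m PowerSeries.X) l))) := by
  obtain ⟨N, hN⟩ := hG.exists_nat_bound
  set T := fun m => toLaurent (σ m PowerSeries.X) with hTdef
  have hT : AnalyticFamilyAt T l := hτ.toLaurent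
  -- The family X^N G without poles; it agrees with that product only near `l`, where the pole bound
  -- holds.
  let P : E → ℂ⟦X⟧ := fun m => PowerSeries.mk fun k => (G m).coeff (k - N)
  have hP : AnalyticPowerAt P l := fun k => by
    simpa only [P, PowerSeries.coeff_mk] using hG.2 (k - N)
  have hPG : ∀ᶠ m in 𝓝 l, toLaurent (P m) = toLaurent PowerSeries.X ^ N * G m := by
    filter_upwards [hN] with m hm
    ext n
    rw [← map_pow, coeff_X_pow_mul]
    rcases lt_or_ge n 0 with hn | hn
    · rw [coeff_toLaurent_of_neg _ hn, hm _ (by omega)]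
    · lift n to ℕ using hn
      rw [coeff_toLaurent_nat, PowerSeries.coeff_mk]
  have hσP := hτ.algEquiv hP
  have hder : ∀ m, toLaurent (PowerSeries.derivative ℂ (σ m PowerSeries.X)) = lderiv (T m) :=
    fun m => (lderiv_toLaurent _).symm
  -- With T = σ(X), the transformed form is σ(P) T′ / T^N. This is differentiated with the
  -- denominator cleared, using the known rule for the power series σ(P).
  have hrel : ∀ᶠ m in 𝓝 l, T m ^ N * formChange (σ m) (G m) =
      toLaurent (σ m (P m)) * lderiv (T m) := by
    filter_upwards [hPG] with m hm
    rw [← laurentEquiv_toLaurent, hm, map_mul, map_pow, laurentEquiv_toLaurent, formChange_apply,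
      hder]
    ring
  have d1 := paramDeriv_congr hrel v
  rw [paramDeriv_mul (hT.pow N) hG', paramDeriv_mul hσP.toLaurent hT.lderiv,
    paramDeriv_lderiv hT, ← toLaurent_powerDeriv v (fun m => σ m (P m)),
    powerDeriv_algEquiv hτ hP, map_add, map_mul, ← laurentEquiv_toLaurent, ← laurentEquiv_toLaurent,
    ← laurentEquiv_toLaurent, toLaurent_powerDeriv v P, ← lderiv_toLaurent, paramDeriv_congr hPG,
    paramDeriv_mul ((analyticFamilyAt_const (toLaurent PowerSeries.X ^ N) l)) hG, paramDeriv_const,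
    mul_zero, add_zero, hPG.self_of_nhds] at d1
  have d2 := mul_paramDeriv_pow hT N v
  have d3 := congrArg (laurentEquiv (σ l)) (lderiv_X_pow_mul N (G l))
  simp only [map_mul, map_add, map_pow, map_natCast, laurentEquiv_toLaurent] at d1 d3
  rw [toLaurent_powerDeriv] at d1 ⊢
  have hT0 : T l ^ (N + 1) ≠ 0 := by
    refine pow_ne_zero _ ?_
    rw [hTdef, Ne, map_eq_zero_iff _ toLaurent_injective]
    exact algEquiv_X_ne_zero _
  refine mul_left_cancel₀ hT0 ?_
  simp only [formChange_apply, hder] at d1 ⊢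
  change T l * laurentEquiv (σ l) _ = _ * (T l ^ N * _) + T l ^ (N + 1) * _ at d3
  change _ = T l ^ N * laurentEquiv (σ l) (G l) * _ + lderiv (T l) * (T l ^ N * _ + _) at d1
  change _ = T l ^ (N + 1) * (_ + (_ * paramDeriv v T l + _ * lderiv (paramDeriv v T l)))
  linear_combination T l * d1 + lderiv (T l) * paramDeriv v T l * d3 -
    laurentEquiv (σ l) (G l) * lderiv (T l) * d2

end ChangeOfCoordinate

section Surface

variable {S : Type*} [TopologicalSpace S] [ChartedSpace (ℂ × ℂ) S] {F : Foliation S}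
  {E : Type*} [NormedAddCommGroup E] [NormedSpace ℂ E]

/-! ### Pull-backs along analytic families of discs -/

theorem AnalyticParamAt.analyticPowerAt {t : E → Discs F} {q : ∀ l, (t l).Param} {l : E}
    (h : AnalyticParamAt t q l) {f : S → ℂ} (hf : IsAnalyticAt f (t l).center) :
    AnalyticPowerAt (fun m => (q m).pull f) l := h.2 f hf

theorem AnalyticParamAt.analyticFamilyAt {t : E → Discs F} {q : ∀ l, (t l).Param} {l : E}
    (h : AnalyticParamAt t q l) {f : S → ℂ} (hf : IsAnalyticAt f (t l).center) :
    AnalyticFamilyAt (fun m => toLaurent ((q m).pull f)) l := (h.analyticPowerAt hf).toLaurent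

theorem toLaurent_pullDeriv (t : E → Discs F) (q : ∀ l, (t l).Param) (l v : E) (f : S → ℂ) :
    toLaurent (pullDeriv t q l v f) = paramDeriv v (fun m => toLaurent ((q m).pull f)) l :=
  toLaurent_powerDeriv v (fun m => (q m).pull f) l

theorem AnalyticParamAt.eventuallyEq_pull {t : E → Discs F} {q : ∀ l, (t l).Param} {l : E}
    (h : AnalyticParamAt t q l) {f g : S → ℂ} (e : f =ᶠ[𝓝 (t l).center] g) :
    (fun m => (q m).pull f) =ᶠ[𝓝 l] fun m => (q m).pull g := by
  filter_upwards [h.1.eventually e.eventuallyEq_nhds] with m hm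
  exact (q m).1.pull_congr hm

theorem AnalyticParamAt.pullDeriv_congr {t : E → Discs F} {q : ∀ l, (t l).Param} {l : E}
    (h : AnalyticParamAt t q l) {f g : S → ℂ} (e : f =ᶠ[𝓝 (t l).center] g) (v : E) :
    pullDeriv t q l v f = pullDeriv t q l v g :=
  powerDeriv_congr (h.eventuallyEq_pull e) v

variable [IsManifold 𝓘(ℂ, ℂ × ℂ) ω S]

/-- The velocity of a family of coordinatised discs is a derivation along the disc. -/
theorem AnalyticParamAt.exists_velocityDerivation {t : E → Discs F} {q : ∀ l, (t l).Param} {l : E}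
    (h : AnalyticParamAt t q l) (v : E) :
    ∃ δ : Stalk (t l).center →ₗ[ℂ] ℂ⟦X⟧, (q l).1.IsDerivation δ ∧
      ∀ f, IsAnalyticAt f (t l).center → δ (germ (t l).center f) = pullDeriv t q l v f := by
  refine (q l).1.exists_derivation_of_fun _ (fun f g hf e => h.pullDeriv_congr e v)
    (fun f g hf hg => ?_) (fun f g hf hg => ?_) fun c => ?_
  · refine Eq.trans ?_ (powerDeriv_add (h.analyticPowerAt hf) (h.analyticPowerAt hg) v)
    refine powerDeriv_congr ?_ v
    -- Additivity of pull-backs at a nearby parameter requires analyticity at the moving centre,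
    -- which the continuity of the centre provides.
    filter_upwards [h.1.eventually hf.eventually, h.1.eventually hg.eventually] with m h1 h2
    exact (q m).1.pull_add h1 h2
  · refine Eq.trans ?_ (powerDeriv_mul (h.analyticPowerAt hf) (h.analyticPowerAt hg) v)
    refine powerDeriv_congr ?_ v
    filter_upwards [h.1.eventually hf.eventually, h.1.eventually hg.eventually] with m h1 h2
    exact (q m).1.pull_mul h1 h2
  · refine Eq.trans ?_ (powerDeriv_const v (PowerSeries.C c) l)
    exact powerDeriv_congr (Filter.Eventually.of_forall fun m => (q m).1.pull_const c) v

/-- The changes of coordinate between two analytic coordinates on a family are analytic. -/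
theorem AnalyticParamAt.analyticPowerAt_change {t : E → Discs F} {q q' : ∀ l, (t l).Param} {l : E}
    (h : AnalyticParamAt t q l) (h' : AnalyticParamAt t q' l) :
    AnalyticPowerAt (fun m => (q m).change (q' m) PowerSeries.X) l := by
  have key : ∀ f, IsAnalyticAt f (t l).center → PowerSeries.coeff 1 ((q l).pull f) ≠ 0 →
      AnalyticPowerAt (fun m => (q m).change (q' m) PowerSeries.X) l := by
    intro f hf hne
    refine analyticPowerAt_algEquiv_X (h.analyticPowerAt hf) ?_ hne
    simpa only [← Discs.Param.pull_change] using h'.analyticPowerAt hf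
  rcases (q l).1.immersion with hne | hne
  · exact key _ (isAnalyticAt_coord₁ _) hne
  · exact key _ (isAnalyticAt_coord₂ _) hne

/-- Differentiation of q′ = σ ∘ q. The second term comes from the motion of the coordinate and is
tangent to the disc: it disappears in the normal bundle and accounts for the shift of the canonical
lift. -/
theorem AnalyticParamAt.pullDeriv_change {t : E → Discs F} {q q' : ∀ l, (t l).Param} {l : E}
    (h : AnalyticParamAt t q l) (h' : AnalyticParamAt t q' l) {f : S → ℂ}
    (hf : IsAnalyticAt f (t l).center) (v : E) :
    pullDeriv t q' l v f = (q l).change (q' l) (pullDeriv t q l v f) +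
      (q l).change (q' l) (PowerSeries.derivative ℂ ((q l).pull f)) *
        powerDeriv v (fun m => (q m).change (q' m) PowerSeries.X) l := by
  have := powerDeriv_algEquiv (h.analyticPowerAt_change h') (h.analyticPowerAt hf) v
  simp only [← Discs.Param.pull_change] at this
  exact this

/-! ### Leaf coordinates and the canonical lift -/

theorem Foliation.IsLeafCoord.eventually {s : S} {x : S → ℂ} (hx : F.IsLeafCoord s x) :
    ∀ᶠ m in 𝓝 s, F.IsLeafCoord m x := by
  filter_upwards [hx.1.eventually, hx.2.eventually_nhds] with m h1 h2
  exact ⟨h1, h2⟩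

/-- Two leaf coordinates are functionally dependent. -/
theorem Foliation.IsLeafCoord.wedge_eq_zero {s : S} {x y : S → ℂ} (hx : F.IsLeafCoord s x)
    (hy : F.IsLeafCoord s y) {p : DiscParam F s} {δ ε : Stalk s →ₗ[ℂ] ℂ⟦X⟧}
    (hδ : p.IsDerivation δ) (hε : p.IsDerivation ε) :
    δ (germ s x) * ε (germ s y) - ε (germ s x) * δ (germ s y) = 0 := by
  rw [hδ.wedge hε hx.1 hy.1]
  have e : (fun m => partial₁ s x m * partial₂ s y m + -1 * (partial₂ s x m * partial₁ s y m))
      =ᶠ[𝓝 s] fun _ => 0 := by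
    filter_upwards [hx.2, hy.2, eventually_diff_eq hx.1, eventually_diff_eq hy.1,
      eventually_exists_diff_coord s] with m h1 h2 e1 e2 hex
    -- This vector lies in the kernel of dx, hence on the line of the foliation, hence in the kernel
    -- of dy; that is the vanishing of dx ∧ dy.
    obtain ⟨v, hv₁, hv₂⟩ := hex (-partial₂ s x m) (partial₁ s x m)
    have hv : v ∈ LinearMap.ker (diff x m) := by
      rw [LinearMap.mem_ker, e1, hv₁, hv₂]
      ring
    rw [h1, ← h2, LinearMap.mem_ker, e2, hv₁, hv₂] at hv
    linear_combination hv
  rw [p.pull_congr e, p.pull_const, map_zero, zero_mul]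

omit [IsManifold 𝓘(ℂ, ℂ × ℂ) ω S] in
-- First-order tangency means that the derivative of a leaf coordinate along the disc has a simple
-- zero, which bounds the pole of the canonical lift by one.
theorem Foliation.IsLeafCoord.coeff_derivative {s : S} {x : S → ℂ} (hx : F.IsLeafCoord s x)
    (p : DiscParam F s) : PowerSeries.coeff 0 (PowerSeries.derivative ℂ (p.pull x)) = 0 ∧
      PowerSeries.coeff 1 (PowerSeries.derivative ℂ (p.pull x)) ≠ 0 := by
  have h := p.tangency x hx
  have h1 : PowerSeries.coeff 1 (p.hom (germ s x) - PowerSeries.C (x s)) = 0 := by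
    refine PowerSeries.coeff_of_lt_order 1 ?_
    rw [h]
    norm_num
  have h2 : PowerSeries.coeff 2 (p.hom (germ s x) - PowerSeries.C (x s)) ≠ 0 :=
    ((PowerSeries.order_eq_nat (n := 2)).1 h).1
  rw [map_sub, PowerSeries.coeff_C] at h1 h2
  simp only [one_ne_zero, OfNat.ofNat_ne_zero, if_false, sub_zero] at h1 h2
  rw [PowerSeries.coeff_derivative, PowerSeries.coeff_derivative, DiscParam.pull]
  refine ⟨by simp [h1], mul_ne_zero h2 ?_⟩
  norm_num

omit [IsManifold 𝓘(ℂ, ℂ × ℂ) ω S] in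
theorem Foliation.IsLeafCoord.derivative_ne_zero {s : S} {x : S → ℂ} (hx : F.IsLeafCoord s x)
    (p : DiscParam F s) : toLaurent (PowerSeries.derivative ℂ (p.pull x)) ≠ 0 := by
  rw [Ne, map_eq_zero_iff _ toLaurent_injective]
  intro h
  exact (hx.coeff_derivative p).2 (by rw [h, map_zero])

/-- The coefficient of the canonical lift, computed with the leaf coordinate `x`. -/
def canonicalLift (t : E → Discs F) (q : ∀ l, (t l).Param) (x : S → ℂ) (v l : E) : ℂ⸨X⸩ :=
  -toLaurent (pullDeriv t q l v x) / toLaurent (PowerSeries.derivative ℂ ((q l).pull x))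

omit [IsManifold 𝓘(ℂ, ℂ × ℂ) ω S] in
theorem canonicalLift_eq {t : E → Discs F} {q : ∀ l, (t l).Param} {l : E} {x : S → ℂ}
    (hx : F.IsLeafCoord (t l).center x) (v : E) :
    toLaurent (pullDeriv t q l v x) + canonicalLift t q x v l *
      toLaurent (PowerSeries.derivative ℂ ((q l).pull x)) = 0 := by
  have h0 := hx.derivative_ne_zero (q l).1
  change toLaurent (PowerSeries.derivative ℂ ((q l).pull x)) ≠ 0 at h0
  rw [canonicalLift, div_mul_cancel₀ _ h0, add_neg_cancel]

/-- For another leaf coordinate y, dx ∧ dy = 0 on the velocity and ∂/∂z; dividing by the nonzero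
derivative of x transfers the equation from x to y. -/
theorem isCanonicalLift_canonicalLift {t : E → Discs F} {q : ∀ l, (t l).Param} {l : E}
    (h : AnalyticParamAt t q l) {x : S → ℂ} (hx : F.IsLeafCoord (t l).center x) (v : E) :
    IsCanonicalLift t q l v (canonicalLift t q x v l) := by
  intro y hy
  obtain ⟨δ, hδ, e⟩ := h.exists_velocityDerivation v
  have hw := congrArg toLaurent (hx.wedge_eq_zero hy hδ (q l).1.isDerivation_deriv)
  rw [e _ hx.1, e _ hy.1] at hw
  change toLaurent (pullDeriv t q l v x * PowerSeries.derivative ℂ ((q l).pull y) -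
    PowerSeries.derivative ℂ ((q l).pull x) * pullDeriv t q l v y) = _ at hw
  rw [map_sub, map_mul, map_mul, map_zero] at hw
  have h1 := canonicalLift_eq (q := q) hx v
  have h0 : toLaurent (PowerSeries.derivative ℂ ((q l).pull x)) ≠ 0 :=
    hx.derivative_ne_zero (q l).1
  refine (mul_eq_zero.1 ?_).resolve_left h0
  change _ * (toLaurent (pullDeriv t q l v y) +
    canonicalLift t q x v l * toLaurent (PowerSeries.derivative ℂ ((q l).pull y))) = 0
  linear_combination toLaurent (PowerSeries.derivative ℂ ((q l).pull y)) * h1 - hw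

omit [IsManifold 𝓘(ℂ, ℂ × ℂ) ω S] in
theorem IsCanonicalLift.eq_canonicalLift {t : E → Discs F} {q : ∀ l, (t l).Param} {l v : E}
    {u : ℂ⸨X⸩} (hu : IsCanonicalLift t q l v u) {x : S → ℂ}
    (hx : F.IsLeafCoord (t l).center x) : u = canonicalLift t q x v l := by
  have h0 : toLaurent (PowerSeries.derivative ℂ ((q l).pull x)) ≠ 0 :=
    hx.derivative_ne_zero (q l).1
  have h1 := canonicalLift_eq (q := q) hx v
  have h2 := hu x hx
  refine mul_right_cancel₀ h0 ?_
  linear_combination h2 - h1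

theorem eventually_isLeafCoord {t : E → Discs F} {q : ∀ l, (t l).Param} {l : E}
    (h : LocalParam t q l) {x : S → ℂ} (hx : F.IsLeafCoord (t l).center x) :
    ∀ᶠ m in 𝓝 l, F.IsLeafCoord (t m).center x :=
  h.self_of_nhds.1.eventually hx.eventually

/-- One leaf coordinate serves for all nearby discs, and tangency holds at each of them. So its
derivative is z times a family of units, and the division reduces to inverting that family and a
factor 1/z. -/
theorem analyticFamilyAt_canonicalLift {t : E → Discs F} {q : ∀ l, (t l).Param} {l : E}
    (h : LocalParam t q l) {x : S → ℂ} (hx : F.IsLeafCoord (t l).center x) (v : E) :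
    AnalyticFamilyAt (canonicalLift t q x v) l := by
  have hX := h.self_of_nhds.analyticPowerAt hx.1
  have hw := hX.derivative.divX
  have h0 : PowerSeries.constantCoeff (divX (PowerSeries.derivative ℂ ((q l).pull x))) ≠ 0 := by
    rw [divX, ← PowerSeries.coeff_zero_eq_constantCoeff_apply, PowerSeries.coeff_mk]
    exact (hx.coeff_derivative (q l).1).2
  have hd := hX.toLaurent.paramDeriv v
  have hi := (hw.inv h0).toLaurent
  refine (((hd.neg).mul hi).mul (analyticFamilyAt_const (toLaurent PowerSeries.X)⁻¹ l)).congr ?_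
  filter_upwards [eventually_isLeafCoord h hx] with m hm
  have hc := hm.coeff_derivative (q m).1
  have e : PowerSeries.derivative ℂ ((q m).pull x) =
      PowerSeries.X * divX (PowerSeries.derivative ℂ ((q m).pull x)) := by
    have := eq_X_mul_divX_add (PowerSeries.derivative ℂ ((q m).pull x))
    rwa [show PowerSeries.coeff 0 (PowerSeries.derivative ℂ ((q m).pull x)) = 0 from hc.1,
      map_zero, add_zero] at this
  have h0' : PowerSeries.constantCoeff (divX (PowerSeries.derivative ℂ ((q m).pull x))) ≠ 0 := by
    rw [divX, ← PowerSeries.coeff_zero_eq_constantCoeff_apply, PowerSeries.coeff_mk]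
    exact hc.2
  have hinv := congrArg toLaurent (PowerSeries.mul_inv_cancel _ h0')
  rw [map_mul, map_one] at hinv
  rw [canonicalLift, toLaurent_pullDeriv]
  have e' : toLaurent (PowerSeries.derivative ℂ ((q m).pull x)) = toLaurent PowerSeries.X *
      toLaurent (divX (PowerSeries.derivative ℂ ((q m).pull x))) := by
    rw [← map_mul, ← e]
  rw [e', div_eq_mul_inv, mul_inv, ← eq_inv_of_mul_eq_one_right hinv]
  ring

/-! ### The covariant derivative -/

/-- `γ` is an analytic section at `l`. -/
def AnalyticSectionAt (t : E → Discs F) (γ : ∀ l, HFiber (t l)) (l : E) : Prop :=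
  ∀ q, LocalParam t q l → AnalyticFamilyAt (fun m => (γ m).coord (q m)) l

/-- The Lie derivative of a relative form in a coordinate: `∂_v g + ∂(u g)/∂z`. -/
def lieDeriv (v : E) (u : ℂ⸨X⸩) (G : E → ℂ⸨X⸩) (l : E) : ℂ⸨X⸩ :=
  paramDeriv v G l + lderiv (u * G l)

omit [IsManifold 𝓘(ℂ, ℂ × ℂ) ω S] in
theorem isCovDeriv_iff {t : E → Discs F} {γ : ∀ l, HFiber (t l)} {l : E}
    (hγ : AnalyticSectionAt t γ l) (v : E) (η : HFiber (t l)) :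
    IsCovDeriv t γ l v η ↔ ∀ q, LocalParam t q l → ∀ u, IsCanonicalLift t q l v u →
      η.coord (q l) = lieDeriv v u (fun m => (γ m).coord (q m)) l := by
  refine forall₂_congr fun q hq => forall₂_congr fun u _ => ?_
  have key : ∀ n : ℤ, (lieDeriv v u (fun m => (γ m).coord (q m)) l).coeff n =
      fderiv ℂ (fun m => ((γ m).coord (q m)).coeff n) l v +
        (LaurentSeries.derivative ℂ (u * (γ l).coord (q l))).coeff n := fun n => by
    rw [lieDeriv, HahnSeries.coeff_add, (hγ q hq).coeff_paramDeriv]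
  constructor
  · intro h
    ext n
    rw [h n, key]
  · intro h n
    rw [h, key]

/-- The canonical lifts in two coordinates. -/
theorem IsCanonicalLift.change {t : E → Discs F} {q q' : ∀ l, (t l).Param} {l : E}
    (h : AnalyticParamAt t q l) (h' : AnalyticParamAt t q' l) {v : E} {u u' : ℂ⸨X⸩}
    (hu : IsCanonicalLift t q l v u) (hu' : IsCanonicalLift t q' l v u') :
    u' * toLaurent (PowerSeries.derivative ℂ ((q l).change (q' l) PowerSeries.X)) =
      laurentEquiv ((q l).change (q' l)) u -
        toLaurent (powerDeriv v (fun m => (q m).change (q' m) PowerSeries.X) l) := by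
  obtain ⟨x, hx'⟩ := F.exists_leafCoord (t l).center
  have hx : F.IsLeafCoord (t l).center x := hx'
  have e := congrArg (laurentEquiv ((q l).change (q' l))) (hu x hx)
  have e' := hu' x hx
  rw [h.pullDeriv_change h' hx.1, Discs.Param.pull_change (q l) (q' l), derivative_algEquiv,
    map_add, map_mul, map_mul] at e'
  rw [map_add, map_mul, laurentEquiv_algebraMap, laurentEquiv_algebraMap, map_zero] at e
  have h0 : toLaurent ((q l).change (q' l) (PowerSeries.derivative ℂ ((q l).pull x))) ≠ 0 := by
    have := hx.derivative_ne_zero (q l).1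
    rw [Ne, map_eq_zero_iff _ toLaurent_injective] at this ⊢
    rwa [map_eq_zero_iff _ (AlgEquiv.injective _)]
  refine mul_left_cancel₀ h0 ?_
  linear_combination e' - e

/-- The Lie derivative along the canonical lift does not depend on the coordinate. -/
theorem lieDeriv_change {t : E → Discs F} {q q' : ∀ l, (t l).Param} {l : E}
    (hq : LocalParam t q l) (hq' : LocalParam t q' l) {v : E} {u u' : ℂ⸨X⸩}
    (hu : IsCanonicalLift t q l v u) (hu' : IsCanonicalLift t q' l v u')
    {γ : ∀ l, HFiber (t l)} (hγ : AnalyticSectionAt t γ l) :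
    lieDeriv v u' (fun m => (γ m).coord (q' m)) l =
      formChange ((q l).change (q' l)) (lieDeriv v u (fun m => (γ m).coord (q m)) l) := by
  have hc : ∀ m, (γ m).coord (q' m) = formChange ((q m).change (q' m)) ((γ m).coord (q m)) :=
    fun m => (γ m).coord_reparam ((q m).reparam_change (q' m))
  have hG' := hγ q' hq'
  simp only [hc] at hG' ⊢
  have d := paramDeriv_formChange
    (hq.self_of_nhds.analyticPowerAt_change hq'.self_of_nhds) (hγ q hq) hG' v
  have hlift := hu.change hq.self_of_nhds hq'.self_of_nhds hu'
  rw [lieDeriv, d, lieDeriv, map_add, ← lderiv_laurentEquiv _ (u * _),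
    map_mul (laurentEquiv _)]
  set σ := (q l).change (q' l)
  set θ := toLaurent (powerDeriv v (fun m => (q m).change (q' m) PowerSeries.X) l)
  -- The shift −θ of the lift cancels the term ∂(θ σ(g))/∂z that arises from differentiating the
  -- change of coordinate.
  have e : u' * formChange σ ((γ l).coord (q l)) =
      laurentEquiv σ u * laurentEquiv σ ((γ l).coord (q l)) -
        θ * laurentEquiv σ ((γ l).coord (q l)) := by
    rw [formChange_apply]
    linear_combination laurentEquiv σ ((γ l).coord (q l)) * hlift
  rw [e, map_sub, lderiv_mul θ, lderiv_laurentEquiv]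
  ring

omit [IsManifold 𝓘(ℂ, ℂ × ℂ) ω S] in
-- The residue of the family is identically zero, so its parameter derivative vanishes, and the
-- remaining term is exact. Hence the connection stays in `H`.
theorem AnalyticSectionAt.residue_lieDeriv {t : E → Discs F} {γ : ∀ l, HFiber (t l)} {l : E}
    (hγ : AnalyticSectionAt t γ l) {q : ∀ l, (t l).Param} (hq : LocalParam t q l) (v : E)
    (u : ℂ⸨X⸩) : residue (lieDeriv v u (fun m => (γ m).coord (q m)) l) = 0 := by
  rw [lieDeriv, residue_add, residue_lderiv, add_zero, ← fderiv_residue (hγ q hq)]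
  simp only [HFiber.residue_coord]
  simp

/-- The Lie derivative in one analytic coordinate defines the form, and `lieDeriv_change` verifies
the condition in every other. -/
theorem exists_isCovDeriv {t : E → Discs F} {γ : ∀ l, HFiber (t l)} {l : E}
    (hγ : AnalyticSectionAt t γ l) {q : ∀ l, (t l).Param} (hq : LocalParam t q l) (v : E) :
    ∃ η, IsCovDeriv t γ l v η := by
  obtain ⟨x, hx⟩ := F.exists_leafCoord (t l).center
  have hu := isCanonicalLift_canonicalLift hq.self_of_nhds hx v
  obtain ⟨η, hη⟩ := exists_hfiber (q l) (hγ.residue_lieDeriv hq v (canonicalLift t q x v l))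
  refine ⟨η, (isCovDeriv_iff hγ v η).2 fun q' hq' u' hu' => ?_⟩
  rw [lieDeriv_change hq hq' hu hu' hγ, ← hη]
  exact η.coord_reparam ((q l).reparam_change (q' l))

/-- The expression of the covariant derivative in an analytic coordinate. -/
theorem coord_nabla {t : E → Discs F} {γ : ∀ l, HFiber (t l)} {l : E}
    (hγ : AnalyticSectionAt t γ l) {q : ∀ l, (t l).Param} (hq : LocalParam t q l) {v : E}
    {u : ℂ⸨X⸩} (hu : IsCanonicalLift t q l v u) :
    (nabla t v γ l).coord (q l) = lieDeriv v u (fun m => (γ m).coord (q m)) l :=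
  (isCovDeriv_iff hγ v _).1 (Classical.epsilon_spec (exists_isCovDeriv hγ hq v)) q hq u hu

omit [IsManifold 𝓘(ℂ, ℂ × ℂ) ω S] in
theorem LocalParam.eventually {t : E → Discs F} {q : ∀ l, (t l).Param} {l : E}
    (hq : LocalParam t q l) : ∀ᶠ m in 𝓝 l, LocalParam t q m :=
  hq.eventually_nhds

/-- The expression of the covariant derivative near a point. -/
theorem eventually_coord_nabla {t : E → Discs F} {γ : ∀ l, HFiber (t l)} {l : E}
    (hγ : ∀ᶠ m in 𝓝 l, AnalyticSectionAt t γ m) {q : ∀ l, (t l).Param} (hq : LocalParam t q l)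
    (v : E) {x : S → ℂ} (hx : F.IsLeafCoord (t l).center x) :
    ∀ᶠ m in 𝓝 l, (nabla t v γ m).coord (q m) =
      paramDeriv v (fun m => (γ m).coord (q m)) m +
        lderiv (canonicalLift t q x v m * (γ m).coord (q m)) := by
  filter_upwards [hγ, hq.eventually, eventually_isLeafCoord hq hx] with m h1 h2 h3
  exact coord_nabla h1 h2 (isCanonicalLift_canonicalLift h2.self_of_nhds h3 v)

/-- Analyticity of γ is required on a neighbourhood because the values of `nabla`, selected by
choice, are controlled only where a covariant derivative exists. -/
theorem AnalyticSectionAt.nabla {t : E → Discs F} {γ : ∀ l, HFiber (t l)} {l : E}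
    (hγ : ∀ᶠ m in 𝓝 l, AnalyticSectionAt t γ m) (v : E) :
    AnalyticSectionAt t (nabla t v γ) l := by
  intro q hq
  obtain ⟨x, hx⟩ := F.exists_leafCoord (t l).center
  have hG := hγ.self_of_nhds q hq
  refine ((hG.paramDeriv v).add
    ((analyticFamilyAt_canonicalLift hq hx v).mul hG).lderiv).congr ?_
  filter_upwards [eventually_coord_nabla hγ hq v hx] with m hm using hm.symm

omit [IsManifold 𝓘(ℂ, ℂ × ℂ) ω S] in
theorem canonicalLift_smul_add {t : E → Discs F} {q : ∀ l, (t l).Param} {l : E}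
    (h : AnalyticParamAt t q l) {x : S → ℂ} (hx : F.IsLeafCoord (t l).center x) (a : ℂ) (v w : E) :
    canonicalLift t q x (a • v + w) l =
      HahnSeries.C a * canonicalLift t q x v l + canonicalLift t q x w l := by
  rw [canonicalLift, canonicalLift, canonicalLift, toLaurent_pullDeriv, toLaurent_pullDeriv,
    toLaurent_pullDeriv, paramDeriv_smul_add (h.analyticFamilyAt hx.1)]
  ring

theorem lderiv_C_mul (a : ℂ) (g : ℂ⸨X⸩) : lderiv (HahnSeries.C a * g) =
    HahnSeries.C a * lderiv g := by
  rw [HahnSeries.C_mul_eq_smul, map_smul, HahnSeries.C_mul_eq_smul]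

omit [IsManifold 𝓘(ℂ, ℂ × ℂ) ω S] in
theorem HFiber.coord_smul_eq {t : Discs F} (c : ℂ) (γ : HFiber t) (p : t.Param) :
    (c • γ).coord p = HahnSeries.C c * γ.coord p := by
  rw [HFiber.coord_smul, HahnSeries.C_mul_eq_smul]

theorem nabla_smul_add_direction {t : E → Discs F} {γ : ∀ l, HFiber (t l)} {l : E}
    (hγ : AnalyticSectionAt t γ l) {q : ∀ l, (t l).Param} (hq : LocalParam t q l) (a : ℂ)
    (v w : E) : nabla t (a • v + w) γ l = a • nabla t v γ l + nabla t w γ l := by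
  obtain ⟨x, hx⟩ := F.exists_leafCoord (t l).center
  have hu := isCanonicalLift_canonicalLift hq.self_of_nhds hx
  refine HFiber.ext_coord (q l) ?_
  rw [HFiber.coord_add, HFiber.coord_smul_eq, coord_nabla hγ hq (hu _), coord_nabla hγ hq (hu _),
    coord_nabla hγ hq (hu _), canonicalLift_smul_add hq.self_of_nhds hx, lieDeriv, lieDeriv,
    lieDeriv, paramDeriv_smul_add (hγ q hq), add_mul, map_add, mul_assoc, lderiv_C_mul]
  ring

omit [IsManifold 𝓘(ℂ, ℂ × ℂ) ω S] in
theorem AnalyticSectionAt.add {t : E → Discs F} {γ γ' : ∀ l, HFiber (t l)} {l : E}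
    (hγ : AnalyticSectionAt t γ l) (hγ' : AnalyticSectionAt t γ' l) :
    AnalyticSectionAt t (fun m => γ m + γ' m) l := fun q hq => (hγ q hq).add (hγ' q hq)

theorem nabla_add {t : E → Discs F} {γ γ' : ∀ l, HFiber (t l)} {l : E}
    (hγ : AnalyticSectionAt t γ l) (hγ' : AnalyticSectionAt t γ' l) {q : ∀ l, (t l).Param}
    (hq : LocalParam t q l) (v : E) :
    nabla t v (fun m => γ m + γ' m) l = nabla t v γ l + nabla t v γ' l := by
  obtain ⟨x, hx⟩ := F.exists_leafCoord (t l).center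
  have hu := isCanonicalLift_canonicalLift hq.self_of_nhds hx
  refine HFiber.ext_coord (q l) ?_
  rw [HFiber.coord_add, coord_nabla hγ hq (hu _), coord_nabla hγ' hq (hu _),
    coord_nabla (hγ.add hγ') hq (hu _), lieDeriv, lieDeriv, lieDeriv]
  simp only [HFiber.coord_add]
  rw [paramDeriv_add (hγ q hq) (hγ' q hq), mul_add, map_add]
  ring

omit [IsManifold 𝓘(ℂ, ℂ × ℂ) ω S] in
theorem AnalyticSectionAt.smul {t : E → Discs F} {γ : ∀ l, HFiber (t l)} {l : E}
    (hγ : AnalyticSectionAt t γ l) {f : E → ℂ} (hf : AnalyticAt ℂ f l) :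
    AnalyticSectionAt t (fun m => f m • γ m) l := fun q hq => by
  simpa only [HFiber.coord_smul_eq] using (analyticFamilyAt_C hf).mul (hγ q hq)

theorem nabla_smul {t : E → Discs F} {γ : ∀ l, HFiber (t l)} {l : E}
    (hγ : AnalyticSectionAt t γ l) {f : E → ℂ} (hf : AnalyticAt ℂ f l) {q : ∀ l, (t l).Param}
    (hq : LocalParam t q l) (v : E) :
    nabla t v (fun m => f m • γ m) l = fderiv ℂ f l v • γ l + f l • nabla t v γ l := by
  obtain ⟨x, hx⟩ := F.exists_leafCoord (t l).center
  have hu := isCanonicalLift_canonicalLift hq.self_of_nhds hx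
  refine HFiber.ext_coord (q l) ?_
  rw [HFiber.coord_add, HFiber.coord_smul_eq, HFiber.coord_smul_eq, coord_nabla hγ hq (hu _),
    coord_nabla (hγ.smul hf) hq (hu _), lieDeriv, lieDeriv]
  simp only [HFiber.coord_smul_eq]
  rw [paramDeriv_mul (analyticFamilyAt_C hf) (hγ q hq), paramDeriv_C hf, mul_left_comm,
    lderiv_C_mul]
  ring

/-- The canonical lifts of commuting vector fields commute. -/
theorem canonicalLift_flat {t : E → Discs F} {q : ∀ l, (t l).Param} {l : E}
    (hq : LocalParam t q l) {x : S → ℂ} (hx : F.IsLeafCoord (t l).center x) (v w : E) :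
    paramDeriv v (canonicalLift t q x w) l + canonicalLift t q x v l *
        lderiv (canonicalLift t q x w l) =
      paramDeriv w (canonicalLift t q x v) l + canonicalLift t q x w l *
        lderiv (canonicalLift t q x v l) := by
  have hX := hq.self_of_nhds.analyticFamilyAt hx.1
  set X : E → ℂ⸨X⸩ := fun m => toLaurent ((q m).pull x) with hXdef
  have hu := analyticFamilyAt_canonicalLift hq hx
  have hrel : ∀ v, ∀ᶠ m in 𝓝 l, paramDeriv v X m = -(canonicalLift t q x v m * lderiv (X m)) := by
    intro v
    filter_upwards [eventually_isLeafCoord hq hx] with m hm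
    have := canonicalLift_eq (q := q) hm v
    rw [toLaurent_pullDeriv, ← lderiv_toLaurent] at this
    exact eq_neg_of_add_eq_zero_left this
  -- The relation x_v = −u_v x_z is used twice to express a mixed derivative of x. In the equality
  -- of the two mixed derivatives u_v u_w x_zz cancels, and x_z can be divided out.
  have hsecond : ∀ v w, paramDeriv w (fun m => paramDeriv v X m) l =
      canonicalLift t q x v l * (canonicalLift t q x w l * lderiv (lderiv (X l)) +
        lderiv (X l) * lderiv (canonicalLift t q x w l)) -
      lderiv (X l) * paramDeriv w (canonicalLift t q x v) l := by
    intro v w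
    rw [paramDeriv_congr (hrel v), paramDeriv_neg ((hu v).mul hX.lderiv),
      paramDeriv_mul (hu v) hX.lderiv, paramDeriv_lderiv hX, (hrel w).self_of_nhds, map_neg,
      lderiv_mul]
    ring
  have hcomm := paramDeriv_comm hX v w
  rw [hsecond, hsecond] at hcomm
  have h0 : lderiv (X l) ≠ 0 := by
    rw [hXdef, lderiv_toLaurent]
    exact hx.derivative_ne_zero (q l).1
  refine mul_left_cancel₀ h0 ?_
  linear_combination -hcomm

/-- The terms are arranged so that all are symmetric in `v`, `w` except ∂_v u_w + u_v ∂_z u_w, whose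
symmetry is `canonicalLift_flat`. -/
theorem coord_nabla_nabla {t : E → Discs F} {γ : ∀ l, HFiber (t l)} {l : E}
    (hγ : ∀ᶠ m in 𝓝 l, AnalyticSectionAt t γ m) {q : ∀ l, (t l).Param} (hq : LocalParam t q l)
    (v w : E) {x : S → ℂ} (hx : F.IsLeafCoord (t l).center x) :
    (nabla t v (nabla t w γ) l).coord (q l) =
      paramDeriv v (fun m => paramDeriv w (fun m => (γ m).coord (q m)) m) l +
      (lderiv (canonicalLift t q x w l * paramDeriv v (fun m => (γ m).coord (q m)) l) +
        lderiv (canonicalLift t q x v l * paramDeriv w (fun m => (γ m).coord (q m)) l)) +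
      lderiv ((γ l).coord (q l) * (paramDeriv v (canonicalLift t q x w) l +
          canonicalLift t q x v l * lderiv (canonicalLift t q x w l)) +
        canonicalLift t q x v l * canonicalLift t q x w l * lderiv ((γ l).coord (q l))) := by
  have hG := hγ.self_of_nhds q hq
  have hu := analyticFamilyAt_canonicalLift hq hx
  have hn := eventually_coord_nabla hγ hq w hx
  rw [coord_nabla (AnalyticSectionAt.nabla hγ w) hq
    (isCanonicalLift_canonicalLift hq.self_of_nhds hx v), lieDeriv, paramDeriv_congr hn,
    paramDeriv_add (hG.paramDeriv w) ((hu w).mul hG).lderiv, paramDeriv_lderiv ((hu w).mul hG),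
    paramDeriv_mul (hu w) hG, hn.self_of_nhds, lderiv_mul (canonicalLift t q x w l),
    add_assoc, add_assoc, ← map_add, ← map_add, ← map_add]
  congr 2
  ring

theorem nabla_flat {t : E → Discs F} {γ : ∀ l, HFiber (t l)} {l : E}
    (hγ : ∀ᶠ m in 𝓝 l, AnalyticSectionAt t γ m) {q : ∀ l, (t l).Param} (hq : LocalParam t q l)
    (v w : E) : nabla t v (nabla t w γ) l = nabla t w (nabla t v γ) l := by
  obtain ⟨x, hx⟩ := F.exists_leafCoord (t l).center
  refine HFiber.ext_coord (q l) ?_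
  rw [coord_nabla_nabla hγ hq v w hx, coord_nabla_nabla hγ hq w v hx,
    paramDeriv_comm (hγ.self_of_nhds q hq) v w, canonicalLift_flat hq hx v w,
    mul_comm (canonicalLift t q x v l) (canonicalLift t q x w l),
    add_comm (lderiv (canonicalLift t q x w l * _))]

/-- Differentiating Res(f η) by the product rule leaves the two terms with u to be compared:
integration by parts makes them opposite, and the constant in the primitive of an exact form pairs
to zero with a residue-free form. -/
theorem nabla_symplectic {t : E → Discs F} {γ γ' : ∀ l, HFiber (t l)} {l : E}
    (hγ : AnalyticSectionAt t γ l) (hγ' : AnalyticSectionAt t γ' l) {q : ∀ l, (t l).Param}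
    (hq : LocalParam t q l) (v : E) :
    AnalyticAt ℂ (fun m => pairing (t m) (γ m) (γ' m)) l ∧
    fderiv ℂ (fun m => pairing (t m) (γ m) (γ' m)) l v =
      pairing (t l) (nabla t v γ l) (γ' l) + pairing (t l) (γ l) (nabla t v γ' l) := by
  obtain ⟨x, hx⟩ := F.exists_leafCoord (t l).center
  have hu := isCanonicalLift_canonicalLift hq.self_of_nhds hx
  have hG := hγ q hq
  have hG' := hγ' q hq
  have e : (fun m => pairing (t m) (γ m) (γ' m)) = fun m =>
      residue (primitive ((γ m).coord (q m)) * (γ' m).coord (q m)) :=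
    funext fun m => pairing_eq _ _ (q m)
  rw [e]
  refine ⟨(hG.primitive.mul hG').residue, ?_⟩
  rw [fderiv_residue (hG.primitive.mul hG'), paramDeriv_mul hG.primitive hG',
    paramDeriv_primitive hG, pairing_eq _ _ (q l), pairing_eq _ _ (q l),
    coord_nabla hγ hq (hu v), coord_nabla hγ' hq (hu v), lieDeriv, lieDeriv, map_add,
    primitive_lderiv, mul_add, add_mul, sub_mul]
  simp only [sub_eq_add_neg, residue_add, residue_mul_lderiv, ← neg_mul, ← map_neg, residue_C_mul,
    HFiber.residue_coord, lderiv_primitive ((γ l).residue_coord (q l))]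
  rw [mul_comm ((γ' l).coord (q l)),
    mul_right_comm (canonicalLift t q x v l) ((γ' l).coord (q l))]
  ring

theorem inducesFlatSymplecticConnection {U : Set E} (hU : IsOpen U) {t : E → Discs F}
    (ht : IsAnalyticFamily U t) : InducesFlatSymplecticConnection U t where
  existsUnique_lift l _ q hq v := by
    obtain ⟨x, hx⟩ := F.exists_leafCoord (t l).center
    exact ⟨_, isCanonicalLift_canonicalLift hq.self_of_nhds hx v,
      fun u hu => hu.eq_canonicalLift hx⟩
  existsUnique γ hγ l hl v := by
    obtain ⟨q, hq⟩ := ht l hl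
    obtain ⟨x, hx⟩ := F.exists_leafCoord (t l).center
    have hu := isCanonicalLift_canonicalLift hq.self_of_nhds hx v
    have hγl : AnalyticSectionAt t γ l := hγ l hl
    obtain ⟨η, hη⟩ := exists_isCovDeriv hγl hq v
    refine ⟨η, hη, fun η' hη' => HFiber.ext_coord (q l) ?_⟩
    rw [(isCovDeriv_iff hγl v η').1 hη' q hq _ hu, (isCovDeriv_iff hγl v η).1 hη q hq _ hu]
  analytic γ hγ v l hl := AnalyticSectionAt.nabla (by
    filter_upwards [hU.mem_nhds hl] with m hm using hγ m hm) v
  linear_direction γ hγ l hl a v w :=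
    let ⟨_, hq⟩ := ht l hl
    nabla_smul_add_direction (hγ l hl) hq a v w
  additive γ γ' hγ hγ' l hl v :=
    let ⟨_, hq⟩ := ht l hl
    nabla_add (hγ l hl) (hγ' l hl) hq v
  leibniz f hf γ hγ l hl v :=
    let ⟨_, hq⟩ := ht l hl
    nabla_smul (hγ l hl) (hf l hl) hq v
  flat γ hγ l hl v w :=
    let ⟨_, hq⟩ := ht l hl
    nabla_flat (by filter_upwards [hU.mem_nhds hl] with m hm using hγ m hm) hq v w
  symplectic γ γ' hγ hγ' l hl v :=
    let ⟨_, hq⟩ := ht l hl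
    nabla_symplectic (hγ l hl) (hγ' l hl) hq v

end Surface

section Surface

variable {S : Type*} [TopologicalSpace S] [ChartedSpace (ℂ × ℂ) S] {F : Foliation S}
  {E : Type*} [NormedAddCommGroup E] [NormedSpace ℂ E]

/-! ### The velocity of a family of discs -/

theorem FieldsAlong.ext_param {t : Discs F} {δ ε : FieldsAlong t} (p : t.Param)
    (h : ∀ f, IsAnalyticAt f t.center → δ.1 p (germ t.center f) = ε.1 p (germ t.center f)) :
    δ = ε := by
  apply Subtype.ext
  funext p'
  ext1 g
  obtain ⟨f, hf, rfl⟩ := g.exists_germ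
  rw [δ.reparam (p.reparam_change p'), ε.reparam (p.reparam_change p'), h f hf]

theorem IsVelocity.unique {t : E → Discs F} {q : ∀ l, (t l).Param} {l v : E}
    (hq : LocalParam t q l) {ξ ξ' : TangentDiscs (t l)} (h : IsVelocity t l v ξ)
    (h' : IsVelocity t l v ξ') : ξ = ξ' := by
  obtain ⟨δ, rfl, hδ⟩ := h q hq
  obtain ⟨ε, rfl, hε⟩ := h' q hq
  rw [FieldsAlong.ext_param (q l) fun f hf => (hδ f hf).trans (hε f hf).symm]

variable [IsManifold 𝓘(ℂ, ℂ × ℂ) ω S]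

/-- In two analytic coordinates the derivatives of the pull-back differ by the tangent field (∂_v
σ(z) / σ(z)′) ∂/∂z, so they define the same section of the normal bundle. -/
theorem exists_isVelocity {t : E → Discs F} {q : ∀ l, (t l).Param} {l : E}
    (hq : LocalParam t q l) (v : E) : ∃ ξ, IsVelocity t l v ξ := by
  obtain ⟨δ, hδ, e⟩ := hq.self_of_nhds.exists_velocityDerivation v
  obtain ⟨ε, rfl⟩ := exists_fieldsAlong (q l) hδ
  refine ⟨Submodule.Quotient.mk ε, fun q' hq' => ?_⟩
  obtain ⟨δ', hδ', e'⟩ := hq'.self_of_nhds.exists_velocityDerivation v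
  obtain ⟨ε', rfl⟩ := exists_fieldsAlong (q' l) hδ'
  refine ⟨ε', ?_, e'⟩
  rw [Submodule.Quotient.eq]
  have hinv := PowerSeries.mul_inv_cancel _
    (constantCoeff_derivative_algEquiv_X ((q l).change (q' l)))
  refine mem_tangentFields (q' l) ⟨powerDeriv v (fun m => (q m).change (q' m) PowerSeries.X) l *
    (PowerSeries.derivative ℂ ((q l).change (q' l) PowerSeries.X))⁻¹, fun g => ?_⟩
  obtain ⟨f, hf, rfl⟩ := g.exists_germ
  change ε'.1 (q' l) (germ _ f) - ε.1 (q' l) (germ _ f) = _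
  rw [e' f hf, ε.reparam ((q l).reparam_change (q' l)), e f hf,
    hq.self_of_nhds.pullDeriv_change hq'.self_of_nhds hf, (q l).reparam_change (q' l),
    derivative_algEquiv ((q l).change (q' l)) ((q l).1.hom _), Discs.Param.pull, DiscParam.pull]
  linear_combination (-((q l).change (q' l) (PowerSeries.derivative ℂ
    ((q l).1.hom (germ (t l).center f))) *
      powerDeriv v (fun m => (q m).change (q' m) PowerSeries.X) l)) * hinv

/-- The contraction of `ω`, written in the chart at `s`, with the velocity of a family of discs. -/
def symplecticCoeff (Ω : SymplecticForm S) (t : E → Discs F) (q : ∀ l, (t l).Param) (s : S)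
    (v m : E) : ℂ⟦X⟧ :=
  (q m).pull (Ω.density s) *
    (pullDeriv t q m v (coord₁ s) * PowerSeries.derivative ℂ ((q m).pull (coord₂ s)) -
      PowerSeries.derivative ℂ ((q m).pull (coord₁ s)) * pullDeriv t q m v (coord₂ s))

/-- The definition of φ at `t m` uses the preferred chart at the centre of `t m`, which may jump
with `m`. The Jacobian in the density compensates that in the wedge of the coordinates, so a fixed
chart at `s` computes φ for all nearby discs and the result can be differentiated. -/
theorem coord_phiPull (Ω : SymplecticForm S) {t : E → Discs F} {q : ∀ l, (t l).Param} {m : E}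
    (hq : LocalParam t q m) (v : E) {s : S}
    (h : ∀ᶠ x in 𝓝 (t m).center, ∀ v w, Ω.form x v w = Ω.density s x *
      (diff (coord₁ s) x v * diff (coord₂ s) x w - diff (coord₁ s) x w * diff (coord₂ s) x v))
    (h₀ : IsAnalyticAt (Ω.density s) (t m).center)
    (h₁ : IsAnalyticAt (coord₁ s) (t m).center) (h₂ : IsAnalyticAt (coord₂ s) (t m).center) :
    (phiPull Ω t v m).coord (q m) = toLaurent (symplecticCoeff Ω t q s v m) := by
  obtain ⟨δ, hδ, e⟩ := Classical.epsilon_spec (exists_isVelocity hq v) q hq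
  have hvel : velocity t m v = Submodule.Quotient.mk δ := hδ.symm
  rw [phiPull, hvel, coord_phi_mk]
  congr 1
  have hw := (δ.isDerivation (q m)).wedge (q m).1.isDerivation_deriv h₁ h₂
  rw [e _ h₁, e _ h₂] at hw
  have hJ := ((h₁.chartDeriv (1, 0)).mul (h₂.chartDeriv (0, 1))).add
    ((isAnalyticAt_const (-1) _).mul ((h₁.chartDeriv (0, 1)).mul (h₂.chartDeriv (1, 0))))
  change pullDeriv t q m v (coord₁ s) * PowerSeries.derivative ℂ ((q m).pull (coord₂ s)) -
      PowerSeries.derivative ℂ ((q m).pull (coord₁ s)) * pullDeriv t q m v (coord₂ s) = _ at hw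
  rw [symplecticCoeff, hw, contractCoeff, (q m).1.pull_congr (Ω.density_eq h h₁ h₂),
    (q m).1.pull_mul h₀ hJ]
  exact mul_assoc _ _ _

theorem eventually_coord_phiPull (Ω : SymplecticForm S) {t : E → Discs F} {q : ∀ l, (t l).Param}
    {l : E} (hq : LocalParam t q l) (v : E) :
    ∀ᶠ m in 𝓝 l, (phiPull Ω t v m).coord (q m) =
      toLaurent (symplecticCoeff Ω t q (t l).center v m) := by
  have hc := hq.self_of_nhds.1
  filter_upwards [hq.eventually, hc.eventually (Ω.form_eq (t l).center).eventually_nhds,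
    hc.eventually (Ω.isAnalyticAt_density _).eventually,
    hc.eventually (isAnalyticAt_coord₁ _).eventually,
    hc.eventually (isAnalyticAt_coord₂ _).eventually] with m h1 h2 h3 h4 h5
  exact coord_phiPull Ω h1 v h2 h3 h4 h5

omit [IsManifold 𝓘(ℂ, ℂ × ℂ) ω S] in
theorem toLaurent_symplecticCoeff (Ω : SymplecticForm S) (t : E → Discs F)
    (q : ∀ l, (t l).Param) (s : S) (v m : E) :
    toLaurent (symplecticCoeff Ω t q s v m) = toLaurent ((q m).pull (Ω.density s)) *
      (paramDeriv v (fun m => toLaurent ((q m).pull (coord₁ s))) m *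
          lderiv (toLaurent ((q m).pull (coord₂ s))) -
        lderiv (toLaurent ((q m).pull (coord₁ s))) *
          paramDeriv v (fun m => toLaurent ((q m).pull (coord₂ s))) m) := by
  rw [symplecticCoeff, map_mul, map_sub, map_mul, map_mul, toLaurent_pullDeriv,
    toLaurent_pullDeriv, lderiv_toLaurent, lderiv_toLaurent]

theorem analyticSectionAt_phiPull (Ω : SymplecticForm S) (t : E → Discs F) (l v : E) :
    AnalyticSectionAt t (phiPull Ω t v) l := by
  intro q hq
  have hH := hq.self_of_nhds.analyticFamilyAt (Ω.isAnalyticAt_density (t l).center)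
  have hA := hq.self_of_nhds.analyticFamilyAt (isAnalyticAt_coord₁ (t l).center)
  have hB := hq.self_of_nhds.analyticFamilyAt (isAnalyticAt_coord₂ (t l).center)
  refine (hH.mul (((hA.paramDeriv v).mul hB.lderiv).sub (hA.lderiv.mul (hB.paramDeriv v)))).congr ?_
  filter_upwards [eventually_coord_phiPull Ω hq v] with m hm
  rw [hm, toLaurent_symplecticCoeff]

theorem phiPull_smul_add (Ω : SymplecticForm S) {t : E → Discs F} {q : ∀ l, (t l).Param} {l : E}
    (hq : LocalParam t q l) (a : ℂ) (v w : E) :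
    phiPull Ω t (a • v + w) l = a • phiPull Ω t v l + phiPull Ω t w l := by
  have hA := hq.self_of_nhds.analyticFamilyAt (isAnalyticAt_coord₁ (t l).center)
  have hB := hq.self_of_nhds.analyticFamilyAt (isAnalyticAt_coord₂ (t l).center)
  refine HFiber.ext_coord (q l) ?_
  rw [HFiber.coord_add, HFiber.coord_smul_eq, (eventually_coord_phiPull Ω hq _).self_of_nhds,
    (eventually_coord_phiPull Ω hq _).self_of_nhds, (eventually_coord_phiPull Ω hq _).self_of_nhds,
    toLaurent_symplecticCoeff, toLaurent_symplecticCoeff, toLaurent_symplecticCoeff,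
    paramDeriv_smul_add hA, paramDeriv_smul_add hB]
  ring

/-! ### Covariant closedness -/

/-- Chain rule for the derivatives of a pulled back function. -/
theorem AnalyticParamAt.paramDeriv_pull {t : E → Discs F} {q : ∀ l, (t l).Param} {l : E}
    (h : AnalyticParamAt t q l) {f : S → ℂ} (hf : IsAnalyticAt f (t l).center) (v : E) :
    paramDeriv v (fun m => toLaurent ((q m).pull f)) l =
      toLaurent ((q l).pull (partial₁ (t l).center f)) *
        paramDeriv v (fun m => toLaurent ((q m).pull (coord₁ (t l).center))) l +
      toLaurent ((q l).pull (partial₂ (t l).center f)) *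
        paramDeriv v (fun m => toLaurent ((q m).pull (coord₂ (t l).center))) l := by
  obtain ⟨δ, hδ, e⟩ := h.exists_velocityDerivation v
  have := congrArg toLaurent (hδ.eq_partials hf)
  rw [e _ hf, e _ (isAnalyticAt_coord₁ _), e _ (isAnalyticAt_coord₂ _), map_add, map_mul, map_mul,
    toLaurent_pullDeriv, toLaurent_pullDeriv, toLaurent_pullDeriv] at this
  exact this

theorem lderiv_pull {t : Discs F} (p : t.Param) {f : S → ℂ} (hf : IsAnalyticAt f t.center) :
    lderiv (toLaurent (p.pull f)) =
      toLaurent (p.pull (partial₁ t.center f)) * lderiv (toLaurent (p.pull (coord₁ t.center))) +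
      toLaurent (p.pull (partial₂ t.center f)) * lderiv (toLaurent (p.pull (coord₂ t.center))) := by
  have := congrArg toLaurent (p.1.derivative_pull hf)
  rw [map_add, map_mul, map_mul] at this
  rw [lderiv_toLaurent, lderiv_toLaurent, lderiv_toLaurent]
  exact this

/-- The symplectic form vanishes on two fields that are tangent to the foliation. -/
theorem canonicalLift_isotropic {t : E → Discs F} {q : ∀ l, (t l).Param} {l : E}
    (h : AnalyticParamAt t q l) {x : S → ℂ} (hx : F.IsLeafCoord (t l).center x) (v w : E)
    {A B : E → ℂ⸨X⸩} (hA : A = fun m => toLaurent ((q m).pull (coord₁ (t l).center)))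
    (hB : B = fun m => toLaurent ((q m).pull (coord₂ (t l).center))) :
    (paramDeriv v A l + canonicalLift t q x v l * lderiv (A l)) *
        (paramDeriv w B l + canonicalLift t q x w l * lderiv (B l)) -
      (paramDeriv w A l + canonicalLift t q x w l * lderiv (A l)) *
        (paramDeriv v B l + canonicalLift t q x v l * lderiv (B l)) = 0 := by
  have hd := lderiv_pull (q l) hx.1
  have h0 : lderiv (toLaurent ((q l).pull x)) ≠ 0 := by
    rw [lderiv_toLaurent]
    exact hx.derivative_ne_zero (q l).1
  set x₁ := toLaurent ((q l).pull (partial₁ (t l).center x))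
  set x₂ := toLaurent ((q l).pull (partial₂ (t l).center x))
  -- By the chain rule, dx = x₁ da + x₂ db kills the lift of every direction.
  have hrel : ∀ v, x₁ * (paramDeriv v A l + canonicalLift t q x v l * lderiv (A l)) +
      x₂ * (paramDeriv v B l + canonicalLift t q x v l * lderiv (B l)) = 0 := by
    intro v
    have e := canonicalLift_eq (q := q) hx v
    rw [toLaurent_pullDeriv, h.paramDeriv_pull hx.1, ← lderiv_toLaurent, hd] at e
    subst hA hB
    linear_combination e
  -- The covector (x₁, x₂) is nonzero because x is not constant along the disc. Two vectors of a
  -- plane killed by it are proportional.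
  by_cases h1 : x₁ = 0
  · have h2 : x₂ ≠ 0 := by
      intro h2
      rw [h1, h2, zero_mul, zero_mul, add_zero] at hd
      exact h0 hd
    refine (mul_eq_zero.1 ?_).resolve_left h2
    linear_combination
      (paramDeriv v A l + canonicalLift t q x v l * lderiv (A l)) * hrel w -
      (paramDeriv w A l + canonicalLift t q x w l * lderiv (A l)) * hrel v
  · refine (mul_eq_zero.1 ?_).resolve_left h1
    linear_combination
      (paramDeriv w B l + canonicalLift t q x w l * lderiv (B l)) * hrel v -
      (paramDeriv v B l + canonicalLift t q x v l * lderiv (B l)) * hrel w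

/-- The derivative of a contracted symplectic form `h (∂_w a ∂_z b - ∂_z a ∂_w b)`. -/
theorem paramDeriv_contraction {H A B : E → ℂ⸨X⸩} {l : E} (hH : AnalyticFamilyAt H l)
    (hA : AnalyticFamilyAt A l) (hB : AnalyticFamilyAt B l) (v w : E) :
    paramDeriv v (fun m => H m * (paramDeriv w A m * lderiv (B m) -
        lderiv (A m) * paramDeriv w B m)) l =
      H l * ((paramDeriv w A l * lderiv (paramDeriv v B l) +
          lderiv (B l) * paramDeriv v (fun m => paramDeriv w A m) l) -
        (lderiv (A l) * paramDeriv v (fun m => paramDeriv w B m) l +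
          paramDeriv w B l * lderiv (paramDeriv v A l))) +
      (paramDeriv w A l * lderiv (B l) - lderiv (A l) * paramDeriv w B l) * paramDeriv v H l := by
  have h1 := (hA.paramDeriv w).mul hB.lderiv
  have h2 := hA.lderiv.mul (hB.paramDeriv w)
  rw [paramDeriv_mul hH (h1.sub h2), paramDeriv_sub h1 h2, paramDeriv_mul (hA.paramDeriv w)
    hB.lderiv, paramDeriv_mul hA.lderiv (hB.paramDeriv w), paramDeriv_lderiv hA,
    paramDeriv_lderiv hB]

/-- Two facts combine: the symplectic form vanishes on a pair of canonical lifts, and its pull-back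
to the total space of the family is closed. -/
theorem nabla_phiPull_comm (Ω : SymplecticForm S) {t : E → Discs F} {q : ∀ l, (t l).Param} {l : E}
    (hq : LocalParam t q l) (v w : E) :
    nabla t v (phiPull Ω t w) l = nabla t w (phiPull Ω t v) l := by
  obtain ⟨x, hx⟩ := F.exists_leafCoord (t l).center
  have hp := hq.self_of_nhds
  have hH := hp.analyticFamilyAt (Ω.isAnalyticAt_density (t l).center)
  have hA := hp.analyticFamilyAt (isAnalyticAt_coord₁ (t l).center)
  have hB := hp.analyticFamilyAt (isAnalyticAt_coord₂ (t l).center)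
  have hHv := fun v => hp.paramDeriv_pull (Ω.isAnalyticAt_density (t l).center) v
  have hHz := lderiv_pull (q l) (Ω.isAnalyticAt_density (t l).center)
  have hiso := canonicalLift_isotropic hp hx v w rfl rfl
  have hphi : ∀ v, ∀ᶠ m in 𝓝 l, (phiPull Ω t v m).coord (q m) = _ := fun v => by
    filter_upwards [eventually_coord_phiPull Ω hq v] with m hm
    exact hm.trans (toLaurent_symplecticCoeff Ω t q (t l).center v m)
  refine HFiber.ext_coord (q l) ?_
  rw [coord_nabla (analyticSectionAt_phiPull Ω t l w) hq (isCanonicalLift_canonicalLift hp hx v),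
    coord_nabla (analyticSectionAt_phiPull Ω t l v) hq (isCanonicalLift_canonicalLift hp hx w),
    lieDeriv, lieDeriv, paramDeriv_congr (hphi v), paramDeriv_congr (hphi w),
    (hphi v).self_of_nhds, (hphi w).self_of_nhds, paramDeriv_contraction hH hA hB,
    paramDeriv_contraction hH hA hB, paramDeriv_comm hA v w, paramDeriv_comm hB v w]
  set uv := canonicalLift t q x v l
  set uw := canonicalLift t q x w l
  set H : E → ℂ⸨X⸩ := fun m => toLaurent ((q m).pull (Ω.density (t l).center)) with hHdef
  set A : E → ℂ⸨X⸩ := fun m => toLaurent ((q m).pull (coord₁ (t l).center)) with hAdef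
  set B : E → ℂ⸨X⸩ := fun m => toLaurent ((q m).pull (coord₂ (t l).center)) with hBdef
  -- Isotropy expanded: u_v φ(w) − u_w φ(v) is the value of the form on the velocities ∂_v and ∂_w,
  -- the terms with u_v u_w cancelling.
  have hωvw : uv * (H l * (paramDeriv w A l * lderiv (B l) - lderiv (A l) * paramDeriv w B l)) =
      uw * (H l * (paramDeriv v A l * lderiv (B l) - lderiv (A l) * paramDeriv v B l)) +
        H l * (paramDeriv v A l * paramDeriv w B l - paramDeriv w A l * paramDeriv v B l) := by
    linear_combination (-(H l)) * hiso
  have hd := congrArg lderiv hωvw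
  rw [map_add, lderiv_mul (H l), map_sub, lderiv_mul (paramDeriv v A l),
    lderiv_mul (paramDeriv w A l)] at hd
  have hv := hHv v
  have hw := hHv w
  have hz : lderiv (H l) = _ := hHz
  change lderiv (uv * (H l * _)) = lderiv (uw * (H l * _)) + _ at hd
  change _ + lderiv (uv * (H l * _)) = _ + lderiv (uw * (H l * _))
  -- Writing the derivatives of h through its partials in a and b leaves a polynomial identity: dh ∧
  -- da ∧ db vanishes on ∂_v, ∂_w, ∂_z.
  rw [hd, hv, hw, hz]
  ring

theorem phiCovariantlyClosed (Ω : SymplecticForm S) {U : Set E} {t : E → Discs F}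
    (ht : IsAnalyticFamily U t) : PhiCovariantlyClosed Ω U t where
  existsUnique_velocity l hl v := by
    obtain ⟨q, hq⟩ := ht l hl
    obtain ⟨ξ, hξ⟩ := exists_isVelocity hq v
    exact ⟨ξ, hξ, fun ξ' hξ' => hξ'.unique hq hξ⟩
  linear l hl a v w :=
    let ⟨_, hq⟩ := ht l hl
    phiPull_smul_add Ω hq a v w
  analytic v l _ := analyticSectionAt_phiPull Ω t l v
  closed l hl v w :=
    let ⟨_, hq⟩ := ht l hl
    nabla_phiPull_comm Ω hq v w

end Surface

end FormalDiscs

theorem theorem6p1p3 {S : Type*} [TopologicalSpace S] [ChartedSpace (ℂ × ℂ) S]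
    [IsManifold 𝓘(ℂ, ℂ × ℂ) ω S]
    (Ω : FormalDiscs.SymplecticForm S) (F : FormalDiscs.Foliation S) :
    (∀ t : FormalDiscs.Discs F, FormalDiscs.PhiLagrangianEmbedding Ω t) ∧
    ∀ (n : ℕ) (U : Set (EuclideanSpace ℂ (Fin n))) (t : EuclideanSpace ℂ (Fin n) →
      FormalDiscs.Discs F), IsOpen U → FormalDiscs.IsAnalyticFamily U t →
        FormalDiscs.InducesFlatSymplecticConnection U t ∧
        FormalDiscs.PhiCovariantlyClosed Ω U t := by
  refine ⟨FormalDiscs.phiLagrangianEmbedding Ω, fun n U t hU ht => ⟨?_, ?_⟩⟩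
  · exact FormalDiscs.inducesFlatSymplecticConnection hU ht
  · exact FormalDiscs.phiCovariantlyClosed Ω ht
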